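/- Let $d\in\{2,3\}$ and let $\Omega\subset\mathbb{R}^d$ be a bounded domain (nonempty, open, connected) with Lipschitz boundary. Boldface denotes spaces of $\mathbb{R}^d$-valued functions, $(\cdot,\cdot)$ denotes the $L^2(\Omega)$, $\mathbf{L}^2(\Omega)$ or $L^2(\Omega)^{d\times d}$ inner product, and $L^2_0(\Omega)$ is the set of functions in $L^2(\Omega)$ with mean value zero; $\mathbf{H}^{-1}(\Omega)$ is the dual of $\mathbf{H}^1_0(\Omega)$. Let $$\mathcal{U}=\{u\in L^\infty(\Omega):\ \exists\, c>0,\ u(x)>c \text{ for a.e. } x\in\Omega\},$$ regarded with the $L^\infty(\Omega)$-topology. For $\mathbf{f}\in\mathbf{H}^{-1}(\Omega)$ and $u\in\mathcal{U}$ let $\mathcal{S}(u)=(\mathbf{y},\mathsf{p})\in\mathbf{H}^1_0(\Omega)\times L^2_0(\Omega)$ be the (unique) solution of the Stokes--Brinkman equations $$(\nabla\mathbf{y},\nabla\mathbf{v})+(u\mathbf{y},\mathbf{v})-(\mathsf{p},\operatorname{div}\mathbf{v})=\langle\mathbf{f},\mathbf{v}\rangle,\qquad (\mathsf{q},\operatorname{div}\mathbf{y})=0\qquad\forall\,(\mathbf{v},\mathsf{q})\in\mathbf{H}^1_0(\Omega)\times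 L^2_0(\Omega).$$ For $\alpha>0$ and $\mathbf{y}_\Omega\in\mathbf{L}^2(\Omega)$ define the reduced cost $j:\mathcal{U}\to[0,\infty)$ by $$j(u)=\tfrac12\|\mathbf{y}-\mathbf{y}_\Omega\|_{\mathbf{L}^2(\Omega)}^2+\tfrac{\alpha}{2}\|u\|_{L^2(\Omega)}^2,\qquad (\mathbf{y},\mathsf{p})=\mathcal{S}(u),$$ and, for $0<a<b$, let $\mathbb{U}_{ad}=\{u\in L^2(\Omega): a\le u\le b \text{ a.e. in }\Omega\}\subset\mathcal{U}$. **Theorem.** There is a function $\mathfrak{D}:\mathbb{R}^2\to(0,\infty)$, depending only on $\Omega$, such that the following holds for all $\mathbf{f}\in\mathbf{H}^{-1}(\Omega)$, $\mathbf{y}_\Omega\in\mathbf{L}^2(\Omega)$, $\alpha>0$ and $0<a<b$. 1. For every $u\in\mathcal{U}$ the state equations have exactly one solution, so that $\mathcal{S}$ and $j$ are well defined, and $j$ is of class $C^2$ on $\mathcal{U}$ (in particular at every point of $\mathbb{U}_{ad}$). 2. For every $u\in\mathbb{U}_{ad}$ the map $\mathcal{S}$ is Fréchet differentiable at $u$;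 the adjoint equations $$(\nabla\mathbf{v},\nabla\mathbf{z})+(u\mathbf{z},\mathbf{v})+(\mathsf{r},\operatorname{div}\mathbf{v})=(\mathbf{y}-\mathbf{y}_\Omega,\mathbf{v}),\qquad(\mathsf{s},\operatorname{div}\mathbf{z})=0\qquad\forall\,(\mathbf{v},\mathsf{s})\in\mathbf{H}^1_0(\Omega)\times L^2_0(\Omega),$$ where $(\mathbf{y},\mathsf{p})=\mathcal{S}(u)$, have exactly one solution $(\mathbf{z},\mathsf{r})\in\mathbf{H}^1_0(\Omega)\times L^2_0(\Omega)$; and for every $v\in L^\infty(\Omega)$, with $(\boldsymbol{\varphi},\zeta)=\mathcal{S}'(u)v$, $$j''(u)v^2=\alpha\|v\|_{L^2(\Omega)}^2-2(v\boldsymbol{\varphi},\mathbf{z})+\|\boldsymbol{\varphi}\|_{\mathbf{L}^2(\Omega)}^2.$$ 3. For all $u_1,u_2\in\mathbb{U}_{ad}$ and $v\in L^\infty(\Omega)$, $$|j''(u_1)v^2-j''(u_2)v^2|\le \mathfrak{D}\big(\|\mathbf{f}\|_{\mathbf{H}^{-1}(\Omega)},\|\mathbf{y}_\Omega\|_{\mathbf{L}^2(\Omega)}\big)\,\|u_1-u_2\|_{L^2(\Omega)}\,\|v\|_{L^2(\Omega)}^2.$$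 -/

import Mathlib

open MeasureTheory Topology
open scoped ENNReal ContDiff

noncomputable section

namespace StokesBrinkman

/-- The Euclidean space `ℝᵈ`. -/
abbrev Vec (d : ℕ) : Type := EuclideanSpace ℝ (Fin d)

/-- `d × d` matrices with the Frobenius inner product; values of velocity gradients. -/
abbrev Mat (d : ℕ) : Type := EuclideanSpace ℝ (Fin d × Fin d)

/-- `Ω` has a Lipschitz boundary: near each boundary point and after a rotation, `Ω` is the set of
points that lie strictly above the graph of a Lipschitz function. Here `e` is the vertical
direction, `y - ⟪e, y⟫ e` is the horizontal part of `y` and `⟪e, y⟫` is its height. -/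
def HasLipschitzBoundary {d : ℕ} (Ω : Set (Vec d)) : Prop :=
  ∀ x ∈ frontier Ω, ∃ (e : Vec d) (K : NNReal) (g : Vec d → ℝ), ‖e‖ = 1 ∧ LipschitzWith K g ∧
    ∀ᶠ y in 𝓝 x, (y ∈ Ω ↔ g (y - inner ℝ e y • e) < inner ℝ e y)

/-- A bounded domain (nonempty, open, connected) of `ℝᵈ` with Lipschitz boundary. -/
structure LipschitzDomain (d : ℕ) where
  carrier : Set (Vec d)
  isOpen : IsOpen carrier
  isConnected : IsConnected carrier
  isBounded : Bornology.IsBounded carrier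
  hasLipschitzBoundary : HasLipschitzBoundary carrier

variable {d : ℕ}

/-- Lebesgue measure on `Ω`. -/
def LipschitzDomain.vol (Ω : LipschitzDomain d) : Measure (Vec d) := volume.restrict Ω.carrier

instance (Ω : LipschitzDomain d) : IsFiniteMeasure Ω.vol :=
  ⟨by simpa [LipschitzDomain.vol] using Ω.isBounded.measure_lt_top⟩

/-- `L²(Ω)` (scalar). -/
abbrev L2 (Ω : LipschitzDomain d) : Type := Lp ℝ 2 Ω.vol

/-- `𝐋²(Ω)` (vector valued). -/
abbrev L2Vec (Ω : LipschitzDomain d) : Type := Lp (Vec d) 2 Ω.vol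

/-- `L^∞(Ω)`. -/
abbrev LInf (Ω : LipschitzDomain d) : Type := Lp ℝ ∞ Ω.vol

/-- `L²₀(Ω)`: the functions of `L²(Ω)` with mean value zero. -/
def L20 (Ω : LipschitzDomain d) : Submodule ℝ (L2 Ω) where
  carrier := {q | ∫ x, q x ∂Ω.vol = 0}
  zero_mem' := by
    have h : ∫ x, (0 : L2 Ω) x ∂Ω.vol = ∫ _, (0 : ℝ) ∂Ω.vol := integral_congr_ae (Lp.coeFn_zero ..)
    simpa using h
  add_mem' := by
    intro p q hp hq
    simp only [Set.mem_ofPred_eq] at hp hq ⊢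
    rw [integral_congr_ae (Lp.coeFn_add p q)]
    simp only [Pi.add_apply]
    rw [integral_add ((Lp.memLp p).integrable (by norm_num))
      ((Lp.memLp q).integrable (by norm_num)), hp, hq, add_zero]
  smul_mem' := by
    intro c q hq
    simp only [Set.mem_ofPred_eq] at hq ⊢
    rw [integral_congr_ae (Lp.coeFn_smul c q)]
    simp only [Pi.smul_apply, smul_eq_mul]
    rw [integral_const_mul, hq, mul_zero]

/-- The classical gradient (Jacobian matrix) `(∇φ)ᵢⱼ = ∂ⱼ φᵢ` of a differentiable vector field. -/
def jacobian (φ : Vec d → Vec d) (x : Vec d) : Mat d :=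
  WithLp.toLp 2 fun ij => fderiv ℝ φ x (EuclideanSpace.single ij.2 1) ij.1

/-- The Hilbert space `𝐋²(Ω) × L²(Ω)^{d × d}` that contains all pairs `(𝐯, ∇𝐯)`, `𝐯 ∈ 𝐇¹(Ω)`. Its norm
restricts to the `𝐇¹` norm `(‖𝐯‖² + ‖∇𝐯‖²)^{1/2}` on these pairs. -/
abbrev GraphSpace (Ω : LipschitzDomain d) : Type :=
  WithLp 2 (L2Vec Ω × Lp (Mat d) 2 Ω.vol)

/-- The pairs `(φ, ∇φ)` with `φ ∈ C_c^∞(Ω; ℝᵈ)`. -/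
def testFields (Ω : LipschitzDomain d) : Submodule ℝ (GraphSpace Ω) where
  carrier := {w | ∃ φ : Vec d → Vec d, ContDiff ℝ ∞ φ ∧ HasCompactSupport φ ∧
    tsupport φ ⊆ Ω.carrier ∧ w.fst =ᵐ[Ω.vol] φ ∧ w.snd =ᵐ[Ω.vol] jacobian φ}
  zero_mem' := by
    refine ⟨0, contDiff_const, HasCompactSupport.zero, by simp [tsupport], Lp.coeFn_zero .., ?_⟩
    have h : jacobian (0 : Vec d → Vec d) = 0 := by
      funext x; ext ij; simp [jacobian]
    rw [h]
    exact Lp.coeFn_zero ..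
  add_mem' := by
    rintro w w' ⟨φ, h1, h2, h3, h4, h5⟩ ⟨φ', h1', h2', h3', h4', h5'⟩
    refine ⟨φ + φ', h1.add h1', h2.add h2', ?_, ?_, ?_⟩
    · exact (tsupport_add φ φ').trans (Set.union_subset h3 h3')
    · exact (Lp.coeFn_add w.fst w'.fst).trans (h4.add h4')
    · refine (Lp.coeFn_add w.snd w'.snd).trans ((h5.add h5').trans (Filter.EventuallyEq.of_eq ?_))
      funext x; ext ij
      simp [jacobian, fderiv_add (h1.differentiable (by simp) x) (h1'.differentiable (by simp) x)]
  smul_mem' := by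
    rintro c w ⟨φ, h1, h2, h3, h4, h5⟩
    refine ⟨c • φ, h1.const_smul c, h2.comp_left (g := fun y => c • y) (smul_zero c), ?_, ?_, ?_⟩
    · exact (closure_mono (Function.support_const_smul_subset c φ)).trans h3
    · exact (Lp.coeFn_smul c w.fst).trans (h4.const_smul c)
    · refine (Lp.coeFn_smul c w.snd).trans ((h5.const_smul c).trans (Filter.EventuallyEq.of_eq ?_))
      funext x; ext ij
      simp [jacobian, fderiv_const_smul (h1.differentiable (by simp) x)]

/-- `𝐇¹₀(Ω)`, the closure of `C_c^∞(Ω; ℝᵈ)` in the `𝐇¹` norm. An element is stored as the pair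
`(𝐯, ∇𝐯)` of a function and its weak gradient. -/
abbrev H10 (Ω : LipschitzDomain d) : Submodule ℝ (GraphSpace Ω) := (testFields Ω).topologicalClosure

/-- The function `𝐯 ∈ 𝐋²(Ω)` underlying an element of `𝐇¹₀(Ω)`. -/
def vel {Ω : LipschitzDomain d} (v : H10 Ω) : L2Vec Ω := (v : GraphSpace Ω).fst

/-- The weak gradient `∇𝐯`. -/
def grad {Ω : LipschitzDomain d} (v : H10 Ω) : Lp (Mat d) 2 Ω.vol := (v : GraphSpace Ω).snd

/-- The weak divergence `div 𝐯`. -/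
def div {Ω : LipschitzDomain d} (v : H10 Ω) (x : Vec d) : ℝ := ∑ i, grad v x (i, i)

/-- `𝐇⁻¹(Ω)`, the dual of `𝐇¹₀(Ω)` with the dual norm. -/
abbrev HNeg (Ω : LipschitzDomain d) : Type := H10 Ω →L[ℝ] ℝ

/-- `(w 𝐲, 𝐯)_{𝐋²(Ω)} = ∫_Ω w 𝐲 · 𝐯` for a scalar coefficient `w ∈ L^∞(Ω)`. -/
def weighted {Ω : LipschitzDomain d} (w : LInf Ω) (y v : H10 Ω) : ℝ :=
  ∫ x, w x * inner ℝ (vel y x) (vel v x) ∂Ω.vol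

/-- `(q, div 𝐯)_{L²(Ω)}`. -/
def pairDiv {Ω : LipschitzDomain d} (q : L2 Ω) (v : H10 Ω) : ℝ :=
  ∫ x, q x * div v x ∂Ω.vol

/-- `(𝐲, 𝗉)` is a weak solution of the Stokes--Brinkman equations with coefficient `u` and force
`f`. -/
def IsState {Ω : LipschitzDomain d} (f : HNeg Ω) (u : LInf Ω) (yp : H10 Ω × L20 Ω) : Prop :=
  (∀ v : H10 Ω, inner ℝ (grad yp.1) (grad v) + weighted u yp.1 v - pairDiv yp.2 v = f v) ∧
    ∀ q : L20 Ω, pairDiv q yp.1 = 0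

/-- The set `𝒰` of the essentially bounded functions that are bounded below by a positive
constant. -/
def coefficients (Ω : LipschitzDomain d) : Set (LInf Ω) :=
  {u | ∃ c : ℝ, 0 < c ∧ ∀ᵐ x ∂Ω.vol, c < u x}

/-- The admissible controls `𝕌_ad`: the functions with `a ≤ u ≤ b` almost everywhere (they
all belong to `L^∞(Ω)`). -/
def admissible (Ω : LipschitzDomain d) (a b : ℝ) : Set (LInf Ω) :=
  {u | ∀ᵐ x ∂Ω.vol, a ≤ u x ∧ u x ≤ b}

open Classical in
/-- The control-to-state map `𝒮 : 𝒰 → 𝐇¹₀(Ω) × L²₀(Ω)`, which sends `u` to the solution of the state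
equations; the value `0` is used where there is no solution. -/
def controlToState {Ω : LipschitzDomain d} (f : HNeg Ω) (u : LInf Ω) : H10 Ω × L20 Ω :=
  if h : ∃ yp, IsState f u yp then h.choose else 0

/-- The `L²(Ω)` norm of a function of `L^∞(Ω)`. -/
def normL2 {Ω : LipschitzDomain d} (u : LInf Ω) : ℝ := (eLpNorm u 2 Ω.vol).toReal

/-- The cost `J(𝐲, u) = ½ ‖𝐲 - 𝐲_Ω‖² + (α / 2) ‖u‖²`. -/
def cost {Ω : LipschitzDomain d} (α : ℝ) (yΩ : L2Vec Ω) (y : H10 Ω) (u : LInf Ω) : ℝ :=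
  1 / 2 * ‖vel y - yΩ‖ ^ 2 + α / 2 * normL2 u ^ 2

/-- The reduced cost `j(u) = J(𝒢 u, u)`, where `𝒢 u` is the velocity component of `𝒮 u`. -/
def reducedCost {Ω : LipschitzDomain d} (α : ℝ) (f : HNeg Ω) (yΩ : L2Vec Ω) (u : LInf Ω) : ℝ :=
  cost α yΩ (controlToState f u).1 u

/-- `(𝐳, 𝗋)` is a weak solution of the adjoint equations for the control `u`. -/
def IsAdjoint {Ω : LipschitzDomain d} (f : HNeg Ω) (yΩ : L2Vec Ω) (u : LInf Ω)
    (zr : H10 Ω × L20 Ω) : Prop :=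
  (∀ v : H10 Ω, inner ℝ (grad v) (grad zr.1) + weighted u zr.1 v + pairDiv zr.2 v
      = inner ℝ (vel (controlToState f u).1 - yΩ) (vel v)) ∧
    ∀ s : L20 Ω, pairDiv s zr.1 = 0

/-- `F''(u) v²`, the second Fréchet derivative of `F` at `u` in the direction `(v, v)`, with respect
to the `L^∞(Ω)` norm. -/
def secondDeriv {Ω : LipschitzDomain d} (F : LInf Ω → ℝ) (u v : LInf Ω) : ℝ :=
  fderiv ℝ (fderiv ℝ F) u v v

end StokesBrinkman

end

open StokesBrinkman

open MeasureTheory Topology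
open scoped ENNReal ContDiff

noncomputable section

namespace StokesBrinkman

/-! ### Continuous linear maps on `𝐇¹₀(Ω)` -/

section

variable {d : ℕ} {Ω : LipschitzDomain d}

/-! The state and adjoint equations are saddle point problems for the symmetric form `(∇y, ∇v) + (u
y, v)`, coercive for `u ≥ 0` by Poincaré's inequality, and the divergence `𝐇¹₀(Ω) → L²₀(Ω)`. If the
divergence is surjective, Brezzi's theorem (`saddle_bijective`) makes the operator invertible. It is
affine in `u`, and inversion is smooth on the open set of invertible operators, so `𝒮` and `j` are
`C²` (`contDiffAt_of_forall_saddle_eq`).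

Surjectivity of the divergence (`exists_divL_eq_of_meanL_eq_zero`) is the deep ingredient. Near each
point of the closure of `Ω` there are a set `E` and a bump `η` such that all segments from `E` to
the support of `η` stay in `Ω`; at the boundary this uses the Lipschitz graph. A density `f` in `E`
is carried to `(∫ f) η` along these segments, and the time integral of the mass flux is a field with
divergence `f - (∫ f) η`. Its gradient is bounded in `L²` by `‖f‖`
(`exists_lintegral_pairing_fderiv_transport_le`). For times `s < 1/2` this is a Fourier estimate:
the multiplier is at most a constant times `|ξ| / (1 + s²|ξ|²)`, whose integral over `s` is at most
`π` for every `ξ`. For `s ≥ 1/2` the derivative falls on the smooth target at bounded cost. Hence,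
modulo divergences, a locally supported function is its mean times a local class. Connectedness
makes this class the same everywhere, and compactness then shows that functions of mean zero are
divergences.

For the second derivative, differentiate the state equation twice: `η = 𝒮''(u)v²` solves the state
operator with right side `-2 (v φ, ·)`. Testing the adjoint equation with `η` replaces `(y - y_Ω,
η)` by `-2 (v φ, z)` (`second_fderiv_reduced`).

For the Lipschitz bound, the embedding of `𝐇¹₀` in `𝐋⁴`, valid for `d = 2, 3`, gives `|(w y, v)| ≤ C
‖w‖_{L²} ‖∇y‖ ‖∇v‖` (`exists_weighted_le`). This is how `L²` norms appear although derivatives are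
taken in `L^∞`. Energy estimates for states, linearized states, adjoints and their differences then
combine in `abs_second_sub_le`. They use only `u ≥ 0`, so the constant does not see `a`, `b` or `α`.
-/

instance : CompleteSpace (H10 Ω) :=
  (Submodule.isClosed_topologicalClosure (testFields Ω)).completeSpace_coe

/-- `v ↦ 𝐯` as a continuous linear map. -/
def velL (Ω : LipschitzDomain d) : H10 Ω →L[ℝ] L2Vec Ω :=
  (WithLp.fstL 2 ℝ (L2Vec Ω) (Lp (Mat d) 2 Ω.vol)).comp (H10 Ω).subtypeL

/-- `v ↦ ∇𝐯` as a continuous linear map. -/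
def gradL (Ω : LipschitzDomain d) : H10 Ω →L[ℝ] Lp (Mat d) 2 Ω.vol :=
  (WithLp.sndL 2 ℝ (L2Vec Ω) (Lp (Mat d) 2 Ω.vol)).comp (H10 Ω).subtypeL

lemma grad_eq_gradL (v : H10 Ω) : grad v = gradL Ω v := rfl

/-- The trace of a matrix. -/
def matTrace (d : ℕ) : Mat d →L[ℝ] ℝ := ∑ i, EuclideanSpace.proj (i, i)

lemma matTrace_apply (A : Mat d) : matTrace d A = ∑ i, A (i, i) := by
  simp [matTrace]

/-- The divergence as a continuous linear map into `L²(Ω)`. -/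
def divL (Ω : LipschitzDomain d) : H10 Ω →L[ℝ] L2 Ω :=
  ((matTrace d).compLpL 2 Ω.vol).comp (gradL Ω)

lemma coeFn_divL (v : H10 Ω) : divL Ω v =ᵐ[Ω.vol] div v := by
  filter_upwards [(matTrace d).coeFn_compLpL (gradL Ω v)] with x hx
  exact hx.trans (matTrace_apply _)

lemma pairDiv_eq (q : L2 Ω) (v : H10 Ω) : pairDiv q v = inner ℝ (divL Ω v) q := by
  rw [L2.inner_def, pairDiv]
  refine integral_congr_ae ?_
  filter_upwards [coeFn_divL v] with x hx
  simp [hx]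

lemma norm_sq_eq (v : H10 Ω) : ‖v‖ ^ 2 = ‖vel v‖ ^ 2 + ‖grad v‖ ^ 2 :=
  WithLp.prod_norm_sq_eq_of_L2 (v : GraphSpace Ω)

lemma norm_vel_le (v : H10 Ω) : ‖vel v‖ ≤ ‖v‖ := by
  have := norm_sq_eq v
  exact abs_le_of_sq_le_sq' (by nlinarith [sq_nonneg ‖grad v‖]) (norm_nonneg _) |>.2

/-- `φ` is a test field on `Ω`. -/
structure IsTestField (Ω : LipschitzDomain d) (φ : Vec d → Vec d) : Prop where
  smooth : ContDiff ℝ ∞ φ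
  compact : HasCompactSupport φ
  subset : tsupport φ ⊆ Ω.carrier

lemma continuous_jacobian {φ : Vec d → Vec d} (hφ : ContDiff ℝ ∞ φ) : Continuous (jacobian φ) := by
  refine (PiLp.continuous_toLp 2 _).comp (continuous_pi fun ij => ?_)
  have h := (hφ.continuous_fderiv (by simp)).clm_apply
    (continuous_const (y := (EuclideanSpace.single ij.2 1 : Vec d)))
  exact (EuclideanSpace.proj (𝕜 := ℝ) ij.1).continuous.comp h

lemma hasCompactSupport_jacobian {φ : Vec d → Vec d} (hφ : HasCompactSupport φ) :
    HasCompactSupport (jacobian φ) := by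
  refine (hφ.fderiv ℝ).mono fun x hx => ?_
  contrapose! hx
  simp only [Function.mem_support, not_not] at hx ⊢
  ext ij; simp [jacobian, hx]

lemma IsTestField.memLp {φ : Vec d → Vec d} (h : IsTestField Ω φ) (p : ℝ≥0∞) : MemLp φ p Ω.vol :=
  h.smooth.continuous.memLp_of_hasCompactSupport h.compact

lemma IsTestField.memLp_jacobian {φ : Vec d → Vec d} (h : IsTestField Ω φ) (p : ℝ≥0∞) :
    MemLp (jacobian φ) p Ω.vol :=
  (continuous_jacobian h.smooth).memLp_of_hasCompactSupport (hasCompactSupport_jacobian h.compact)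

/-- The element of `𝐇¹₀(Ω)` given by a test field. -/
def IsTestField.toH10 {φ : Vec d → Vec d} (h : IsTestField Ω φ) : H10 Ω :=
  ⟨WithLp.toLp 2
    ((h.memLp 2).toLp φ, (h.memLp_jacobian 2).toLp (jacobian φ)),
    Submodule.le_topologicalClosure _ ⟨φ, h.smooth, h.compact, h.subset,
      (h.memLp 2).coeFn_toLp, (h.memLp_jacobian 2).coeFn_toLp⟩⟩

lemma IsTestField.vel_toH10 {φ : Vec d → Vec d} (h : IsTestField Ω φ) :
    vel h.toH10 =ᵐ[Ω.vol] φ := (h.memLp 2).coeFn_toLp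

lemma IsTestField.grad_toH10 {φ : Vec d → Vec d} (h : IsTestField Ω φ) :
    grad h.toH10 =ᵐ[Ω.vol] jacobian φ := (h.memLp_jacobian 2).coeFn_toLp

/-- A closed property of elements of `𝐇¹₀(Ω)` that holds for the test fields holds always. -/
lemma H10.induction {P : H10 Ω → Prop} (hP : IsClosed {v | P v})
    (h : ∀ (φ : Vec d → Vec d) (hφ : IsTestField Ω φ), P hφ.toH10) (v : H10 Ω) : P v := by
  have hd : Dense {v : H10 Ω | (v : GraphSpace Ω) ∈ testFields Ω} := by
    intro v
    rw [closure_subtype]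
    refine closure_mono ?_ v.2
    intro w hw
    exact ⟨⟨w, Submodule.le_topologicalClosure _ hw⟩, hw, rfl⟩
  refine hP.closure_subset_iff.2 ?_ (hd v)
  rintro w ⟨φ, h1, h2, h3, h4, h5⟩
  have hφ : IsTestField Ω φ := ⟨h1, h2, h3⟩
  have : w = hφ.toH10 := by
    refine Subtype.ext ((WithLp.ofLp_injective 2) (Prod.ext ?_ ?_))
    · exact Lp.ext (h4.trans hφ.vel_toH10.symm)
    · exact Lp.ext (h5.trans hφ.grad_toH10.symm)
  rw [this]
  exact h φ hφ

/-- Multiplication by a function in `L^∞(Ω)`. -/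
def mulInf (Ω : LipschitzDomain d) : LInf Ω →L[ℝ] L2Vec Ω →L[ℝ] L2Vec Ω :=
  (ContinuousLinearMap.lsmul ℝ ℝ).holderL Ω.vol ∞ 2 2

lemma coeFn_mulInf (w : LInf Ω) (y : L2Vec Ω) :
    mulInf Ω w y =ᵐ[Ω.vol] fun x => w x • y x :=
  (ContinuousLinearMap.lsmul ℝ ℝ).coeFn_holder (r := 2) w y

lemma weighted_eq (w : LInf Ω) (y v : H10 Ω) :
    weighted w y v = inner ℝ (mulInf Ω w (velL Ω y)) (velL Ω v) := by
  rw [L2.inner_def, weighted]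
  refine integral_congr_ae ?_
  filter_upwards [coeFn_mulInf w (velL Ω y)] with x hx
  rw [hx, real_inner_smul_left]; rfl

lemma weighted_comm (w : LInf Ω) (y v : H10 Ω) : weighted w y v = weighted w v y := by
  simp only [weighted, real_inner_comm]

end

/-! ### Poincaré and Sobolev inequalities -/

section

variable {d : ℕ} {Ω : LipschitzDomain d}

/-- The standard basis vectors of `ℝᵈ`. -/
abbrev stdVec (i : Fin d) : Vec d := EuclideanSpace.single i 1

/-- The coordinate functionals of `ℝᵈ`. -/
def coordL (i : Fin d) : Vec d →L[ℝ] ℝ := EuclideanSpace.proj i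

lemma jacobian_apply {φ : Vec d → Vec d} (hφ : ContDiff ℝ ∞ φ) (x : Vec d) (i j : Fin d) :
    jacobian φ x (i, j) = fderiv ℝ (fun x => φ x i) x (stdVec j) := by
  have h := (((coordL i).hasFDerivAt).comp x
    (hφ.differentiable (by simp) x).hasFDerivAt).fderiv
  change _ = fderiv ℝ (coordL i ∘ φ) x _
  rw [h]; rfl

lemma contDiff_component {φ : Vec d → Vec d} (hφ : ContDiff ℝ ∞ φ) (i : Fin d) :
    ContDiff ℝ ∞ fun x => φ x i :=
  (coordL i).contDiff.comp hφ

lemma hasCompactSupport_component {φ : Vec d → Vec d} (hφ : HasCompactSupport φ) (i : Fin d) :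
    HasCompactSupport fun x => φ x i :=
  hφ.comp_left (g := fun y : Vec d => y i) rfl

lemma IsTestField.jacobian_eq_zero {φ : Vec d → Vec d} (h : IsTestField Ω φ) {x : Vec d}
    (hx : x ∉ Ω.carrier) : jacobian φ x = 0 := by
  ext ij
  simp [jacobian, fderiv_of_notMem_tsupport ℝ fun hx' => hx (h.subset hx')]

/-- Integration by parts, one coordinate at a time. The compact support of `φ` removes all boundary
terms, so `ψ` may be a constant, as in `meanL_divL`. -/
lemma IsTestField.integral_mul_div {φ : Vec d → Vec d} (h : IsTestField Ω φ) {ψ : Vec d → ℝ}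
    (hψ : ContDiff ℝ ∞ ψ) :
    ∫ x, ψ x * matTrace d (jacobian φ x) ∂Ω.vol
      = - ∫ x, ∑ i, φ x i * fderiv ℝ ψ x (stdVec i) := by
  have hs : ∀ x ∉ Ω.carrier, ψ x * matTrace d (jacobian φ x) = 0 := fun x hx => by
    rw [h.jacobian_eq_zero hx]; simp
  rw [LipschitzDomain.vol, setIntegral_eq_integral_of_forall_compl_eq_zero hs]
  have hc := fun i => contDiff_component h.smooth i
  have hcc := fun i => hasCompactSupport_component h.compact i
  have hψ' : ∀ i : Fin d, Continuous fun x => fderiv ℝ ψ x (stdVec i) := fun i =>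
    (hψ.continuous_fderiv (by simp)).clm_apply continuous_const
  have hφ' : ∀ i : Fin d, Continuous fun x => fderiv ℝ (fun x => φ x i) x (stdVec i) := fun i =>
    ((hc i).continuous_fderiv (by simp)).clm_apply continuous_const
  have i1 : ∀ i : Fin d, Integrable fun x => fderiv ℝ ψ x (stdVec i) * φ x i := fun i =>
    ((hψ' i).mul (hc i).continuous).integrable_of_hasCompactSupport (hcc i).mul_left
  have i2 : ∀ i : Fin d, Integrable fun x => ψ x * fderiv ℝ (fun x => φ x i) x (stdVec i) :=
    fun i => (hψ.continuous.mul (hφ' i)).integrable_of_hasCompactSupport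
      ((hcc i).fderiv_apply (𝕜 := ℝ) _).mul_left
  have i3 : ∀ i : Fin d, Integrable fun x => ψ x * φ x i := fun i =>
    (hψ.continuous.mul (hc i).continuous).integrable_of_hasCompactSupport (hcc i).mul_left
  simp only [matTrace_apply, jacobian_apply h.smooth, Finset.mul_sum]
  simp only [mul_comm (φ _ _)]
  rw [integral_finsetSum _ fun i _ => i2 i, integral_finsetSum _ fun i _ => i1 i,
    ← Finset.sum_neg_distrib]
  exact Finset.sum_congr rfl fun i _ => integral_mul_fderiv_eq_neg_fderiv_mul_of_integrable
    (i1 i) (i2 i) (i3 i) (fun x _ => hψ.differentiable (by simp) x)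
    (fun x _ => (hc i).differentiable (by simp) x)

lemma divL_toH10 {φ : Vec d → Vec d} (h : IsTestField Ω φ) :
    divL Ω h.toH10 =ᵐ[Ω.vol] fun x => matTrace d (jacobian φ x) := by
  filter_upwards [coeFn_divL h.toH10, h.grad_toH10] with x hx hx'
  rw [hx, div, hx', matTrace_apply]

/-- The integral over `Ω` as a continuous linear functional on `L²(Ω)`. -/
def meanL (Ω : LipschitzDomain d) : L2 Ω →L[ℝ] ℝ :=
  innerSL ℝ ((memLp_const (1 : ℝ)).toLp (fun _ : Vec d => (1 : ℝ)) : L2 Ω)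

lemma meanL_apply (q : L2 Ω) : meanL Ω q = ∫ x, q x ∂Ω.vol := by
  rw [meanL, innerSL_apply_apply, L2.inner_def]
  refine integral_congr_ae ?_
  filter_upwards [(memLp_const (1 : ℝ)).coeFn_toLp (p := 2) (μ := Ω.vol)] with x hx
  rw [hx]; simp

/-- The easy half of the description of the range of the divergence: integrate by parts against the
constant `1`, then pass to the closure. -/
lemma meanL_divL (v : H10 Ω) : meanL Ω (divL Ω v) = 0 := by
  refine H10.induction (P := fun v => meanL Ω (divL Ω v) = 0)
    (isClosed_eq ((meanL Ω).comp (divL Ω)).continuous continuous_const) (fun φ hφ => ?_) v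
  have h := hφ.integral_mul_div (ψ := fun _ => 1) contDiff_const
  simp only [one_mul] at h
  rw [meanL_apply, integral_congr_ae (divL_toH10 hφ), h]
  simp

lemma mem_L20 {q : L2 Ω} : q ∈ L20 Ω ↔ meanL Ω q = 0 := by
  rw [meanL_apply]; rfl

/-- Cauchy–Schwarz in each row. It connects the operator norm in the Sobolev inequality with the
Frobenius norm used for gradients. -/
lemma norm_fderiv_le_jacobian {φ : Vec d → Vec d} (x : Vec d) :
    ‖fderiv ℝ φ x‖ ≤ ‖jacobian φ x‖ := by
  refine ContinuousLinearMap.opNorm_le_bound _ (norm_nonneg _) fun v => ?_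
  refine abs_le_of_sq_le_sq' ?_ (by positivity) |>.2
  rw [mul_pow, EuclideanSpace.norm_sq_eq, EuclideanSpace.norm_sq_eq, EuclideanSpace.norm_sq_eq,
    Fintype.sum_prod_type, Finset.sum_mul]
  refine Finset.sum_le_sum fun i _ => ?_
  have hv : fderiv ℝ φ x v i = ∑ j, jacobian φ x (i, j) * v j := by
    conv_lhs => rw [← (EuclideanSpace.basisFun (Fin d) ℝ).sum_repr v]
    simp [jacobian, mul_comm]
  rw [hv]
  simp only [Real.norm_eq_abs, sq_abs]
  exact Finset.sum_mul_sq_le_sq_mul_sq _ _ _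

/-- The Sobolev inequality `‖φ‖_{L⁴} ≤ C ‖∇φ‖_{L²}` for test fields in dimensions two and three. -/
theorem exists_sobolev_test (hd : d = 2 ∨ d = 3) (Ω : LipschitzDomain d) :
    ∃ C : NNReal, ∀ φ : Vec d → Vec d, IsTestField Ω φ →
      eLpNorm φ 4 Ω.vol ≤ C * eLpNorm (jacobian φ) 2 Ω.vol := by
  -- The exponent with `1/p - 1/d = 1/4`, whose Sobolev conjugate is `4`. For `d = 2, 3` it
  -- satisfies `1 ≤ p ≤ 2` and `p < d`, so Hölder on the bounded set `Ω` passes from `L^p` to `L²`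
  -- with the constant `c`.
  obtain ⟨p, hp⟩ : ∃ p : NNReal, p = 4 * d / (d + 4) := ⟨_, rfl⟩
  have hp1 : 1 ≤ p ∧ p < d ∧ p ≤ 2 ∧ (p : ℝ)⁻¹ - (d : ℝ)⁻¹ ≤ ((4 : NNReal) : ℝ)⁻¹ := by
    rw [hp]
    refine ⟨?_, ?_, ?_, ?_⟩ <;> rcases hd with rfl | rfl
    · rw [one_le_div₀] <;> norm_num
    · rw [one_le_div₀] <;> norm_num
    · rw [div_lt_iff₀] <;> norm_num
    · rw [div_lt_iff₀] <;> norm_num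
    · rw [div_le_iff₀] <;> norm_num
    · rw [div_le_iff₀] <;> norm_num
    · norm_num
    · norm_num
  obtain ⟨c, hc, hc'⟩ : ∃ c : ℝ≥0∞, c = Ω.vol Set.univ ^ (1 / (p : ℝ) - 1 / 2) ∧ c ≠ ⊤ := by
    refine ⟨_, rfl, ENNReal.rpow_ne_top_of_nonneg ?_ (measure_ne_top _ _)⟩
    have h0 : (0 : ℝ) < p := lt_of_lt_of_le one_pos (by exact_mod_cast hp1.1)
    rw [sub_nonneg]
    exact one_div_le_one_div_of_le h0 (by exact_mod_cast hp1.2.2.1)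
  refine ⟨eLpNormLESNormFDerivOfLeConst (Vec d) (volume : Measure (Vec d)) Ω.carrier p 4 *
    c.toNNReal, fun φ hφ => ?_⟩
  have hs : Function.support φ ⊆ Ω.carrier := (subset_tsupport _).trans hφ.subset
  have hs' : Function.support (jacobian φ) ⊆ Ω.carrier := fun x hx => by
    by_contra h; exact hx (hφ.jacobian_eq_zero h)
  have h1 := eLpNorm_le_eLpNorm_fderiv_of_le (volume : Measure (Vec d))
    (hφ.smooth.of_le (by simp)) hs (p := p) (q := 4) hp1.1
    (by rw [finrank_euclideanSpace_fin]; exact hp1.2.1)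
    (by rw [finrank_euclideanSpace_fin]; exact hp1.2.2.2) Ω.isBounded
  have h2 : eLpNorm (fderiv ℝ φ) p volume ≤ eLpNorm (jacobian φ) p Ω.vol := by
    rw [LipschitzDomain.vol, eLpNorm_restrict_eq_of_support_subset hs']
    exact eLpNorm_mono fun x => norm_fderiv_le_jacobian x
  have h3 : eLpNorm (jacobian φ) p Ω.vol ≤ eLpNorm (jacobian φ) 2 Ω.vol * c := by
    have := eLpNorm_le_eLpNorm_mul_rpow_measure_univ (μ := Ω.vol) (f := jacobian φ)
      (p := p) (q := 2) (by exact_mod_cast hp1.2.2.1)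
      (continuous_jacobian hφ.smooth).aestronglyMeasurable
    rw [hc]
    exact this
  rw [LipschitzDomain.vol, eLpNorm_restrict_eq_of_support_subset hs, ← LipschitzDomain.vol]
  refine (h1.trans (mul_le_mul_right (h2.trans h3) _)).trans_eq ?_
  rw [ENNReal.coe_mul, ENNReal.coe_toNNReal hc']
  ring

instance : ENNReal.HolderTriple 4 4 2 :=
  ⟨by rw [← two_mul, show (4 : ℝ≥0∞) = 2 * 2 by norm_num,
    ENNReal.mul_inv (by simp) (by simp), ← mul_assoc,
    ENNReal.mul_inv_cancel (by simp) (by simp), one_mul]⟩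

lemma IsTestField.norm_grad_toH10 {φ : Vec d → Vec d} (h : IsTestField Ω φ) :
    ENNReal.ofReal ‖grad h.toH10‖ = eLpNorm (jacobian φ) 2 Ω.vol := by
  rw [ofReal_norm, Lp.enorm_def, eLpNorm_congr_ae h.grad_toH10]

lemma IsTestField.norm_vel_toH10 {φ : Vec d → Vec d} (h : IsTestField Ω φ) :
    ENNReal.ofReal ‖vel h.toH10‖ = eLpNorm φ 2 Ω.vol := by
  rw [ofReal_norm, Lp.enorm_def, eLpNorm_congr_ae h.vel_toH10]

/-- The Poincaré inequality in `𝐇¹₀(Ω)`. -/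
theorem exists_poincare (hd : d = 2 ∨ d = 3) (Ω : LipschitzDomain d) :
    ∃ C : ℝ, 0 < C ∧ ∀ v : H10 Ω, ‖vel v‖ ≤ C * ‖grad v‖ := by
  obtain ⟨C, hC⟩ := exists_sobolev_test hd Ω
  -- Here `c = |Ω|^{1/4}` is the norm of the inclusion of `L⁴(Ω)` in `L²(Ω)`; Poincaré follows from
  -- the Sobolev inequality.
  obtain ⟨c, hc⟩ : ∃ c : NNReal, (c : ℝ≥0∞) = Ω.vol Set.univ ^ (1 / (2 : ℝ) - 1 / 4) := by
    refine ⟨_, ENNReal.coe_toNNReal (ENNReal.rpow_ne_top_of_nonneg ?_ (measure_ne_top _ _))⟩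
    norm_num
  refine ⟨c * C + 1, by positivity, fun v => ?_⟩
  refine H10.induction (P := fun v => ‖vel v‖ ≤ (c * C + 1) * ‖grad v‖)
    (isClosed_le (velL Ω).continuous.norm (continuous_const.mul (gradL Ω).continuous.norm))
    (fun φ hφ => ?_) v
  have h1 := eLpNorm_le_eLpNorm_mul_rpow_measure_univ (μ := Ω.vol) (f := φ)
    (p := 2) (q := 4) (by norm_num) hφ.smooth.continuous.aestronglyMeasurable
  have e : (1 / (2 : ℝ≥0∞).toReal - 1 / (4 : ℝ≥0∞).toReal : ℝ) = 1 / 2 - 1 / 4 := by norm_num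
  rw [e, ← hc] at h1
  have h2 : ENNReal.ofReal ‖vel hφ.toH10‖ ≤ ENNReal.ofReal (c * C * ‖grad hφ.toH10‖) := by
    rw [ENNReal.ofReal_mul (by positivity), hφ.norm_vel_toH10, hφ.norm_grad_toH10,
      ENNReal.ofReal_mul (by positivity), ENNReal.ofReal_coe_nnreal, ENNReal.ofReal_coe_nnreal]
    refine (h1.trans (mul_le_mul_left (hC φ hφ) _)).trans_eq ?_
    ring
  rw [ENNReal.ofReal_le_ofReal_iff (by positivity)] at h2
  nlinarith [norm_nonneg (grad hφ.toH10)]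

lemma memLp_two (w : LInf Ω) : MemLp w 2 Ω.vol := (Lp.memLp w).mono_exponent le_top

lemma normL2_nonneg (w : LInf Ω) : 0 ≤ normL2 w := ENNReal.toReal_nonneg

/-- The bound of the weighted product by the `L²` norm of the weight. -/
theorem exists_weighted_le (hd : d = 2 ∨ d = 3) (Ω : LipschitzDomain d) :
    ∃ C : ℝ, 0 < C ∧ ∀ (w : LInf Ω) (y v : H10 Ω),
      |weighted w y v| ≤ C * normL2 w * ‖grad y‖ * ‖grad v‖ := by
  obtain ⟨C, hC⟩ := exists_sobolev_test hd Ω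
  -- Hölder with exponents `2, 4, 4` and two Sobolev inequalities give the constant `C * C`; the `1`
  -- only makes it positive.
  refine ⟨C * C + 1, by positivity, fun w y v => ?_⟩
  have hnn : 0 ≤ normL2 w * ‖grad y‖ * ‖grad v‖ :=
    mul_nonneg (mul_nonneg (normL2_nonneg w) (norm_nonneg _)) (norm_nonneg _)
  suffices |weighted w y v| ≤ C * C * normL2 w * ‖grad y‖ * ‖grad v‖ by nlinarith
  clear hnn
  -- For fixed `w ∈ L^∞` both sides are continuous in `y` and in `v` separately, so density of the
  -- test fields may be used in one variable after the other.
  revert v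
  have c1 : ∀ v, Continuous fun y => |weighted w y v| := fun v => by
    simp only [weighted_eq]
    exact (((mulInf Ω w).comp (velL Ω)).continuous.inner continuous_const).abs
  have c2 : ∀ y, Continuous fun v => |weighted w y v| := fun y => by
    simp only [weighted_eq]
    exact (continuous_const.inner (velL Ω).continuous).abs
  refine H10.induction (P := fun y => ∀ v,
    |weighted w y v| ≤ C * C * normL2 w * ‖grad y‖ * ‖grad v‖) ?_ (fun φ hφ => ?_) y
  · rw [show {y : H10 Ω | ∀ v, |weighted w y v| ≤ C * C * normL2 w * ‖grad y‖ * ‖grad v‖}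
      = ⋂ v, {y | |weighted w y v| ≤ C * C * normL2 w * ‖grad y‖ * ‖grad v‖} by
        ext; simp only [Set.mem_ofPred_eq, Set.mem_iInter]]
    exact isClosed_iInter fun v => isClosed_le (c1 v)
      ((continuous_const.mul (gradL Ω).continuous.norm).mul continuous_const)
  refine H10.induction (isClosed_le (c2 _)
    (continuous_const.mul (gradL Ω).continuous.norm)) (fun ψ hψ => ?_)
  have h0 : weighted w hφ.toH10 hψ.toH10 = ∫ x, w x * inner ℝ (φ x) (ψ x) ∂Ω.vol := by
    refine integral_congr_ae ?_
    filter_upwards [hφ.vel_toH10, hψ.vel_toH10] with x h1 h2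
    rw [h1, h2]
  have hm1 : AEStronglyMeasurable φ Ω.vol := hφ.smooth.continuous.aestronglyMeasurable
  have hm2 : AEStronglyMeasurable ψ Ω.vol := hψ.smooth.continuous.aestronglyMeasurable
  have e1 : eLpNorm (fun x => inner ℝ (φ x) (ψ x)) 2 Ω.vol
      ≤ eLpNorm φ 4 Ω.vol * eLpNorm ψ 4 Ω.vol := by
    have := eLpNorm_le_eLpNorm_mul_eLpNorm_of_nnnorm (p := 4) (q := 4) (r := 2) hm1 hm2
      (fun a b => (inner ℝ a b : ℝ)) 1 (.of_forall fun x => by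
        rw [one_mul]; exact nnnorm_inner_le_nnnorm _ _)
    simpa using this
  have e2 : eLpNorm (fun x => w x * inner ℝ (φ x) (ψ x)) 1 Ω.vol
      ≤ eLpNorm w 2 Ω.vol * eLpNorm (fun x => inner ℝ (φ x) (ψ x)) 2 Ω.vol := by
    have := eLpNorm_le_eLpNorm_mul_eLpNorm_of_nnnorm (p := 2) (q := 2) (r := 1)
      (memLp_two w).1 (hm1.inner (𝕜 := ℝ) hm2) (fun a b : ℝ => a * b) 1
      (.of_forall fun x => by rw [one_mul, nnnorm_mul])
    simpa using this
  have h2 : ENNReal.ofReal |weighted w hφ.toH10 hψ.toH10| ≤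
      ENNReal.ofReal (C * C * normL2 w * ‖grad hφ.toH10‖ * ‖grad hψ.toH10‖) := by
    have hw := normL2_nonneg w
    rw [ENNReal.ofReal_mul (by positivity), ENNReal.ofReal_mul (by positivity),
      ENNReal.ofReal_mul (by positivity), ENNReal.ofReal_mul (by positivity),
      hφ.norm_grad_toH10, hψ.norm_grad_toH10, ENNReal.ofReal_coe_nnreal, normL2,
      ENNReal.ofReal_toReal (memLp_two w).eLpNorm_ne_top, ← Real.norm_eq_abs, ofReal_norm, h0]
    refine (enorm_integral_le_lintegral_enorm _).trans ?_
    rw [← eLpNorm_one_eq_lintegral_enorm]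
    refine (e2.trans (mul_le_mul_right (e1.trans (mul_le_mul' (hC φ hφ) (hC ψ hψ))) _)).trans_eq ?_
    ring
  have hw := normL2_nonneg w
  exact (ENNReal.ofReal_le_ofReal_iff (by positivity)).1 h2

end

/-! ### Dilations and transport of densities -/

section

variable {d : ℕ}

open scoped Convolution FourierTransform

/-- The push-forward of the density `Φ` under the dilation `x ↦ s x`. -/
def dilate (s : ℝ) (Φ : Vec d → ℝ) (x : Vec d) : ℝ := (s ^ d)⁻¹ * Φ (s⁻¹ • x)

/-- The push-forward of the density `Φ(a) G(y)` under `(a, y) ↦ s a + (1 - s) y`. -/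
def transport (Φ G : Vec d → ℝ) (s : ℝ) : Vec d → ℝ :=
  dilate s Φ ⋆[ContinuousLinearMap.mul ℝ ℝ, volume] dilate (1 - s) G

lemma contDiff_dilate {Φ : Vec d → ℝ} (hΦ : ContDiff ℝ ∞ Φ) (s : ℝ) : ContDiff ℝ ∞ (dilate s Φ) :=
  contDiff_const.mul (hΦ.comp (contDiff_const_smul _))

lemma hasCompactSupport_dilate {Φ : Vec d → ℝ} (hΦ : HasCompactSupport Φ) {s : ℝ} (hs : s ≠ 0) :
    HasCompactSupport (dilate s Φ) :=
  (hΦ.comp_homeomorph (Homeomorph.smulOfNeZero s⁻¹ (inv_ne_zero hs))).mul_left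

lemma integral_dilate_smul {F : Type*} [NormedAddCommGroup F] [NormedSpace ℝ F]
    (Φ : Vec d → ℝ) {s : ℝ} (hs : 0 < s) (g : Vec d → F) :
    ∫ x, dilate s Φ x • g x = ∫ x, Φ x • g (s • x) := by
  have h := Measure.integral_comp_inv_smul_of_nonneg (volume : Measure (Vec d))
    (fun x => Φ x • g (s • x)) hs.le
  simp only [smul_smul, mul_inv_cancel₀ hs.ne', one_smul, finrank_euclideanSpace_fin] at h
  simp only [dilate, mul_smul]
  rw [integral_smul, h, smul_smul, inv_mul_cancel₀ (by positivity), one_smul]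

lemma integrable_dilate {Φ : Vec d → ℝ} (hΦ : ContDiff ℝ ∞ Φ) (hΦc : HasCompactSupport Φ) {s : ℝ}
    (hs : s ≠ 0) : Integrable (dilate s Φ) :=
  (contDiff_dilate hΦ s).continuous.integrable_of_hasCompactSupport (hasCompactSupport_dilate hΦc hs)

lemma contDiff_transport {Φ G : Vec d → ℝ} (hΦ : ContDiff ℝ ∞ Φ) (hΦc : HasCompactSupport Φ)
    (hG : ContDiff ℝ ∞ G) (hGc : HasCompactSupport G) {s : ℝ} (hs : s ∈ Set.Ioo (0 : ℝ) 1) :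
    ContDiff ℝ ∞ (transport Φ G s) :=
  (hasCompactSupport_dilate hΦc hs.1.ne').contDiff_convolution_left _ (contDiff_dilate hΦ s)
    (integrable_dilate hG hGc (sub_pos.2 hs.2).ne').locallyIntegrable

lemma hasCompactSupport_transport {Φ G : Vec d → ℝ} (hΦc : HasCompactSupport Φ)
    (hGc : HasCompactSupport G) {s : ℝ} (hs : s ∈ Set.Ioo (0 : ℝ) 1) :
    HasCompactSupport (transport Φ G s) :=
  (hasCompactSupport_dilate hΦc hs.1.ne').convolution _
    (hasCompactSupport_dilate hGc (sub_pos.2 hs.2).ne')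

lemma support_transport_subset (Φ G : Vec d → ℝ) {s : ℝ} (hs : s ∈ Set.Ioo (0 : ℝ) 1) :
    Function.support (transport Φ G s) ⊆
      (fun p : Vec d × Vec d => s • p.1 + (1 - s) • p.2) '' (tsupport Φ ×ˢ tsupport G) := by
  refine (support_convolution_subset _).trans ?_
  rintro _ ⟨a, ha, b, hb, rfl⟩
  have h1 : (1 - s) ≠ 0 := (sub_pos.2 hs.2).ne'
  refine ⟨(s⁻¹ • a, (1 - s)⁻¹ • b), ⟨subset_tsupport _ (right_ne_zero_of_mul ha),
    subset_tsupport _ (right_ne_zero_of_mul hb)⟩, ?_⟩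
  simp [smul_smul, mul_inv_cancel₀ hs.1.ne', mul_inv_cancel₀ h1]

lemma tsupport_transport_subset {Φ G : Vec d → ℝ} (hΦc : HasCompactSupport Φ)
    (hGc : HasCompactSupport G) {s : ℝ} (hs : s ∈ Set.Ioo (0 : ℝ) 1) :
    tsupport (transport Φ G s) ⊆
      (fun p : Vec d × Vec d => s • p.1 + (1 - s) • p.2) '' (tsupport Φ ×ˢ tsupport G) :=
  closure_minimal (support_transport_subset Φ G hs)
    ((hΦc.isCompact.prod hGc.isCompact).image (by fun_prop)).isClosed

/-- The push-forward property behind the convolution formula: if `a` and `y` are independent with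
densities `Φ` and `G`, then `s a` and `(1 - s) y` have the dilated densities and their sum has the
convolution. The proof is Fubini and a change of variables. -/
lemma integral_transport_mul {Φ G : Vec d → ℝ} (hΦ : ContDiff ℝ ∞ Φ) (hΦc : HasCompactSupport Φ)
    (hG : ContDiff ℝ ∞ G) (hGc : HasCompactSupport G) {s : ℝ} (hs : s ∈ Set.Ioo (0 : ℝ) 1)
    {ψ : Vec d → ℝ} (hψ : Continuous ψ) {C : ℝ} (hC : ∀ x, ‖ψ x‖ ≤ C) :
    ∫ x, transport Φ G s x * ψ x = ∫ a, Φ a * ∫ y, G y * ψ (s • a + (1 - s) • y) := by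
  have h1 : 0 < 1 - s := sub_pos.2 hs.2
  have hint := (integrable_dilate hΦ hΦc hs.1.ne').convolution_integrand
    (ContinuousLinearMap.mul ℝ ℝ) (integrable_dilate hG hGc h1.ne')
  have hint' : Integrable (fun p : Vec d × Vec d =>
      dilate s Φ p.2 * dilate (1 - s) G (p.1 - p.2) * ψ p.1) (volume.prod volume) := by
    refine Integrable.mul_bdd (c := C) hint
      (hψ.comp continuous_fst).aestronglyMeasurable (.of_forall fun p => hC _)
  calc ∫ x, transport Φ G s x * ψ x
      = ∫ x, ∫ t, dilate s Φ t * dilate (1 - s) G (x - t) * ψ x := by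
        refine integral_congr_ae (.of_forall fun x => ?_)
        simp only [transport, convolution_def, ContinuousLinearMap.mul_apply']
        rw [← integral_mul_const]
    _ = ∫ t, ∫ x, dilate s Φ t * dilate (1 - s) G (x - t) * ψ x :=
        integral_integral_swap hint'
    _ = ∫ t, dilate s Φ t • ∫ z, dilate (1 - s) G z • ψ (t + z) := by
        refine integral_congr_ae (.of_forall fun t => ?_)
        simp only [mul_assoc, smul_eq_mul]
        rw [integral_const_mul,
          ← integral_add_left_eq_self (fun x => dilate (1 - s) G (x - t) * ψ x) t]
        simp
    _ = _ := by
        rw [integral_dilate_smul Φ hs.1 fun t => ∫ z, dilate (1 - s) G z • ψ (t + z)]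
        refine integral_congr_ae (.of_forall fun a => ?_)
        simp only [smul_eq_mul]
        congr 1
        exact integral_dilate_smul G h1 fun z => ψ (s • a + z)

lemma fderiv_dilate {Φ : Vec d → ℝ} (s : ℝ) (x v : Vec d) :
    fderiv ℝ (dilate s Φ) x v = s⁻¹ * dilate s (fun x => fderiv ℝ Φ x v) x := by
  have : dilate s Φ = (s ^ d)⁻¹ • fun x => Φ (s⁻¹ • x) := rfl
  rw [this, fderiv_const_smul_field, Pi.smul_apply, fderiv_comp_smul]
  simp [dilate]; ring

lemma contDiff_fderiv_apply {Φ : Vec d → ℝ} (hΦ : ContDiff ℝ ∞ Φ) (v : Vec d) :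
    ContDiff ℝ ∞ fun x => fderiv ℝ Φ x v :=
  (hΦ.fderiv_right (m := ∞) (by simp)).clm_apply contDiff_const

lemma hasCompactSupport_fderiv_apply {Φ : Vec d → ℝ} (hΦ : HasCompactSupport Φ) (v : Vec d) :
    HasCompactSupport fun x => fderiv ℝ Φ x v :=
  hΦ.fderiv_apply (𝕜 := ℝ) v

/-- The derivative is put on the factor `Φ`, so no derivative of `G` is needed. The dilation costs
`s⁻¹`, which is harmless for `s ≥ 1/2` but not integrable at `0`. -/
lemma fderiv_transport {Φ G : Vec d → ℝ} (hΦ : ContDiff ℝ ∞ Φ) (hΦc : HasCompactSupport Φ)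
    (hG : ContDiff ℝ ∞ G) (hGc : HasCompactSupport G) {s : ℝ} (hs : s ∈ Set.Ioo (0 : ℝ) 1)
    (x v : Vec d) :
    fderiv ℝ (transport Φ G s) x v = s⁻¹ * transport (fun x => fderiv ℝ Φ x v) G s x := by
  have hg := integrable_dilate hG hGc (sub_pos.2 hs.2).ne'
  have h := ((hasCompactSupport_dilate hΦc hs.1.ne').hasFDerivAt_convolution_left
    (ContinuousLinearMap.mul ℝ ℝ) ((contDiff_dilate hΦ s).of_le (by simp)) hg.locallyIntegrable x)
  have h1 : ConvolutionExistsAt (fderiv ℝ (dilate s Φ)) (dilate (1 - s) G) x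
      ((ContinuousLinearMap.mul ℝ ℝ).precompL (Vec d)) volume :=
    HasCompactSupport.convolutionExists_left _ ((hasCompactSupport_dilate hΦc hs.1.ne').fderiv ℝ)
      ((contDiff_dilate hΦ s).continuous_fderiv (by simp)) hg.locallyIntegrable x
  have h2 : fderiv ℝ (transport Φ G s) x =
      (fderiv ℝ (dilate s Φ) ⋆[(ContinuousLinearMap.mul ℝ ℝ).precompL (Vec d), volume]
        dilate (1 - s) G) x := h.fderiv
  rw [h2, convolution_def, ContinuousLinearMap.integral_apply h1.integrable, transport,
    convolution_def, ← integral_const_mul]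
  refine integral_congr_ae (.of_forall fun t => ?_)
  simp [ContinuousLinearMap.precompL_apply, fderiv_dilate]
  ring

end

/-! ### The Fourier transform of a real density -/

section

variable {d : ℕ}

open scoped Convolution FourierTransform

/-- The Fourier transform of a real-valued function. -/
def fourierReal (Φ : Vec d → ℝ) (ξ : Vec d) : ℂ := 𝓕 (fun x => (Φ x : ℂ)) ξ

/-- A real test function as a complex Schwartz function. -/
def testSchwartz {Φ : Vec d → ℝ} (hΦ : ContDiff ℝ ∞ Φ) (hΦc : HasCompactSupport Φ) :
    SchwartzMap (Vec d) ℂ :=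
  HasCompactSupport.toSchwartzMap (f := fun x => (Φ x : ℂ))
    (hΦc.comp_left Complex.ofReal_zero) (Complex.ofRealCLM.contDiff.comp hΦ)

lemma testSchwartz_apply {Φ : Vec d → ℝ} (hΦ : ContDiff ℝ ∞ Φ) (hΦc : HasCompactSupport Φ)
    (x : Vec d) : testSchwartz hΦ hΦc x = Φ x := rfl

lemma fourier_testSchwartz {Φ : Vec d → ℝ} (hΦ : ContDiff ℝ ∞ Φ) (hΦc : HasCompactSupport Φ)
    (ξ : Vec d) : 𝓕 (testSchwartz hΦ hΦc) ξ = fourierReal Φ ξ := rfl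

lemma fourierReal_dilate (Φ : Vec d → ℝ) {s : ℝ} (hs : 0 < s) (ξ : Vec d) :
    fourierReal (dilate s Φ) ξ = fourierReal Φ (s • ξ) := by
  simp only [fourierReal, Real.fourier_eq]
  have h := integral_dilate_smul Φ hs fun x => ((Real.fourierChar (-inner ℝ x ξ) : Circle) : ℂ)
  simp only [Circle.smul_def, smul_eq_mul, Complex.real_smul, inner_smul_left,
    inner_smul_right, conj_trivial] at h ⊢
  simp only [mul_comm _ (Complex.ofReal _)]
  exact h

lemma fourierReal_transport {Φ G : Vec d → ℝ} (hΦ : ContDiff ℝ ∞ Φ) (hΦc : HasCompactSupport Φ)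
    (hG : ContDiff ℝ ∞ G) (hGc : HasCompactSupport G) {s : ℝ} (hs : s ∈ Set.Ioo (0 : ℝ) 1)
    (ξ : Vec d) :
    fourierReal (transport Φ G s) ξ = fourierReal Φ (s • ξ) * fourierReal G ((1 - s) • ξ) := by
  have h1 : 0 < 1 - s := sub_pos.2 hs.2
  have i1 : Integrable fun x => (dilate s Φ x : ℂ) := (integrable_dilate hΦ hΦc hs.1.ne').ofReal
  have i2 : Integrable fun x => (dilate (1 - s) G x : ℂ) :=
    (integrable_dilate hG hGc h1.ne').ofReal
  rw [← fourierReal_dilate Φ hs.1, ← fourierReal_dilate G h1, fourierReal, fourierReal,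
    fourierReal, ← Real.fourier_mul_convolution_eq i1 i2]
  refine congrArg (fun g : Vec d → ℂ => 𝓕 g ξ) (funext fun x => ?_)
  simp only [transport, convolution_def, ContinuousLinearMap.mul_apply']
  rw [← integral_complex_ofReal]
  simp

lemma fourierReal_fderiv {Φ : Vec d → ℝ} (hΦ : ContDiff ℝ ∞ Φ) (hΦc : HasCompactSupport Φ)
    (v ξ : Vec d) :
    fourierReal (fun x => fderiv ℝ Φ x v) ξ
      = (2 * Real.pi * Complex.I) * (inner ℝ ξ v * fourierReal Φ ξ) := by
  open LineDeriv in
  have h := congrArg (fun f : SchwartzMap (Vec d) ℂ => f ξ)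
    (SchwartzMap.fourier_lineDerivOp_eq (testSchwartz hΦ hΦc) v)
  have ht : (inner ℝ · v : Vec d → ℝ).HasTemperateGrowth := ((innerSL ℝ).flip v).hasTemperateGrowth
  simp only [smul_apply, SchwartzMap.smulLeftCLM_apply_apply ht, smul_eq_mul,
    Complex.real_smul, fourier_testSchwartz] at h
  rw [← h]
  simp only [SchwartzMap.fourier_coe, fourierReal]
  refine congrArg (fun g : Vec d → ℂ => 𝓕 g ξ) (funext fun x => ?_)
  rw [SchwartzMap.lineDerivOp_apply_eq_fderiv]
  have := (Complex.ofRealCLM.hasFDerivAt.comp x (hΦ.differentiable (by simp) x).hasFDerivAt).fderiv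
  change _ = fderiv ℝ (Complex.ofRealCLM ∘ Φ) x v
  rw [this]; simp

/-- Decay of the Fourier transform of a test function. -/
lemma exists_fourierReal_le {Φ : Vec d → ℝ} (hΦ : ContDiff ℝ ∞ Φ) (hΦc : HasCompactSupport Φ) :
    ∃ C : ℝ, 0 < C ∧ ∀ ξ, ‖fourierReal Φ ξ‖ ≤ C / (1 + ‖ξ‖ ^ 2) := by
  obtain ⟨C, hC, h⟩ := (𝓕 (testSchwartz hΦ hΦc)).decay 0 0
  obtain ⟨C', hC', h'⟩ := (𝓕 (testSchwartz hΦ hΦc)).decay 2 0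
  refine ⟨C + C', by positivity, fun ξ => ?_⟩
  have a := h ξ
  have b := h' ξ
  simp only [norm_iteratedFDeriv_zero, pow_zero, one_mul, fourier_testSchwartz] at a b
  rw [le_div_iff₀ (by positivity)]
  linarith

/-- The modulus of the Fourier transform of a real square integrable function. -/
lemma exists_fourier_modulus {h : Vec d → ℝ} (hh : MemLp h 2) :
    ∃ H : Vec d → ℝ≥0∞, Measurable H ∧ eLpNorm H 2 = eLpNorm h 2 ∧
      ∀ g : Vec d → ℝ, ContDiff ℝ ∞ g → HasCompactSupport g →
        ‖∫ x, h x * g x‖ₑ ≤ ∫⁻ ξ, H ξ * ‖fourierReal g ξ‖ₑ := by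
  have hc : MemLp (fun x => (h x : ℂ)) 2 := hh.ofReal
  -- `H` is the modulus of the Plancherel transform of `h`; the bound is Parseval's identity against
  -- the Schwartz function `g`.
  set F := 𝓕 (hc.toLp _) with hF
  refine ⟨fun ξ => ‖F ξ‖ₑ, (Lp.stronglyMeasurable F).enorm, ?_, fun g hg hgc => ?_⟩
  · rw [eLpNorm_enorm, ← Lp.enorm_def, hF, ← ofReal_norm, Lp.norm_fourier_eq, ofReal_norm,
      Lp.enorm_def, eLpNorm_congr_ae hc.coeFn_toLp]
    exact eLpNorm_congr_norm_ae (.of_forall fun x => by simp)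
  · set S := testSchwartz hg hgc
    have h1 := Lp.inner_fourier_eq (hc.toLp _) (S.toLp 2)
    rw [SchwartzMap.toLp_fourier_eq, L2.inner_def, L2.inner_def] at h1
    have h2 : (∫ x, inner ℂ ((hc.toLp _ : Lp ℂ 2 volume) x) ((S.toLp 2 : Lp ℂ 2 volume) x))
        = ((∫ x, h x * g x : ℝ) : ℂ) := by
      rw [← integral_complex_ofReal]
      refine integral_congr_ae ?_
      filter_upwards [hc.coeFn_toLp, S.coeFn_toLp 2] with x hx hx'
      rw [hx, hx']
      simp [S, testSchwartz_apply, mul_comm]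
    have h3 : ‖∫ x, h x * g x‖ₑ = ‖((∫ x, h x * g x : ℝ) : ℂ)‖ₑ := by
      simp [← ofReal_norm]
    rw [h3, ← h2, ← h1]
    refine (enorm_integral_le_lintegral_enorm _).trans (lintegral_mono_ae ?_)
    filter_upwards [(𝓕 S).coeFn_toLp 2] with ξ hξ
    rw [hξ, fourier_testSchwartz, ← hF]
    rw [← ofReal_norm, ← ofReal_norm, ← ofReal_norm, ← ENNReal.ofReal_mul (norm_nonneg _)]
    exact ENNReal.ofReal_le_ofReal (norm_inner_le_norm _ _)

end

/-! ### Integrals over dilations -/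

section

variable {d : ℕ}

lemma lintegral_smul_eq (f : Vec d → ℝ≥0∞) {c : ℝ} (hc : 0 < c) :
    ∫⁻ x, f (c • x) = ENNReal.ofReal (c ^ d)⁻¹ * ∫⁻ x, f x := by
  have h := lintegral_map_equiv (μ := (volume : Measure (Vec d))) f
    (Homeomorph.smulOfNeZero c hc.ne').toMeasurableEquiv
  have h2 : Measure.map (Homeomorph.smulOfNeZero (α := Vec d) c hc.ne').toMeasurableEquiv volume
      = ENNReal.ofReal (c ^ d)⁻¹ • volume := by
    have := Measure.map_addHaar_smul (volume : Measure (Vec d)) hc.ne'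
    rw [finrank_euclideanSpace_fin, abs_of_pos (by positivity)] at this
    exact this
  rw [h2, lintegral_smul_measure, smul_eq_mul] at h
  exact h.symm

lemma lintegral_enorm_dilate (G : Vec d → ℝ) {s : ℝ} (hs : 0 < s) :
    ∫⁻ x, ‖dilate s G x‖ₑ = ∫⁻ x, ‖G x‖ₑ := by
  simp only [dilate, enorm_mul]
  rw [lintegral_const_mul' _ _ enorm_ne_top,
    lintegral_smul_eq (fun x => ‖G x‖ₑ) (inv_pos.2 hs), ← mul_assoc, inv_pow, inv_inv,
    ← ofReal_norm, ← ENNReal.ofReal_mul (norm_nonneg _), Real.norm_of_nonneg (by positivity),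
    inv_mul_cancel₀ (by positivity), ENNReal.ofReal_one, one_mul]

/-- The weight `r / (1 + s² r²)`. -/
def cauchyWeight (s r : ℝ) : ℝ := r / (1 + (s * r) ^ 2)

lemma cauchyWeight_nonneg {s r : ℝ} (hr : 0 ≤ r) : 0 ≤ cauchyWeight s r := by
  unfold cauchyWeight; positivity

/-- The substitution `t = s r` turns this into the integral of `1 / (1 + t²)`. The factor `r` lost
to differentiation is recovered by integrating over `s`, uniformly in the frequency. -/
lemma lintegral_cauchyWeight_le {r : ℝ} (hr : 0 ≤ r) :
    ∫⁻ s, ENNReal.ofReal (cauchyWeight s r) ≤ ENNReal.ofReal Real.pi := by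
  rcases hr.eq_or_lt with rfl | hr
  · simp [cauchyWeight]
  have h1 : (fun s => cauchyWeight s r) = fun s => r * (1 + (s * r) ^ 2)⁻¹ := by
    funext s; rw [cauchyWeight, div_eq_mul_inv]
  have hi : Integrable fun s => cauchyWeight s r := by
    rw [h1]
    exact ((integrable_comp_mul_right_iff (fun x : ℝ => (1 + x ^ 2)⁻¹) hr.ne').2
      integrable_inv_one_add_sq).const_mul r
  rw [← ofReal_integral_eq_lintegral_ofReal hi (.of_forall fun s => cauchyWeight_nonneg hr.le), h1,
    integral_const_mul, Measure.integral_comp_mul_right (fun x : ℝ => (1 + x ^ 2)⁻¹) r,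
    integral_univ_inv_one_add_sq, abs_of_pos (inv_pos.2 hr), smul_eq_mul, ← mul_assoc,
    mul_inv_cancel₀ hr.ne', one_mul]

/-- With `r = (1 - s)‖ξ‖` this compares the weights at `ξ` and `(1 - s) ξ`: the numerator at most
doubles and the denominator does not decrease. -/
lemma cauchyWeight_inv_mul_le {s r : ℝ} (hr : 0 ≤ r) (hs : s ∈ Set.Ioo (0 : ℝ) (1 / 2)) :
    cauchyWeight s ((1 - s)⁻¹ * r) ≤ 2 * cauchyWeight s r := by
  have h0 : 0 < 1 - s := by linarith [hs.2]
  have h1 : 1 ≤ (1 - s)⁻¹ := (one_le_inv₀ h0).2 (by linarith [hs.1])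
  have h2 : (1 - s)⁻¹ ≤ 2 := by
    rw [inv_le_comm₀ h0 two_pos]; linarith [hs.2]
  unfold cauchyWeight
  rw [← mul_div_assoc]
  have h3 : r ≤ (1 - s)⁻¹ * r := le_mul_of_one_le_left hr h1
  have := hs.1.le
  gcongr

lemma measurable_cauchyWeight :
    Measurable fun p : ℝ × Vec d => ENNReal.ofReal (cauchyWeight p.1 ‖p.2‖) := by
  simp only [cauchyWeight]; fun_prop

lemma lintegral_prod_cauchyWeight_le {F : Vec d → ℝ≥0∞} (hF : Measurable F) (S : Set ℝ) :
    ∫⁻ p, F p.2 ^ 2 * ENNReal.ofReal (cauchyWeight p.1 ‖p.2‖)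
        ∂((volume.restrict S).prod (volume : Measure (Vec d)))
      ≤ ENNReal.ofReal Real.pi * ∫⁻ ξ, F ξ ^ 2 := by
  have hm : Measurable fun p : ℝ × Vec d =>
      F p.2 ^ 2 * ENNReal.ofReal (cauchyWeight p.1 ‖p.2‖) :=
    ((hF.comp measurable_snd).pow_const 2).mul measurable_cauchyWeight
  rw [lintegral_prod_symm' _ hm, mul_comm, ← lintegral_mul_const _ (hF.pow_const 2)]
  refine lintegral_mono fun ξ => ?_
  have hm' : Measurable fun s => ENNReal.ofReal (cauchyWeight s ‖ξ‖) := by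
    simp only [cauchyWeight]; fun_prop
  refine (lintegral_const_mul (μ := volume.restrict S) (F ξ ^ 2) hm').trans_le
    (mul_le_mul_right ?_ _)
  exact (setLIntegral_le_lintegral S _).trans (lintegral_cauchyWeight_le (norm_nonneg _))

/-- Cauchy–Schwarz on `(0, 1/2) × ℝᵈ`, with a square root of the weight given to each factor. Each
factor is then bounded by integrating the weight over `s` first. -/
lemma lintegral_cauchyWeight_mul_le {H K : Vec d → ℝ≥0∞} (hH : Measurable H) (hK : Measurable K) :
    ∫⁻ s in Set.Ioo (0 : ℝ) (1 / 2), ∫⁻ ξ,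
        H ξ * (ENNReal.ofReal (cauchyWeight s ‖ξ‖) * K ((1 - s) • ξ))
      ≤ (ENNReal.ofReal Real.pi * (2 * ENNReal.ofReal (2 ^ d))) * (eLpNorm H 2 * eLpNorm K 2) := by
  set μ := (volume.restrict (Set.Ioo (0 : ℝ) (1 / 2)))
  set W : ℝ → Vec d → ℝ≥0∞ := fun s ξ => ENNReal.ofReal (cauchyWeight s ‖ξ‖) with hW
  set V : ℝ → Vec d → ℝ≥0∞ := fun s ξ => ENNReal.ofReal (√(cauchyWeight s ‖ξ‖)) with hV
  have hVW : ∀ s ξ, V s ξ * V s ξ = W s ξ := fun s ξ => by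
    simp only [hV, hW]
    rw [← ENNReal.ofReal_mul (Real.sqrt_nonneg _),
      Real.mul_self_sqrt (cauchyWeight_nonneg (norm_nonneg _))]
  have hWm : Measurable (Function.uncurry W) := measurable_cauchyWeight
  have hVm : Measurable (Function.uncurry V) := by
    simp only [hV, cauchyWeight]; fun_prop
  have hK' : Measurable fun p : ℝ × Vec d => K ((1 - p.1) • p.2) := hK.comp (by fun_prop)
  have hH' : Measurable fun p : ℝ × Vec d => H p.2 := hH.comp measurable_snd
  have hnorm : ∀ F : Vec d → ℝ≥0∞, eLpNorm F 2 = (∫⁻ ξ, F ξ ^ 2) ^ (1 / 2 : ℝ) := fun F => by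
    rw [eLpNorm_eq_lintegral_rpow_enorm_toReal (by simp) (by simp)]
    simp
  have hsq : ∀ x y : ℝ≥0∞, (x * y) ^ (2 : ℝ) = x ^ 2 * (y * y) := fun x y => by
    rw [ENNReal.rpow_two]; ring
  have key := ENNReal.lintegral_mul_le_Lp_mul_Lq (μ.prod (volume : Measure (Vec d)))
    Real.HolderConjugate.two_two (f := fun p => H p.2 * V p.1 p.2)
    (g := fun p => K ((1 - p.1) • p.2) * V p.1 p.2)
    (hH'.mul hVm).aemeasurable (hK'.mul hVm).aemeasurable
  simp only [hsq, hVW] at key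
  have e1 : ∀ {F : Vec d → ℝ≥0∞}, Measurable F →
      ∫⁻ p, F p.2 ^ 2 * W p.1 p.2 ∂(μ.prod (volume : Measure (Vec d)))
        ≤ ENNReal.ofReal Real.pi * ∫⁻ ξ, F ξ ^ 2 :=
    fun {F} hF => lintegral_prod_cauchyWeight_le hF _
  have e2 : ∫⁻ p, K ((1 - p.1) • p.2) ^ 2 * W p.1 p.2 ∂(μ.prod (volume : Measure (Vec d)))
      ≤ (2 * ENNReal.ofReal (2 ^ d)) * (ENNReal.ofReal Real.pi * ∫⁻ ξ, K ξ ^ 2) := by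
    -- Replace `(1 - s) ξ` by `ξ`. The factor `2` comes from the comparison of weights, and `2 ^ d`
    -- from the Jacobian `(1 - s)^{-d}` with `s < 1/2`.
    refine le_trans ?_ (mul_le_mul_right (e1 hK) _)
    have m3 : Measurable fun p : ℝ × Vec d => K p.2 ^ 2 * W p.1 p.2 :=
      ((hK.comp measurable_snd).pow_const 2).mul hWm
    have m2 : Measurable fun p : ℝ × Vec d => K ((1 - p.1) • p.2) ^ 2 * W p.1 p.2 :=
      (hK'.pow_const 2).mul hWm
    rw [lintegral_prod _ m2.aemeasurable, lintegral_prod _ m3.aemeasurable,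
      ← lintegral_const_mul _ m3.lintegral_prod_right']
    refine setLIntegral_mono' measurableSet_Ioo fun s hs => ?_
    have h0 : 0 < 1 - s := by linarith [hs.2]
    dsimp only
    calc ∫⁻ ξ, K ((1 - s) • ξ) ^ 2 * W s ξ
        ≤ ∫⁻ ξ, 2 * (K ((1 - s) • ξ) ^ 2 * W s ((1 - s) • ξ)) := by
          refine lintegral_mono fun ξ => ?_
          have := cauchyWeight_inv_mul_le (norm_nonneg ((1 - s) • ξ)) hs
          rw [norm_smul, Real.norm_of_nonneg h0.le, ← mul_assoc, inv_mul_cancel₀ h0.ne',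
            one_mul] at this
          simp only [hW, norm_smul, Real.norm_of_nonneg h0.le]
          rw [mul_left_comm]
          gcongr
          refine (ENNReal.ofReal_le_ofReal this).trans_eq ?_
          rw [ENNReal.ofReal_mul two_pos.le, ENNReal.ofReal_ofNat]
      _ = 2 * (ENNReal.ofReal ((1 - s) ^ d)⁻¹ * ∫⁻ ξ, K ξ ^ 2 * W s ξ) := by
          rw [lintegral_const_mul' _ _ (by simp),
            lintegral_smul_eq (fun ξ => K ξ ^ 2 * W s ξ) h0]
      _ ≤ _ := by
          rw [mul_assoc]
          gcongr
          rw [← inv_pow]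
          gcongr
          rw [inv_le_comm₀ h0 two_pos]; linarith [hs.2]
  calc _ = ∫⁻ p : ℝ × Vec d, (H p.2 * V p.1 p.2) * (K ((1 - p.1) • p.2) * V p.1 p.2)
            ∂(μ.prod (volume : Measure (Vec d))) := by
        have hm : Measurable fun p : ℝ × Vec d =>
            (H p.2 * V p.1 p.2) * (K ((1 - p.1) • p.2) * V p.1 p.2) :=
          (hH'.mul hVm).mul (hK'.mul hVm)
        rw [lintegral_prod _ hm.aemeasurable]
        refine lintegral_congr fun s => lintegral_congr fun ξ => ?_
        dsimp only
        rw [mul_mul_mul_comm, hVW]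
        ring
    _ ≤ _ := key
    _ ≤ (ENNReal.ofReal Real.pi * ∫⁻ ξ, H ξ ^ 2) ^ (1 / 2 : ℝ) *
        ((2 * ENNReal.ofReal (2 ^ d)) * (ENNReal.ofReal Real.pi * ∫⁻ ξ, K ξ ^ 2)) ^ (1 / 2 : ℝ) := by
        gcongr
        exact e1 hH
    _ = (ENNReal.ofReal Real.pi ^ (1 / 2 : ℝ) * ENNReal.ofReal Real.pi ^ (1 / 2 : ℝ)) *
        (2 * ENNReal.ofReal (2 ^ d)) ^ (1 / 2 : ℝ) * (eLpNorm H 2 * eLpNorm K 2) := by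
        rw [hnorm, hnorm]
        simp only [ENNReal.mul_rpow_of_nonneg _ _ (show (0 : ℝ) ≤ 1 / 2 by norm_num)]
        ring
    _ ≤ _ := by
        gcongr
        · rw [← ENNReal.rpow_add_of_nonneg _ _ (by norm_num) (by norm_num)]
          norm_num
        -- The square root of the constant is bounded by the constant itself, which is at least `1`.
        · refine (ENNReal.rpow_le_rpow_of_exponent_le ?_
            (show (1 / 2 : ℝ) ≤ 1 by norm_num)).trans_eq (ENNReal.rpow_one _)
          refine one_le_mul (by norm_num) ?_
          rw [ENNReal.one_le_ofReal]
          exact one_le_pow₀ (by norm_num)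

end

/-! ### The Fourier estimate -/

section

variable {d : ℕ}

lemma continuous_fourierReal {G : Vec d → ℝ} (hG : ContDiff ℝ ∞ G) (hGc : HasCompactSupport G) :
    Continuous (fourierReal G) :=
  (FourierTransform.fourier (testSchwartz hG hGc)).continuous

lemma eLpNorm_fourierReal {G : Vec d → ℝ} (hG : ContDiff ℝ ∞ G) (hGc : HasCompactSupport G) :
    eLpNorm (fun ξ => ‖fourierReal G ξ‖ₑ) 2 = eLpNorm G 2 := by
  have h := SchwartzMap.norm_fourier_toL2_eq (testSchwartz hG hGc)
  have h' := congrArg ENNReal.ofReal h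
  rw [ofReal_norm, ofReal_norm, Lp.enorm_def, Lp.enorm_def,
    eLpNorm_congr_ae (SchwartzMap.coeFn_toLp _ 2 volume), eLpNorm_congr_ae (SchwartzMap.coeFn_toLp _ 2 volume)]
    at h'
  rw [eLpNorm_enorm]
  refine (h'.trans (eLpNorm_congr_norm_ae (.of_forall fun x => ?_)))
  simp [testSchwartz_apply]

/-- On the Fourier side the derivative of the transported density is `2πi ⟨ξ, v⟩ Φ̂(sξ) Ĝ((1 -
s)ξ)`. The quadratic decay of `Φ̂` bounds the multiplier by a constant times `cauchyWeight s ‖ξ‖`,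
which avoids the singular factor `s⁻¹`. -/
lemma exists_lintegral_pairing_lower_half_le {Φ : Vec d → ℝ} (hΦ : ContDiff ℝ ∞ Φ)
    (hΦc : HasCompactSupport Φ) :
    ∃ C : ℝ≥0∞, C ≠ ⊤ ∧ ∀ v : Vec d, ‖v‖ ≤ 1 → ∀ G : Vec d → ℝ, ContDiff ℝ ∞ G →
      HasCompactSupport G → ∀ h : Vec d → ℝ, MemLp h 2 →
        ∫⁻ s in Set.Ioo (0 : ℝ) (1 / 2), ‖∫ x, h x * fderiv ℝ (transport Φ G s) x v‖ₑ
          ≤ C * (eLpNorm h 2 * eLpNorm G 2) := by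
  obtain ⟨C, hC0, hC⟩ := exists_fourierReal_le hΦ hΦc
  refine ⟨ENNReal.ofReal (2 * Real.pi * C) *
    (ENNReal.ofReal Real.pi * (2 * ENNReal.ofReal (2 ^ d))), by finiteness, ?_⟩
  intro v hv G hG hGc h hh
  obtain ⟨H, hHm, hHn, hH⟩ := exists_fourier_modulus hh
  have hK : Measurable fun ξ => ‖fourierReal G ξ‖ₑ := (continuous_fourierReal hG hGc).enorm.measurable
  rw [mul_assoc, ← hHn, ← eLpNorm_fourierReal hG hGc]
  refine le_trans ?_ (mul_le_mul_right (lintegral_cauchyWeight_mul_le hHm hK) _)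
  rw [← lintegral_const_mul' _ _ ENNReal.ofReal_ne_top]
  refine setLIntegral_mono' measurableSet_Ioo fun s hs => ?_
  have hs' : s ∈ Set.Ioo (0 : ℝ) 1 := ⟨hs.1, by linarith [hs.2]⟩
  have hT := contDiff_transport hΦ hΦc hG hGc hs'
  have hTc := hasCompactSupport_transport hΦc hGc hs'
  refine (hH _ (contDiff_fderiv_apply hT v) (hasCompactSupport_fderiv_apply hTc v)).trans ?_
  rw [← lintegral_const_mul' _ _ ENNReal.ofReal_ne_top]
  refine lintegral_mono fun ξ => ?_
  rw [mul_left_comm]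
  gcongr
  rw [fourierReal_fderiv hT hTc, fourierReal_transport hΦ hΦc hG hGc hs', ← mul_assoc, ← mul_assoc,
    enorm_mul, ← mul_assoc]
  gcongr
  rw [← ofReal_norm, ← ENNReal.ofReal_mul (by positivity)]
  apply ENNReal.ofReal_le_ofReal
  simp only [norm_mul, Complex.norm_I, Complex.norm_real, mul_one, RCLike.norm_ofNat,
    Real.norm_of_nonneg Real.pi_pos.le]
  have h1 := hC (s • ξ)
  have h2 : ‖inner ℝ ξ v‖ ≤ ‖ξ‖ :=
    (norm_inner_le_norm _ _).trans (mul_le_of_le_one_right (norm_nonneg _) hv)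
  rw [norm_smul, Real.norm_of_nonneg hs.1.le] at h1
  calc _ ≤ 2 * Real.pi * ‖ξ‖ * (C / (1 + (s * ‖ξ‖) ^ 2)) := by gcongr
    _ = _ := by rw [cauchyWeight]; ring

/-- Young's inequality for `L^∞` and `L¹`: for `s ≥ 1/2` the dilated `Φ` is at most `2 ^ d * M`, and
dilation preserves the `L¹` norm of `G`. -/
lemma enorm_transport_le {Φ G : Vec d → ℝ} {M : ℝ} (hM : ∀ x, ‖Φ x‖ ≤ M) {s : ℝ}
    (hs : s ∈ Set.Ico (1 / 2 : ℝ) 1) (x : Vec d) :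
    ‖transport Φ G s x‖ₑ ≤ ENNReal.ofReal (2 ^ d * M) * eLpNorm G 1 := by
  have hs0 : 0 < s := lt_of_lt_of_le (by norm_num) hs.1
  rw [eLpNorm_one_eq_lintegral_enorm, ← lintegral_enorm_dilate G (sub_pos.2 hs.2), transport,
    convolution_def]
  refine (enorm_integral_le_lintegral_enorm _).trans ?_
  rw [← lintegral_sub_left_eq_self (fun t => ‖dilate (1 - s) G t‖ₑ) x,
    ← lintegral_const_mul' _ _ ENNReal.ofReal_ne_top]
  refine lintegral_mono fun t => ?_
  rw [ContinuousLinearMap.mul_apply', enorm_mul]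
  gcongr
  rw [← ofReal_norm]
  apply ENNReal.ofReal_le_ofReal
  rw [dilate, norm_mul, norm_inv, norm_pow, Real.norm_of_nonneg hs0.le, ← inv_pow]
  have : s⁻¹ ≤ 2 := by rw [inv_le_comm₀ hs0 two_pos]; linarith [hs.1]
  gcongr
  exact hM _

lemma eLpNorm_one_restrict_le {G : Vec d → ℝ} (hG : AEStronglyMeasurable G) (S : Set (Vec d)) :
    eLpNorm G 1 (volume.restrict S) ≤ eLpNorm G 2 * volume S ^ (1 / 2 : ℝ) := by
  have h := eLpNorm_le_eLpNorm_mul_rpow_measure_univ (μ := volume.restrict S)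
    (by norm_num : (1 : ℝ≥0∞) ≤ 2) hG.restrict
  have e : (1 / (1 : ℝ≥0∞).toReal - 1 / (2 : ℝ≥0∞).toReal : ℝ) = 1 / 2 := by norm_num
  rw [e, Measure.restrict_apply_univ] at h
  exact h.trans (mul_le_mul_left (eLpNorm_mono_measure G Measure.restrict_le_self) _)

lemma enorm_pairing_fderiv_transport_le {Φ G : Vec d → ℝ} (hΦ : ContDiff ℝ ∞ Φ)
    (hΦc : HasCompactSupport Φ) (hG : ContDiff ℝ ∞ G) (hGc : HasCompactSupport G) {M : ℝ}
    (hM : ∀ x, ‖fderiv ℝ Φ x‖ ≤ M) {B : Set (Vec d)} (hB : Convex ℝ B) (hΦB : tsupport Φ ⊆ B)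
    (hGB : tsupport G ⊆ B) {v : Vec d} (hv : ‖v‖ ≤ 1) {s : ℝ} (hs : s ∈ Set.Ico (1 / 2 : ℝ) 1)
    (h : Vec d → ℝ) :
    ‖∫ x, h x * fderiv ℝ (transport Φ G s) x v‖ₑ ≤
      (∫⁻ x in B, ‖h x‖ₑ) * (ENNReal.ofReal 2 * (ENNReal.ofReal (2 ^ d * M) * eLpNorm G 1)) := by
  have hs' : s ∈ Set.Ioo (0 : ℝ) 1 := ⟨lt_of_lt_of_le (by norm_num) hs.1, hs.2⟩
  -- Convexity of `B` keeps the transported density in `B`, so only the `L¹` norm of `h` on `B` is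
  -- needed.
  have hsupp : ∀ x ∉ B, h x * fderiv ℝ (transport Φ G s) x v = 0 := by
    intro x hx
    have : x ∉ tsupport (transport Φ G s) := by
      intro hx'
      obtain ⟨p, hp, rfl⟩ := tsupport_transport_subset hΦc hGc hs' hx'
      exact hx (hB (hΦB hp.1) (hGB hp.2) hs'.1.le (by linarith [hs.2]) (by ring))
    rw [fderiv_of_notMem_tsupport ℝ this]; simp
  have hG1 : eLpNorm G 1 ≠ ⊤ := ((hG.continuous.memLp_of_hasCompactSupport hGc)).eLpNorm_ne_top
  rw [← setIntegral_eq_integral_of_forall_compl_eq_zero hsupp,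
    ← lintegral_mul_const' _ _ (by finiteness)]
  refine (enorm_integral_le_lintegral_enorm _).trans (lintegral_mono fun x => ?_)
  rw [enorm_mul, fderiv_transport hΦ hΦc hG hGc hs', enorm_mul]
  refine mul_le_mul_right (mul_le_mul' ?_ (enorm_transport_le (M := M) (fun x => ?_) hs x)) _
  · rw [← ofReal_norm, norm_inv, Real.norm_of_nonneg hs'.1.le]
    apply ENNReal.ofReal_le_ofReal
    rw [inv_le_comm₀ hs'.1 two_pos]; linarith [hs.1]
  · exact (ContinuousLinearMap.le_opNorm _ _).trans
      ((mul_le_of_le_one_right (norm_nonneg _) hv).trans (hM x))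

/-- Here a pointwise bound in `s` suffices. All supports lie in one ball, on which `L²` controls
`L¹`; this is where the constant depends on `R`. -/
lemma exists_lintegral_pairing_upper_half_le {Φ : Vec d → ℝ} (hΦ : ContDiff ℝ ∞ Φ)
    (hΦc : HasCompactSupport Φ) (R : ℝ) :
    ∃ C : ℝ≥0∞, C ≠ ⊤ ∧ ∀ v : Vec d, ‖v‖ ≤ 1 → ∀ G : Vec d → ℝ, ContDiff ℝ ∞ G →
      HasCompactSupport G → tsupport G ⊆ Metric.closedBall 0 R → ∀ h : Vec d → ℝ, MemLp h 2 →
        ∫⁻ s in Set.Ico (1 / 2 : ℝ) 1, ‖∫ x, h x * fderiv ℝ (transport Φ G s) x v‖ₑ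
          ≤ C * (eLpNorm h 2 * eLpNorm G 2) := by
  obtain ⟨r, hr⟩ := hΦc.isCompact.isBounded.subset_closedBall (0 : Vec d)
  obtain ⟨M, hM⟩ := (hΦ.continuous_fderiv (by simp)).bounded_above_of_compact_support (hΦc.fderiv ℝ)
  obtain ⟨B, hBdef⟩ : ∃ B, B = Metric.closedBall (0 : Vec d) (max r R) := ⟨_, rfl⟩
  obtain ⟨c, hcdef⟩ : ∃ c, c = volume B ^ (1 / 2 : ℝ) := ⟨_, rfl⟩
  have hc : c ≠ ⊤ := by
    rw [hcdef, hBdef]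
    exact ENNReal.rpow_ne_top_of_nonneg (by norm_num) (isCompact_closedBall _ _).measure_lt_top.ne
  have hB : Convex ℝ B := hBdef ▸ convex_closedBall _ _
  have hΦB : tsupport Φ ⊆ B :=
    hBdef ▸ hr.trans (Metric.closedBall_subset_closedBall (le_max_left _ _))
  refine ⟨ENNReal.ofReal 2 * ENNReal.ofReal (2 ^ d * M) * c * c, by finiteness, ?_⟩
  intro v hv G hG hGc hGR h hh
  have hGB : tsupport G ⊆ B :=
    hBdef ▸ hGR.trans (Metric.closedBall_subset_closedBall (le_max_right _ _))
  have hG1 : eLpNorm G 1 ≤ eLpNorm G 2 * c := by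
    rw [← eLpNorm_restrict_eq_of_support_subset (p := 1) ((subset_tsupport G).trans hGB), hcdef]
    exact eLpNorm_one_restrict_le hG.continuous.aestronglyMeasurable B
  have hh1 : ∫⁻ x in B, ‖h x‖ₑ ≤ eLpNorm h 2 * c := by
    rw [← eLpNorm_one_eq_lintegral_enorm, hcdef]
    exact eLpNorm_one_restrict_le hh.1 B
  have hpt : ∀ s ∈ Set.Ico (1 / 2 : ℝ) 1, ‖∫ x, h x * fderiv ℝ (transport Φ G s) x v‖ₑ ≤
      ENNReal.ofReal 2 * ENNReal.ofReal (2 ^ d * M) * c * c * (eLpNorm h 2 * eLpNorm G 2) := by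
    intro s hs
    refine (enorm_pairing_fderiv_transport_le hΦ hΦc hG hGc hM hB hΦB hGB hv hs h).trans ?_
    refine (mul_le_mul' hh1 (mul_le_mul_right (mul_le_mul_right hG1 _) _)).trans_eq ?_
    ring
  refine (setLIntegral_mono' measurableSet_Ico hpt).trans ?_
  rw [setLIntegral_const, Real.volume_Ico]
  refine mul_le_of_le_one_right' ?_
  rw [ENNReal.ofReal_le_one]; norm_num

/-- The `L²` bound for `∇ ∫₀¹ transport Φ G s ds`, in a weak form with absolute convergence. -/
theorem exists_lintegral_pairing_fderiv_transport_le {Φ : Vec d → ℝ} (hΦ : ContDiff ℝ ∞ Φ)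
    (hΦc : HasCompactSupport Φ) (R : ℝ) :
    ∃ C : ℝ≥0∞, C ≠ ⊤ ∧ ∀ v : Vec d, ‖v‖ ≤ 1 → ∀ G : Vec d → ℝ, ContDiff ℝ ∞ G →
      HasCompactSupport G → tsupport G ⊆ Metric.closedBall 0 R → ∀ h : Vec d → ℝ, MemLp h 2 →
        ∫⁻ s in Set.Ioo (0 : ℝ) 1, ‖∫ x, h x * fderiv ℝ (transport Φ G s) x v‖ₑ
          ≤ C * (eLpNorm h 2 * eLpNorm G 2) := by
  obtain ⟨C₁, hC₁, h₁⟩ := exists_lintegral_pairing_lower_half_le hΦ hΦc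
  obtain ⟨C₂, hC₂, h₂⟩ := exists_lintegral_pairing_upper_half_le hΦ hΦc R
  refine ⟨C₁ + C₂, by finiteness, fun v hv G hG hGc hGR h hh => ?_⟩
  rw [add_mul, ← Set.Ioo_union_Ico_eq_Ioo (show (0 : ℝ) < 1 / 2 by norm_num) (by norm_num)]
  exact (lintegral_union_le _ _ _).trans (add_le_add (h₁ v hv G hG hGc h hh)
    (h₂ v hv G hG hGc hGR h hh))

end

/-! ### Fluxes -/

section

variable {d : ℕ} {Ω : LipschitzDomain d}

open scoped Convolution

lemma integral_transport_mul_prod {Φ G : Vec d → ℝ} (hΦ : ContDiff ℝ ∞ Φ)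
    (hΦc : HasCompactSupport Φ) (hG : ContDiff ℝ ∞ G) (hGc : HasCompactSupport G) {s : ℝ}
    (hs : s ∈ Set.Ioo (0 : ℝ) 1) {ψ : Vec d → ℝ} (hψ : Continuous ψ) (hψc : HasCompactSupport ψ) :
    Integrable (fun p : Vec d × Vec d => Φ p.1 * G p.2 * ψ (s • p.1 + (1 - s) • p.2))
      (volume.prod volume) ∧
    ∫ x, transport Φ G s x * ψ x
      = ∫ p : Vec d × Vec d, Φ p.1 * G p.2 * ψ (s • p.1 + (1 - s) • p.2)
          ∂(volume.prod volume) := by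
  obtain ⟨C, hC⟩ := hψ.bounded_above_of_compact_support hψc
  have hi : Integrable (fun p : Vec d × Vec d => Φ p.1 * G p.2 * ψ (s • p.1 + (1 - s) • p.2))
      (volume.prod volume) := by
    have h0 : Integrable (fun p : Vec d × Vec d => Φ p.1 * G p.2) (volume.prod volume) :=
      (hΦ.continuous.integrable_of_hasCompactSupport hΦc).mul_prod
        (hG.continuous.integrable_of_hasCompactSupport hGc)
    have hc : Continuous fun p : Vec d × Vec d => ψ (s • p.1 + (1 - s) • p.2) :=
      hψ.comp (by fun_prop)
    exact h0.mul_bdd (c := C) hc.aestronglyMeasurable (.of_forall fun p => hC _)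
  refine ⟨hi, ?_⟩
  rw [integral_transport_mul hΦ hΦc hG hGc hs hψ hC, integral_prod _ hi]
  refine integral_congr_ae (.of_forall fun a => ?_)
  simp only [mul_assoc]
  rw [← integral_const_mul]

/-- Multiplication of a density by a coordinate function. -/
def coordMul (i : Fin d) (Φ : Vec d → ℝ) (x : Vec d) : ℝ := x i * Φ x

lemma contDiff_coordMul {Φ : Vec d → ℝ} (hΦ : ContDiff ℝ ∞ Φ) (i : Fin d) :
    ContDiff ℝ ∞ (coordMul i Φ) :=
  (coordL i).contDiff.mul hΦ

lemma tsupport_coordMul_subset (i : Fin d) (Φ : Vec d → ℝ) :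
    tsupport (coordMul i Φ) ⊆ tsupport Φ :=
  closure_mono fun _ hx => right_ne_zero_of_mul hx

lemma hasCompactSupport_coordMul {Φ : Vec d → ℝ} (hΦ : HasCompactSupport Φ) (i : Fin d) :
    HasCompactSupport (coordMul i Φ) :=
  hΦ.mono' ((subset_tsupport _).trans (tsupport_coordMul_subset i Φ))

/-- The flux at time `s` when the density `f(y)` is transported to `η(a)` along segments. -/
def flux (η f : Vec d → ℝ) (s : ℝ) (x : Vec d) : Vec d :=
  WithLp.toLp 2 fun i => transport (coordMul i η) f s x - transport η (coordMul i f) s x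

lemma flux_apply (η f : Vec d → ℝ) (s : ℝ) (x : Vec d) (i : Fin d) :
    flux η f s x i = transport (coordMul i η) f s x - transport η (coordMul i f) s x := rfl

/-- Data for the transport of densities supported in `E` to the density `η` inside `Ω`. -/
structure IsTarget (Ω : LipschitzDomain d) (E : Set (Vec d)) (η : Vec d → ℝ) : Prop where
  smooth : ContDiff ℝ ∞ η
  compact : HasCompactSupport η
  integral_eq_one : ∫ x, η x = 1
  support_subset : tsupport η ⊆ Ω.carrier
  segment_mem : ∀ a ∈ tsupport η, ∀ y ∈ E, ∀ s ∈ Set.Ioo (0 : ℝ) 1, s • a + (1 - s) • y ∈ Ω.carrier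
  isOpen : IsOpen E
  subset : E ⊆ Ω.carrier

/-- A smooth scalar density with compact support in `E`. -/
structure IsDensity (E : Set (Vec d)) (f : Vec d → ℝ) : Prop where
  smooth : ContDiff ℝ ∞ f
  compact : HasCompactSupport f
  subset : tsupport f ⊆ E

/-- At time `s` all mass lies at points `s a + (1 - s) y` with `a ∈ tsupport η` and `y ∈ tsupport
f`. They form a compact set, contained in `Ω` by `segment_mem`. -/
lemma IsTarget.isTestField_flux {E : Set (Vec d)} {η f : Vec d → ℝ} (hη : IsTarget Ω E η)
    (hf : IsDensity E f) {s : ℝ} (hs : s ∈ Set.Ioo (0 : ℝ) 1) : IsTestField Ω (flux η f s) := by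
  have hK : IsCompact ((fun p : Vec d × Vec d => s • p.1 + (1 - s) • p.2) ''
      (tsupport η ×ˢ tsupport f)) :=
    (hη.compact.isCompact.prod hf.compact.isCompact).image (by fun_prop)
  have hsupp : Function.support (flux η f s) ⊆
      (fun p : Vec d × Vec d => s • p.1 + (1 - s) • p.2) '' (tsupport η ×ˢ tsupport f) := by
    intro x hx
    by_contra h
    apply hx
    have h1 : ∀ i, transport (coordMul i η) f s x = 0 := fun i => by
      by_contra hne
      exact h (Set.image_mono (Set.prod_mono_left (tsupport_coordMul_subset i η))
        (support_transport_subset _ _ hs hne))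
    have h2 : ∀ i, transport η (coordMul i f) s x = 0 := fun i => by
      by_contra hne
      exact h (Set.image_mono (Set.prod_mono_right (tsupport_coordMul_subset i f))
        (support_transport_subset _ _ hs hne))
    ext i
    simp [flux_apply, h1, h2]
  refine ⟨?_, HasCompactSupport.of_support_subset_isCompact hK hsupp, ?_⟩
  · refine contDiff_euclidean.2 fun i => ?_
    exact (contDiff_transport (contDiff_coordMul hη.smooth i)
      (hasCompactSupport_coordMul hη.compact i) hf.smooth hf.compact hs).sub
      (contDiff_transport hη.smooth hη.compact (contDiff_coordMul hf.smooth i)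
        (hasCompactSupport_coordMul hf.compact i) hs)
  · refine (closure_minimal hsupp hK.isClosed).trans ?_
    rintro _ ⟨p, hp, rfl⟩
    exact hη.segment_mem _ hp.1 _ (hf.subset hp.2) s hs

/-- The weak continuity equation. A particle on the segment from `y` to `a` has velocity `a - y`, so
the right side is minus the time derivative of `∫ ψ` against the transported density. -/
lemma IsTarget.integral_mul_div_flux {E : Set (Vec d)} {η f : Vec d → ℝ} (hη : IsTarget Ω E η)
    (hf : IsDensity E f) {ψ : Vec d → ℝ} (hψ : ContDiff ℝ ∞ ψ) (hψc : HasCompactSupport ψ)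
    {s : ℝ} (hs : s ∈ Set.Ioo (0 : ℝ) 1) :
    ∫ x, ψ x * matTrace d (jacobian (flux η f s) x) ∂Ω.vol =
      - ∫ p : Vec d × Vec d, η p.1 * f p.2 * fderiv ℝ ψ (s • p.1 + (1 - s) • p.2) (p.1 - p.2)
          ∂(volume.prod volume) := by
  rw [(hη.isTestField_flux hf hs).integral_mul_div hψ]
  congr 1
  have hψ' : ∀ i : Fin d, Continuous fun x => fderiv ℝ ψ x (stdVec i) := fun i =>
    (contDiff_fderiv_apply hψ _).continuous
  have hψ'c : ∀ i : Fin d, HasCompactSupport fun x => fderiv ℝ ψ x (stdVec i) := fun i =>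
    hasCompactSupport_fderiv_apply hψc _
  have A := fun i => integral_transport_mul_prod (contDiff_coordMul hη.smooth i)
      (hasCompactSupport_coordMul hη.compact i) hf.smooth hf.compact hs (hψ' i) (hψ'c i)
  have B := fun i => integral_transport_mul_prod hη.smooth hη.compact
    (contDiff_coordMul hf.smooth i) (hasCompactSupport_coordMul hf.compact i) hs (hψ' i) (hψ'c i)
  have A' : ∀ i, Integrable fun x => transport (coordMul i η) f s x * fderiv ℝ ψ x (stdVec i) :=
    fun i => ((contDiff_transport (contDiff_coordMul hη.smooth i)
      (hasCompactSupport_coordMul hη.compact i) hf.smooth hf.compact hs).continuous.mul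
      (hψ' i)).integrable_of_hasCompactSupport (hψ'c i).mul_left
  have B' : ∀ i, Integrable fun x => transport η (coordMul i f) s x * fderiv ℝ ψ x (stdVec i) :=
    fun i => ((contDiff_transport hη.smooth hη.compact (contDiff_coordMul hf.smooth i)
      (hasCompactSupport_coordMul hf.compact i) hs).continuous.mul
      (hψ' i)).integrable_of_hasCompactSupport (hψ'c i).mul_left
  simp only [flux_apply, sub_mul]
  refine (integral_finsetSum _ fun i _ => (A' i).sub (B' i)).trans ?_
  refine (Finset.sum_congr rfl fun i _ => (integral_sub (A' i) (B' i)).trans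
    ((congrArg₂ _ (A i).2 (B i).2).trans (integral_sub (A i).1 (B i).1).symm)).trans ?_
  refine (integral_finsetSum _ fun i _ => (A i).1.sub (B i).1).symm.trans ?_
  refine integral_congr_ae (.of_forall fun p => ?_)
  have hv : (p.1 - p.2) = ∑ i, (p.1 i - p.2 i) • (stdVec i : Vec d) := by
    conv_lhs => rw [← (EuclideanSpace.basisFun (Fin d) ℝ).sum_repr (p.1 - p.2)]
    simp
  dsimp only
  rw [hv, map_sum, Finset.mul_sum]
  refine Finset.sum_congr rfl fun i _ => ?_
  simp only [map_smul, smul_eq_mul, coordMul, Pi.sub_apply]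
  ring

lemma integral_fderiv_segment {ψ : Vec d → ℝ} (hψ : ContDiff ℝ ∞ ψ) (a y : Vec d) :
    ∫ s in Set.Ioo (0 : ℝ) 1, fderiv ℝ ψ (s • a + (1 - s) • y) (a - y) = ψ a - ψ y := by
  rw [← integral_Ioc_eq_integral_Ioo, ← intervalIntegral.integral_of_le zero_le_one]
  have h : ∀ s : ℝ, HasDerivAt (fun s : ℝ => ψ (s • a + (1 - s) • y))
      (fderiv ℝ ψ (s • a + (1 - s) • y) (a - y)) s := fun s => by
    have h1 : HasDerivAt (fun s : ℝ => s • a + (1 - s) • y) (a - y) s := by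
      have := ((hasDerivAt_id s).smul_const a).add
        (((hasDerivAt_const s (1 : ℝ)).sub (hasDerivAt_id s)).smul_const y)
      convert! this using 1
      simp [sub_eq_add_neg]
    exact (hψ.differentiable (by simp) _).hasFDerivAt.comp_hasDerivAt s h1
  rw [intervalIntegral.integral_eq_sub_of_hasDerivAt (fun s _ => h s)]
  · simp
  · refine Continuous.intervalIntegrable ?_ _ _
    exact ((hψ.continuous_fderiv (by simp)).comp (by fun_prop)).clm_apply continuous_const

/-- After Fubini, the fundamental theorem of calculus on each segment leaves `ψ a - ψ y`.
Integrating against `η(a) f(y)` with `∫ η = 1` gives the initial density minus the final one. -/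
lemma IsTarget.integral_integral_mul_div_flux {E : Set (Vec d)} {η f : Vec d → ℝ}
    (hη : IsTarget Ω E η) (hf : IsDensity E f) {ψ : Vec d → ℝ} (hψ : ContDiff ℝ ∞ ψ)
    (hψc : HasCompactSupport ψ) :
    ∫ s in Set.Ioo (0 : ℝ) 1, ∫ x, ψ x * matTrace d (jacobian (flux η f s) x) ∂Ω.vol =
      (∫ x, ψ x * f x) - (∫ x, f x) * ∫ x, ψ x * η x := by
  rw [setIntegral_congr_fun measurableSet_Ioo fun s hs =>
    hη.integral_mul_div_flux hf hψ hψc hs, integral_neg]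
  obtain ⟨M, hM⟩ := (hψ.continuous_fderiv (by simp)).bounded_above_of_compact_support
    (hψc.fderiv ℝ)
  have hηi : Integrable η := hη.smooth.continuous.integrable_of_hasCompactSupport hη.compact
  have hfi : Integrable f := hf.smooth.continuous.integrable_of_hasCompactSupport hf.compact
  have hη1 : Integrable fun x => ‖x‖ * η x :=
    (continuous_norm.mul hη.smooth.continuous).integrable_of_hasCompactSupport hη.compact.mul_left
  have hf1 : Integrable fun x => ‖x‖ * f x :=
    (continuous_norm.mul hf.smooth.continuous).integrable_of_hasCompactSupport hf.compact.mul_left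
  have hηψ : Integrable fun x => η x * ψ x :=
    (hη.smooth.continuous.mul hψ.continuous).integrable_of_hasCompactSupport hψc.mul_left
  have hfψ : Integrable fun x => f x * ψ x :=
    (hf.smooth.continuous.mul hψ.continuous).integrable_of_hasCompactSupport hψc.mul_left
  have hcont : Continuous fun q : ℝ × (Vec d × Vec d) => η q.2.1 * f q.2.2 *
      fderiv ℝ ψ (q.1 • q.2.1 + (1 - q.1) • q.2.2) (q.2.1 - q.2.2) := by
    have h1 : Continuous fun q : ℝ × (Vec d × Vec d) =>
        fderiv ℝ ψ (q.1 • q.2.1 + (1 - q.1) • q.2.2) :=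
      (hψ.continuous_fderiv (by simp)).comp (by fun_prop)
    have h2 := hη.smooth.continuous
    have h3 := hf.smooth.continuous
    fun_prop
  have hint : Integrable (fun q : ℝ × (Vec d × Vec d) => η q.2.1 * f q.2.2 *
      fderiv ℝ ψ (q.1 • q.2.1 + (1 - q.1) • q.2.2) (q.2.1 - q.2.2))
      -- The velocity `a - y` is unbounded, but `‖a‖ + ‖y‖` is integrable against the compactly
      -- supported densities.
      ((volume.restrict (Set.Ioo (0 : ℝ) 1)).prod (volume.prod volume)) := by
    have hb : Integrable (fun p : Vec d × Vec d => M * (‖(‖p.1‖ * η p.1) * f p.2‖ +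
        ‖η p.1 * (‖p.2‖ * f p.2)‖)) (volume.prod volume) :=
      ((hη1.mul_prod hfi).norm.add (hηi.mul_prod hf1).norm).const_mul M
    refine (hb.comp_snd (volume.restrict (Set.Ioo (0 : ℝ) 1))).mono' hcont.aestronglyMeasurable
      (.of_forall fun q => ?_)
    have h1 : ‖fderiv ℝ ψ (q.1 • q.2.1 + (1 - q.1) • q.2.2) (q.2.1 - q.2.2)‖
        ≤ M * (‖q.2.1‖ + ‖q.2.2‖) :=
      (ContinuousLinearMap.le_of_opNorm_le _ (hM _) _).trans
        (mul_le_mul_of_nonneg_left (norm_sub_le _ _) ((norm_nonneg _).trans (hM 0)))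
    simp only [norm_mul, norm_norm]
    calc _ ≤ ‖η q.2.1‖ * ‖f q.2.2‖ * (M * (‖q.2.1‖ + ‖q.2.2‖)) := by gcongr
      _ = _ := by ring
  rw [integral_integral_swap hint]
  simp only [integral_const_mul, integral_fderiv_segment hψ]
  have e : ∀ p : Vec d × Vec d, η p.1 * f p.2 * (ψ p.1 - ψ p.2)
      = (η p.1 * ψ p.1) * f p.2 - η p.1 * (f p.2 * ψ p.2) := fun p => by ring
  simp only [e]
  rw [integral_sub (hηψ.mul_prod hfi) (hηi.mul_prod hfψ),
    integral_prod_mul (fun x => η x * ψ x) f, integral_prod_mul η (fun x => f x * ψ x),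
    hη.integral_eq_one]
  simp only [mul_comm (ψ _)]
  ring

end

/-! ### Pairings with fluxes -/

section

variable {d : ℕ} {Ω : LipschitzDomain d}

open scoped Convolution

/-- By `fderiv_transport` the integrand agrees on `(0, 1)` with a formula that is jointly measurable
in `(s, x)`, even at times where `transport` is not smooth. -/
lemma aestronglyMeasurable_pairing {Φ G : Vec d → ℝ} (hΦ : ContDiff ℝ ∞ Φ)
    (hΦc : HasCompactSupport Φ) (hG : ContDiff ℝ ∞ G) (hGc : HasCompactSupport G)
    {h : Vec d → ℝ} (hh : Measurable h) (v : Vec d) :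
    AEStronglyMeasurable (fun s => ∫ x, h x * fderiv ℝ (transport Φ G s) x v)
      (volume.restrict (Set.Ioo (0 : ℝ) 1)) := by
  have hΨ := (contDiff_fderiv_apply hΦ v).continuous.measurable
  have hGm := hG.continuous.measurable
  have h1 : Measurable fun q : (ℝ × Vec d) × Vec d =>
      dilate q.1.1 (fun x => fderiv ℝ Φ x v) q.2 * dilate (1 - q.1.1) G (q.1.2 - q.2) := by
    unfold dilate
    refine Measurable.mul ?_ ?_
    · exact Measurable.mul (by fun_prop) (hΨ.comp (by fun_prop))
    · exact Measurable.mul (by fun_prop) (hGm.comp (by fun_prop))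
  have h2 : StronglyMeasurable fun q : ℝ × Vec d =>
      transport (fun x => fderiv ℝ Φ x v) G q.1 q.2 :=
    h1.stronglyMeasurable.integral_prod_right'
  have h3 : StronglyMeasurable fun q : ℝ × Vec d =>
      h q.2 * (q.1⁻¹ * transport (fun x => fderiv ℝ Φ x v) G q.1 q.2) :=
    ((hh.comp measurable_snd).mul (measurable_fst.inv.mul h2.measurable)).stronglyMeasurable
  refine (h3.integral_prod_right' (ν := volume)).aestronglyMeasurable.congr ?_
  filter_upwards [ae_restrict_mem measurableSet_Ioo] with s hs
  refine integral_congr_ae (.of_forall fun x => ?_)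
  dsimp only
  rw [fderiv_transport hΦ hΦc hG hGc hs]

lemma exists_pairing_le {Φ : Vec d → ℝ} (hΦ : ContDiff ℝ ∞ Φ) (hΦc : HasCompactSupport Φ) (R : ℝ) :
    ∃ C : ℝ, 0 ≤ C ∧ ∀ v : Vec d, ‖v‖ ≤ 1 → ∀ G : Vec d → ℝ, ContDiff ℝ ∞ G →
      HasCompactSupport G → tsupport G ⊆ Metric.closedBall 0 R →
      ∀ h : Vec d → ℝ, Measurable h → MemLp h 2 →
        IntegrableOn (fun s => ∫ x, h x * fderiv ℝ (transport Φ G s) x v) (Set.Ioo (0 : ℝ) 1) ∧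
        ∫ s in Set.Ioo (0 : ℝ) 1, ‖∫ x, h x * fderiv ℝ (transport Φ G s) x v‖
          ≤ C * ((eLpNorm h 2).toReal * (eLpNorm G 2).toReal) := by
  obtain ⟨C, hC, H⟩ := exists_lintegral_pairing_fderiv_transport_le hΦ hΦc R
  refine ⟨C.toReal, ENNReal.toReal_nonneg, fun v hv G hG hGc hGR h hhm hh => ?_⟩
  have hb := H v hv G hG hGc hGR h hh
  have h1 : eLpNorm h 2 ≠ ⊤ := hh.eLpNorm_ne_top
  have h2 : eLpNorm G 2 ≠ ⊤ := (hG.continuous.memLp_of_hasCompactSupport hGc).eLpNorm_ne_top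
  have hfin : C * (eLpNorm h 2 * eLpNorm G 2) ≠ ⊤ := by finiteness
  have hm := aestronglyMeasurable_pairing hΦ hΦc hG hGc hhm v
  refine ⟨⟨hm, hb.trans_lt hfin.lt_top⟩, ?_⟩
  rw [integral_norm_eq_lintegral_enorm hm, ← ENNReal.toReal_mul, ← ENNReal.toReal_mul]
  exact ENNReal.toReal_mono hfin hb

/-- The zero extension of an entry of a matrix field on `Ω`. -/
def entry (W : Lp (Mat d) 2 Ω.vol) (i j : Fin d) : Vec d → ℝ :=
  Ω.carrier.indicator fun x => W x (i, j)

lemma measurable_entry (W : Lp (Mat d) 2 Ω.vol) (i j : Fin d) : Measurable (entry W i j) := by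
  refine Measurable.indicator ?_ Ω.isOpen.measurableSet
  exact (EuclideanSpace.proj (𝕜 := ℝ) (i, j)).continuous.measurable.comp
    (Lp.stronglyMeasurable W).measurable

lemma eLpNorm_entry_le (W : Lp (Mat d) 2 Ω.vol) (i j : Fin d) :
    eLpNorm (entry W i j) 2 ≤ eLpNorm W 2 Ω.vol := by
  rw [entry, eLpNorm_indicator_eq_eLpNorm_restrict Ω.isOpen.measurableSet]
  exact eLpNorm_mono fun x => PiLp.norm_apply_le _ _

lemma memLp_entry (W : Lp (Mat d) 2 Ω.vol) (i j : Fin d) : MemLp (entry W i j) 2 :=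
  ⟨(measurable_entry W i j).aestronglyMeasurable,
    (eLpNorm_entry_le W i j).trans_lt (Lp.memLp W).eLpNorm_lt_top⟩

lemma norm_entry_le (W : Lp (Mat d) 2 Ω.vol) (i j : Fin d) :
    (eLpNorm (entry W i j) 2).toReal ≤ ‖W‖ := by
  rw [Lp.norm_def]
  exact ENNReal.toReal_mono (Lp.memLp W).eLpNorm_ne_top (eLpNorm_entry_le W i j)

lemma integrable_mul_fderiv {h g : Vec d → ℝ} (hh : MemLp h 2) (hg : ContDiff ℝ ∞ g)
    (hgc : HasCompactSupport g) (v : Vec d) : Integrable fun x => h x * fderiv ℝ g x v := by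
  have : MemLp (fun x => fderiv ℝ g x v) 2 :=
    (contDiff_fderiv_apply hg v).continuous.memLp_of_hasCompactSupport
      (hasCompactSupport_fderiv_apply hgc v)
  exact hh.integrable_mul this

lemma IsTestField.inner_grad_eq {φ : Vec d → Vec d} (h : IsTestField Ω φ)
    (W : Lp (Mat d) 2 Ω.vol) :
    inner ℝ (grad h.toH10) W
      = ∑ i, ∑ j, ∫ x, entry W i j x * fderiv ℝ (fun x => φ x i) x (stdVec j) := by
  have hi : ∀ i j, Integrable fun x => entry W i j x * fderiv ℝ (fun x => φ x i) x (stdVec j) :=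
    fun i j => integrable_mul_fderiv (memLp_entry W i j) (contDiff_component h.smooth i)
      (hasCompactSupport_component h.compact i) _
  have hz : ∀ x ∉ Ω.carrier,
      ∑ i, ∑ j, entry W i j x * fderiv ℝ (fun x => φ x i) x (stdVec j) = 0 := fun x hx =>
    Finset.sum_eq_zero fun i _ => Finset.sum_eq_zero fun j _ => by
      rw [entry, Set.indicator_of_notMem hx, zero_mul]
  simp only [← integral_finsetSum _ fun j _ => hi _ j]
  rw [← integral_finsetSum _ fun i _ => integrable_finsetSum _ fun j _ => hi i j, L2.inner_def,
    ← setIntegral_eq_integral_of_forall_compl_eq_zero hz]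
  refine integral_congr_ae ?_
  filter_upwards [h.grad_toH10, ae_restrict_mem Ω.isOpen.measurableSet] with x hx hxΩ
  rw [hx, PiLp.inner_apply, Fintype.sum_prod_type]
  refine Finset.sum_congr rfl fun i _ => Finset.sum_congr rfl fun j _ => ?_
  rw [entry, Set.indicator_of_mem hxΩ, jacobian_apply h.smooth]
  rfl

/-- The mass flux as an element of `𝐇¹₀(Ω)`. -/
def IsTarget.fluxH10 {E : Set (Vec d)} {η f : Vec d → ℝ} (hη : IsTarget Ω E η)
    (hf : IsDensity E f) (s : ℝ) : H10 Ω :=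
  open Classical in
  -- The default `0` gives an element of `𝐇¹₀(Ω)` at every `s`, as `exists_weak_integral` requires;
  -- only `(0, 1)` is integrated over.
  if hs : s ∈ Set.Ioo (0 : ℝ) 1 then (hη.isTestField_flux hf hs).toH10 else 0

lemma IsTarget.fluxH10_of_mem {E : Set (Vec d)} {η f : Vec d → ℝ} (hη : IsTarget Ω E η)
    (hf : IsDensity E f) {s : ℝ} (hs : s ∈ Set.Ioo (0 : ℝ) 1) :
    hη.fluxH10 hf s = (hη.isTestField_flux hf hs).toH10 := dif_pos hs

lemma eLpNorm_coordMul_le {f : Vec d → ℝ} {R : ℝ} (hR : tsupport f ⊆ Metric.closedBall 0 R)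
    (i : Fin d) : eLpNorm (coordMul i f) 2 ≤ ENNReal.ofReal R * eLpNorm f 2 := by
  refine eLpNorm_le_mul_eLpNorm_of_ae_le_mul (.of_forall fun x => ?_) 2
  by_cases hx : x ∈ tsupport f
  · rw [coordMul, norm_mul]
    gcongr
    exact (PiLp.norm_apply_le x i).trans (by simpa using hR hx)
  · simp [coordMul, image_eq_zero_of_notMem_tsupport hx]

/-- The weak bound of the time integral of the gradient of the flux. -/
lemma IsTarget.exists_inner_grad_fluxH10_le {E : Set (Vec d)} {η : Vec d → ℝ}
    (hη : IsTarget Ω E η) :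
    ∃ C : ℝ, 0 ≤ C ∧ ∀ (f : Vec d → ℝ) (hf : IsDensity E f) (W : Lp (Mat d) 2 Ω.vol),
      IntegrableOn (fun s => inner ℝ (grad (hη.fluxH10 hf s)) W) (Set.Ioo (0 : ℝ) 1) ∧
      ‖∫ s in Set.Ioo (0 : ℝ) 1, inner ℝ (grad (hη.fluxH10 hf s)) W‖
        ≤ C * (eLpNorm f 2).toReal * ‖W‖ := by
  obtain ⟨R, hR⟩ := Ω.isBounded.subset_closedBall (0 : Vec d)
  obtain ⟨C₀, hC₀, H₀⟩ := exists_pairing_le hη.smooth hη.compact R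
  choose C hC H using fun i : Fin d => exists_pairing_le (contDiff_coordMul hη.smooth i)
    (hasCompactSupport_coordMul hη.compact i) R
  refine ⟨∑ i, ∑ _j : Fin d, (C i + C₀ * max R 0), Finset.sum_nonneg fun i _ =>
    Finset.sum_nonneg fun j _ => add_nonneg (hC i) (mul_nonneg hC₀ (le_max_right _ _)),
    fun f hf W => ?_⟩
  have hfR : tsupport f ⊆ Metric.closedBall 0 R := (hf.subset.trans hη.subset).trans hR
  have hs1 : ∀ j : Fin d, ‖(stdVec j : Vec d)‖ ≤ 1 := fun j => by simp
  have A := fun i j => H i (stdVec j) (hs1 j) f hf.smooth hf.compact hfR _ (measurable_entry W i j)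
    (memLp_entry W i j)
  have B := fun i j => H₀ (stdVec j) (hs1 j) (coordMul i f) (contDiff_coordMul hf.smooth i)
    (hasCompactSupport_coordMul hf.compact i) ((tsupport_coordMul_subset i f).trans hfR) _
    (measurable_entry W i j) (memLp_entry W i j)
  have hfn : eLpNorm f 2 ≠ ⊤ :=
    (hf.smooth.continuous.memLp_of_hasCompactSupport hf.compact).eLpNorm_ne_top
  have hcm : ∀ i, (eLpNorm (coordMul i f) 2).toReal ≤ max R 0 * (eLpNorm f 2).toReal := fun i => by
    refine (ENNReal.toReal_mono (by finiteness) (eLpNorm_coordMul_le hfR i)).trans_eq ?_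
    rw [ENNReal.toReal_mul, ENNReal.toReal_ofReal']
  -- Each component of the flux is a difference of two transports, of `(xᵢ η, f)` and `(η, xᵢ f)`,
  -- and the pairing estimate applies to both.
  have hEq : ∀ s ∈ Set.Ioo (0 : ℝ) 1, ∑ i, ∑ j,
      ((∫ x, entry W i j x * fderiv ℝ (transport (coordMul i η) f s) x (stdVec j)) -
        ∫ x, entry W i j x * fderiv ℝ (transport η (coordMul i f) s) x (stdVec j)) =
      inner ℝ (grad (hη.fluxH10 hf s)) W := by
    intro s hs
    rw [hη.fluxH10_of_mem hf hs, IsTestField.inner_grad_eq]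
    refine Finset.sum_congr rfl fun i _ => Finset.sum_congr rfl fun j _ => ?_
    have t1 := contDiff_transport (contDiff_coordMul hη.smooth i)
      (hasCompactSupport_coordMul hη.compact i) hf.smooth hf.compact hs
    have t2 := contDiff_transport hη.smooth hη.compact (contDiff_coordMul hf.smooth i)
      (hasCompactSupport_coordMul hf.compact i) hs
    have c1 := hasCompactSupport_transport (hasCompactSupport_coordMul hη.compact i) hf.compact hs
    have c2 := hasCompactSupport_transport hη.compact (hasCompactSupport_coordMul hf.compact i) hs
    have i1 := integrable_mul_fderiv (memLp_entry W i j) t1 c1 (stdVec j)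
    have i2 := integrable_mul_fderiv (memLp_entry W i j) t2 c2 (stdVec j)
    refine (integral_sub i1 i2).symm.trans (integral_congr_ae (.of_forall fun x => ?_))
    have hfd : fderiv ℝ (fun x => flux η f s x i) x = fderiv ℝ (transport (coordMul i η) f s) x
        - fderiv ℝ (transport η (coordMul i f) s) x :=
      fderiv_fun_sub (t1.differentiable (by simp) x) (t2.differentiable (by simp) x)
    dsimp only
    rw [hfd, sub_apply, mul_sub]
  have hint : ∀ i j, IntegrableOn (fun s =>
      (∫ x, entry W i j x * fderiv ℝ (transport (coordMul i η) f s) x (stdVec j)) -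
        ∫ x, entry W i j x * fderiv ℝ (transport η (coordMul i f) s) x (stdVec j))
      (Set.Ioo (0 : ℝ) 1) := fun i j => (A i j).1.sub (B i j).1
  refine ⟨IntegrableOn.congr_fun (integrable_finsetSum _ fun i _ =>
    integrable_finsetSum _ fun j _ => hint i j) hEq measurableSet_Ioo, ?_⟩
  rw [← setIntegral_congr_fun measurableSet_Ioo hEq,
    integral_finsetSum _ fun i _ => integrable_finsetSum _ fun j _ => hint i j]
  simp only [integral_finsetSum _ fun j _ => hint _ j, integral_sub (A _ _).1 (B _ _).1]
  simp only [Finset.sum_mul]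
  refine (norm_sum_le _ _).trans (Finset.sum_le_sum fun i _ => (norm_sum_le _ _).trans
    (Finset.sum_le_sum fun j _ => (norm_sub_le _ _).trans ?_))
  have a1 := (norm_integral_le_integral_norm _).trans (A i j).2
  have a2 := (norm_integral_le_integral_norm _).trans (B i j).2
  have hW := norm_entry_le W i j
  have := hC i
  calc _ ≤ C i * (‖W‖ * (eLpNorm f 2).toReal) + C₀ * (‖W‖ * (max R 0 * (eLpNorm f 2).toReal)) := by
        refine add_le_add (a1.trans ?_) (a2.trans ?_)
        · gcongr
        · gcongr
          exact hcm i
    _ = _ := by ring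

end

/-! ### Solving the divergence equation, up to the target density -/

section

variable {d : ℕ} {Ω : LipschitzDomain d}

lemma exists_norm_le_grad (hd : d = 2 ∨ d = 3) (Ω : LipschitzDomain d) :
    ∃ C : ℝ, 0 < C ∧ ∀ v : H10 Ω, ‖v‖ ≤ C * ‖grad v‖ := by
  obtain ⟨C, hC, h⟩ := exists_poincare hd Ω
  refine ⟨C + 1, by positivity, fun v => ?_⟩
  refine abs_le_of_sq_le_sq' ?_ (by positivity) |>.2
  rw [norm_sq_eq]
  have := h v
  have h0 := norm_nonneg (vel v)
  have h1 := norm_nonneg (grad v)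
  nlinarith [mul_le_mul this this h0 (by positivity), mul_nonneg hC.le (mul_nonneg h1 h1)]

/-- By Poincaré the gradient is bounded below. Closedness guarantees that a weak integral of
gradients is again a gradient. -/
lemma isClosed_range_gradL (hd : d = 2 ∨ d = 3) (Ω : LipschitzDomain d) :
    IsClosed (LinearMap.range (gradL Ω).toLinearMap : Set (Lp (Mat d) 2 Ω.vol)) := by
  obtain ⟨C, hC, h⟩ := exists_norm_le_grad hd Ω
  have : AntilipschitzWith C.toNNReal (gradL Ω) :=
    ContinuousLinearMap.antilipschitz_of_bound _ fun v => by
      rw [Real.coe_toNNReal _ hC.le]; exact h v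
  rw [LinearMap.coe_range]
  exact this.isClosed_range (gradL Ω).uniformContinuous

/-- The class in `L²(Ω)` of a smooth function with compact support. -/
def classL2 (Ω : LipschitzDomain d) {ψ : Vec d → ℝ} (hψ : ContDiff ℝ ∞ ψ)
    (hψc : HasCompactSupport ψ) : L2 Ω :=
  MemLp.toLp ψ (hψ.continuous.memLp_of_hasCompactSupport hψc)

lemma coeFn_classL2 {ψ : Vec d → ℝ} (hψ : ContDiff ℝ ∞ ψ) (hψc : HasCompactSupport ψ) :
    classL2 Ω hψ hψc =ᵐ[Ω.vol] ψ := MemLp.coeFn_toLp _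

lemma inner_classL2 {ψ : Vec d → ℝ} (hψ : ContDiff ℝ ∞ ψ) (hψc : HasCompactSupport ψ) (q : L2 Ω) :
    inner ℝ q (classL2 Ω hψ hψc) = ∫ x, ψ x * q x ∂Ω.vol := by
  rw [L2.inner_def]
  refine integral_congr_ae ?_
  filter_upwards [coeFn_classL2 (Ω := Ω) hψ hψc] with x hx
  rw [hx]; simp

/-- Functions in `L²(Ω)` that are orthogonal to all smooth densities in an open set vanish there. -/
lemma ae_eq_zero_of_forall_density {E : Set (Vec d)} (hE : IsOpen E) (hEΩ : E ⊆ Ω.carrier)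
    {q : L2 Ω} (hq : ∀ ψ : Vec d → ℝ, IsDensity E ψ → ∫ x, ψ x * q x ∂Ω.vol = 0) :
    ∀ᵐ x ∂Ω.vol, x ∈ E → q x = 0 := by
  have hint : Integrable q Ω.vol := (Lp.memLp q).integrable (by norm_num)
  have hloc : LocallyIntegrableOn q E volume := by
    have : IntegrableOn q Ω.carrier volume := hint
    exact (this.mono_set hEΩ).locallyIntegrableOn
  have h := hE.ae_eq_zero_of_integral_contDiff_smul_eq_zero hloc fun ψ hψ hψc hψE => by
    rw [← hq ψ ⟨hψ, hψc, hψE⟩, eq_comm]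
    refine setIntegral_eq_integral_of_forall_compl_eq_zero fun x hx => ?_
    rw [image_eq_zero_of_notMem_tsupport fun hx' => hx (hEΩ (hψE hx')), zero_mul]
  exact ae_restrict_of_ae h

/-- The weak integral of a function with values in a closed subspace of a Hilbert space. -/
lemma exists_weak_integral {H α : Type*} [NormedAddCommGroup H] [InnerProductSpace ℝ H]
    [CompleteSpace H] [MeasurableSpace α] (μ : Measure α) (K : Submodule ℝ H)
    (hK : IsClosed (K : Set H)) (g : α → H) (hg : ∀ s, g s ∈ K) {C : ℝ} (hC : 0 ≤ C)
    (hint : ∀ W, Integrable (fun s => inner ℝ (g s) W) μ)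
    (hbound : ∀ W, ‖∫ s, inner ℝ (g s) W ∂μ‖ ≤ C * ‖W‖) :
    ∃ U ∈ K, ‖U‖ ≤ C ∧ ∀ W, inner ℝ U W = ∫ s, inner ℝ (g s) W ∂μ := by
  obtain ⟨ℓ, hℓa, hℓn⟩ : ∃ ℓ : H →L[ℝ] ℝ, (∀ W, ℓ W = ∫ s, inner ℝ (g s) W ∂μ) ∧ ‖ℓ‖ ≤ C := by
    refine ⟨LinearMap.mkContinuous
      { toFun := fun W => ∫ s, inner ℝ (g s) W ∂μ
        map_add' := fun W W' => ?_
        map_smul' := fun c W => ?_ } C hbound,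
      fun W => rfl, LinearMap.mkContinuous_norm_le _ hC _⟩
    · simp only [inner_add_right]
      exact integral_add (hint W) (hint W')
    · simp only [inner_smul_right, RingHom.id_apply, smul_eq_mul]
      exact integral_const_mul _ _
  obtain ⟨U, hU⟩ := (InnerProductSpace.toDual ℝ H).surjective ℓ
  have hUi : ∀ W, inner ℝ U W = ℓ W := fun W => by
    rw [← hU, InnerProductSpace.toDual_apply_apply]
  refine ⟨U, ?_, ?_, fun W => by rw [hUi, hℓa]⟩
  -- A closed subspace is its double orthogonal complement, and `U` is orthogonal to whatever is
  -- orthogonal to all `g s`.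
  · rw [← IsClosed.submodule_topologicalClosure_eq hK, ← Submodule.orthogonal_orthogonal_eq_closure,
      Submodule.mem_orthogonal]
    intro W hW
    rw [real_inner_comm, hUi, hℓa]
    exact integral_eq_zero_of_ae (.of_forall fun s => (Submodule.mem_orthogonal _ _).1 hW _ (hg s))
  · rwa [← hU, LinearIsometryEquiv.norm_map] at hℓn

/-- The time integral of the gradient of the flux is the gradient of a field in `𝐇¹₀(Ω)`. -/
lemma IsTarget.exists_integral_flux (hd : d = 2 ∨ d = 3) {E : Set (Vec d)} {η : Vec d → ℝ}
    (hη : IsTarget Ω E η) :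
    ∃ C : ℝ, 0 ≤ C ∧ ∀ (f : Vec d → ℝ) (hf : IsDensity E f), ∃ v : H10 Ω,
      ‖v‖ ≤ C * ‖classL2 Ω hf.smooth hf.compact‖ ∧
      ∀ W, inner ℝ (gradL Ω v) W
        = ∫ s in Set.Ioo (0 : ℝ) 1, inner ℝ (gradL Ω (hη.fluxH10 hf s)) W := by
  obtain ⟨C, hC0, hC⟩ := hη.exists_inner_grad_fluxH10_le
  obtain ⟨P, hP, hPoin⟩ := exists_norm_le_grad hd Ω
  refine ⟨P * C, by positivity, fun f hf => ?_⟩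
  have hfn : (eLpNorm f 2).toReal = ‖classL2 Ω hf.smooth hf.compact‖ := by
    rw [classL2, Lp.norm_toLp]
    congr 1
    exact (eLpNorm_restrict_eq_of_support_subset
      ((subset_tsupport f).trans (hf.subset.trans hη.subset))).symm
  have hC' := hC f hf
  simp only [grad_eq_gradL, hfn] at hC' hPoin
  obtain ⟨U, ⟨v, rfl⟩, hUn, hUi⟩ := exists_weak_integral (volume.restrict (Set.Ioo (0 : ℝ) 1))
    (LinearMap.range (gradL Ω).toLinearMap) (isClosed_range_gradL hd Ω)
    (fun s => gradL Ω (hη.fluxH10 hf s)) (fun s => ⟨_, rfl⟩)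
    (mul_nonneg hC0 (norm_nonneg (classL2 Ω hf.smooth hf.compact)))
    (fun W => (hC' W).1) (fun W => (hC' W).2)
  refine ⟨v, (hPoin v).trans ?_, hUi⟩
  rw [mul_assoc]
  exact mul_le_mul_of_nonneg_left hUn hP.le

/-- The field is the time integral of the flux. Its divergence is identified by testing with smooth
densities `ψ` in `Ω`, where the integrated continuity equation applies. -/
theorem IsTarget.exists_divL_eq (hd : d = 2 ∨ d = 3) {E : Set (Vec d)} {η : Vec d → ℝ}
    (hη : IsTarget Ω E η) :
    ∃ C : ℝ, 0 ≤ C ∧ ∀ (f : Vec d → ℝ) (hf : IsDensity E f), ∃ v : H10 Ω,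
      ‖v‖ ≤ C * ‖classL2 Ω hf.smooth hf.compact‖ ∧
      divL Ω v = classL2 Ω hf.smooth hf.compact
        - (∫ x, f x) • classL2 Ω hη.smooth hη.compact := by
  obtain ⟨C, hC0, hC⟩ := hη.exists_integral_flux hd
  refine ⟨C, hC0, fun f hf => ?_⟩
  obtain ⟨v, hvn, hv⟩ := hC f hf
  refine ⟨v, hvn, ?_⟩
  · rw [← sub_eq_zero]
    refine Lp.ext ?_
    have hz := ae_eq_zero_of_forall_density Ω.isOpen subset_rfl
      (q := divL Ω v - (classL2 Ω hf.smooth hf.compact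
        - (∫ x, f x) • classL2 Ω hη.smooth hη.compact)) fun ψ hψ => ?_
    · filter_upwards [hz, ae_restrict_mem Ω.isOpen.measurableSet, Lp.coeFn_zero ℝ 2 Ω.vol]
        with x hx hxΩ h0
      rw [hx hxΩ, h0]; rfl
    · rw [← inner_classL2 hψ.smooth hψ.compact, inner_sub_left, inner_sub_left, inner_smul_left,
        sub_eq_zero]
      have e1 : inner ℝ (divL Ω v) (classL2 Ω hψ.smooth hψ.compact) =
          ∫ s in Set.Ioo (0 : ℝ) 1, ∫ x, ψ x * matTrace d (jacobian (flux η f s) x) ∂Ω.vol := by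
        -- Moving the trace to `ψ` by its adjoint reduces the pairing to one with `gradL Ω v`, for
        -- which the weak integral formula `hv` holds.
        rw [divL, ContinuousLinearMap.comp_apply, ← ContinuousLinearMap.adjoint_inner_right, hv]
        refine setIntegral_congr_fun measurableSet_Ioo fun s hs => ?_
        rw [ContinuousLinearMap.adjoint_inner_right]
        change inner ℝ (divL Ω (hη.fluxH10 hf s)) _ = _
        rw [inner_classL2, hη.fluxH10_of_mem hf hs]
        refine integral_congr_ae ?_
        filter_upwards [divL_toH10 (hη.isTestField_flux hf hs)] with x hx
        rw [hx]
      have e2 : ∀ g : Vec d → ℝ, (hg : ContDiff ℝ ∞ g) → (hgc : HasCompactSupport g) →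
          ∫ x, ψ x * classL2 Ω hg hgc x ∂Ω.vol = ∫ x, ψ x * g x := fun g hg hgc => by
        have hz : ∀ x ∉ Ω.carrier, ψ x * g x = 0 := fun x hx => by
          rw [image_eq_zero_of_notMem_tsupport fun hx' => hx (hψ.subset hx'), zero_mul]
        rw [← setIntegral_eq_integral_of_forall_compl_eq_zero hz]
        refine integral_congr_ae ?_
        filter_upwards [coeFn_classL2 (Ω := Ω) hg hgc] with x hx
        rw [hx]
      rw [e1, hη.integral_integral_mul_div_flux hf hψ.smooth hψ.compact, inner_classL2,
        inner_classL2, e2, e2]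
      rfl

end

/-! ### Densities -/

section

variable {d : ℕ} {Ω : LipschitzDomain d}

/-- The classes in `L²(Ω)` of the smooth densities with compact support in `E`. -/
def densities (Ω : LipschitzDomain d) (E : Set (Vec d)) : Submodule ℝ (L2 Ω) where
  carrier := {q | ∃ f : Vec d → ℝ, IsDensity E f ∧ q =ᵐ[Ω.vol] f}
  zero_mem' := ⟨0, ⟨contDiff_const, HasCompactSupport.zero, by simp [tsupport]⟩, Lp.coeFn_zero ..⟩
  add_mem' := by
    rintro p q ⟨f, hf, hp⟩ ⟨g, hg, hq⟩
    exact ⟨f + g, ⟨hf.smooth.add hg.smooth, hf.compact.add hg.compact,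
      (tsupport_add f g).trans (Set.union_subset hf.subset hg.subset)⟩,
      (Lp.coeFn_add p q).trans (hp.add hq)⟩
  smul_mem' := by
    rintro c q ⟨f, hf, hq⟩
    exact ⟨c • f, ⟨hf.smooth.const_smul c,
      hf.compact.comp_left (g := fun y => c • y) (smul_zero c),
      (closure_mono (Function.support_const_smul_subset c f)).trans hf.subset⟩,
      (Lp.coeFn_smul c q).trans (hq.const_smul c)⟩

/-- By duality: a function orthogonal to all densities vanishes on `E`, hence is orthogonal to `q`.
-/
lemma mem_closure_densities {E : Set (Vec d)} (hE : IsOpen E) (hEΩ : E ⊆ Ω.carrier) {q : L2 Ω}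
    (hq : ∀ᵐ x ∂Ω.vol, x ∉ E → q x = 0) : q ∈ (densities Ω E).topologicalClosure := by
  rw [← Submodule.orthogonal_orthogonal_eq_closure, Submodule.mem_orthogonal]
  intro r hr
  have hr0 := ae_eq_zero_of_forall_density hE hEΩ (q := r) fun ψ hψ => by
    rw [← inner_classL2 hψ.smooth hψ.compact, real_inner_comm]
    exact (Submodule.mem_orthogonal _ _).1 hr _ ⟨ψ, hψ, coeFn_classL2 _ _⟩
  rw [L2.inner_def]
  refine integral_eq_zero_of_ae ?_
  filter_upwards [hq, hr0] with x h1 h2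
  by_cases hx : x ∈ E
  · simp [h2 hx]
  · simp [h1 hx]

lemma meanL_classL2 {E : Set (Vec d)} (hEΩ : E ⊆ Ω.carrier) {f : Vec d → ℝ}
    (hf : IsDensity E f) : meanL Ω (classL2 Ω hf.smooth hf.compact) = ∫ x, f x := by
  rw [meanL_apply, integral_congr_ae (coeFn_classL2 (Ω := Ω) hf.smooth hf.compact)]
  exact setIntegral_eq_integral_of_forall_compl_eq_zero fun x hx =>
    image_eq_zero_of_notMem_tsupport fun hx' => hx (hEΩ (hf.subset hx'))

/-- Functions supported in `E` are congruent to a multiple of `η` modulo divergences. -/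
theorem IsTarget.exists_divL_eq_sub (hd : d = 2 ∨ d = 3) {E : Set (Vec d)} {η : Vec d → ℝ}
    (hη : IsTarget Ω E η) {q : L2 Ω} (hq : ∀ᵐ x ∂Ω.vol, x ∉ E → q x = 0) :
    ∃ v : H10 Ω, divL Ω v = q - meanL Ω q • classL2 Ω hη.smooth hη.compact := by
  obtain ⟨C, hC0, hC⟩ := hη.exists_divL_eq hd
  have hη1 : meanL Ω (classL2 Ω hη.smooth hη.compact) = 1 := by
    rw [← hη.integral_eq_one]
    exact meanL_classL2 (E := Ω.carrier) subset_rfl ⟨hη.smooth, hη.compact, hη.support_subset⟩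
  -- Adjoining the multiples of `η` makes `T` hit each density exactly, with a preimage bounded by
  -- its norm. Such bounded solvability passes from a subgroup to its closure because the domain is
  -- complete.
  obtain ⟨T, hT⟩ : ∃ T : H10 Ω × ℝ →L[ℝ] L2 Ω,
      ∀ p, T p = divL Ω p.1 + p.2 • classL2 Ω hη.smooth hη.compact :=
    ⟨(divL Ω).coprod (ContinuousLinearMap.toSpanSingleton ℝ (classL2 Ω hη.smooth hη.compact)),
      fun p => by simp⟩
  have hsurj : (AddMonoidHom.mkNormedAddGroupHom T.toLinearMap.toAddMonoidHom ‖T‖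
      T.le_opNorm).SurjectiveOnWith (densities Ω E).toAddSubgroup (C + ‖meanL Ω‖ + 1) := by
    rintro _ ⟨f, hf, hqf⟩
    rename_i q'
    have hq' : q' = classL2 Ω hf.smooth hf.compact := Lp.ext (hqf.trans (coeFn_classL2 _ _).symm)
    obtain ⟨v, hvn, hv⟩ := hC f hf
    refine ⟨(v, ∫ x, f x), ?_, ?_⟩
    · refine (hT (v, ∫ x, f x)).trans ?_
      rw [hv, hq', sub_add_cancel]
    · rw [Prod.norm_def, hq']
      have h1 : ‖∫ x, f x‖ ≤ ‖meanL Ω‖ * ‖classL2 Ω hf.smooth hf.compact‖ := by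
        rw [← meanL_classL2 hη.subset hf]
        exact (meanL Ω).le_opNorm _
      have h2 := norm_nonneg (classL2 Ω hf.smooth hf.compact)
      have h3 := mul_nonneg hC0 h2
      have h4 := mul_nonneg (norm_nonneg (meanL Ω)) h2
      refine max_le ?_ ?_
      · dsimp only; linarith
      · dsimp only; linarith
  obtain ⟨p, hp, -⟩ := controlled_closure_of_complete (by positivity) one_pos hsurj q
    (mem_closure_densities hη.isOpen hη.subset hq)
  have hp' : T p = q := hp
  rw [hT] at hp'
  refine ⟨p.1, ?_⟩
  -- Divergences have mean zero and `η` has mean one, so the coefficient of `η` is the mean of `q`.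
  rw [← hp', map_add, map_smul, meanL_divL, hη1]
  simp

end

/-! ### Surjectivity of the divergence -/

section

variable {d : ℕ} {Ω : LipschitzDomain d}

lemma exists_smooth_density (c : Vec d) {ρ : ℝ} (hρ : 0 < ρ) :
    ∃ η : Vec d → ℝ, ContDiff ℝ ∞ η ∧ HasCompactSupport η ∧ ∫ x, η x = 1 ∧
      tsupport η ⊆ Metric.closedBall c ρ := by
  let b : ContDiffBump c := ⟨ρ / 2, ρ, by positivity, by linarith⟩
  refine ⟨b.normed volume, b.contDiff_normed, b.hasCompactSupport_normed, b.integral_normed, ?_⟩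
  rw [b.tsupport_normed_eq]

/-- At an interior point a ball in `Ω` is convex, so any bump inside it is a target. -/
lemma exists_isTarget_of_mem {x : Vec d} (hx : x ∈ Ω.carrier) :
    ∃ r > 0, ∃ η, IsTarget Ω (Ω.carrier ∩ Metric.ball x r) η := by
  obtain ⟨r, hr, hrΩ⟩ := Metric.isOpen_iff.1 Ω.isOpen x hx
  obtain ⟨η, h1, h2, h3, h4⟩ := exists_smooth_density x (half_pos hr)
  have h5 : tsupport η ⊆ Metric.ball x r :=
    h4.trans (Metric.closedBall_subset_ball (half_lt_self hr))
  exact ⟨r, hr, η, h1, h2, h3, h5.trans hrΩ, fun a ha y hy s hs =>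
    hrΩ (convex_ball x r (h5 ha) hy.2 hs.1.le (by linarith [hs.2]) (by ring)),
    Ω.isOpen.inter Metric.isOpen_ball, Set.inter_subset_left⟩

/-- Near a Lipschitz graph, segments that end far enough above the graph stay above it. -/
lemma segment_above_graph {e : Vec d} (he : ‖e‖ = 1) {K : NNReal} {g : Vec d → ℝ}
    (hg : LipschitzWith K g) {h δ : ℝ} (hK : (4 * K + 2) * δ ≤ h) {y w : Vec d}
    (hy : g (y - inner ℝ e y • e) < inner ℝ e y) (hw : ‖w - h • e‖ ≤ 2 * δ) {s : ℝ} (hs : 0 ≤ s) :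
    g ((y + s • w) - inner ℝ e (y + s • w) • e) < inner ℝ e (y + s • w) := by
  obtain ⟨ε, rfl⟩ : ∃ ε, w = h • e + ε := ⟨w - h • e, by abel⟩
  rw [add_sub_cancel_left] at hw
  have hee : inner ℝ e e = (1 : ℝ) := by rw [real_inner_self_eq_norm_sq, he]; norm_num
  have h1 : |inner ℝ e ε| ≤ 2 * δ := by
    refine (abs_real_inner_le_norm e ε).trans ?_
    rwa [he, one_mul]
  have h2 : inner ℝ e (y + s • (h • e + ε)) = inner ℝ e y + s * (h + inner ℝ e ε) := by
    simp only [inner_add_right, inner_smul_right, hee]; ring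
  have h3 : ((y + s • (h • e + ε)) - inner ℝ e (y + s • (h • e + ε)) • e)
      - (y - inner ℝ e y • e) = s • (ε - inner ℝ e ε • e) := by
    rw [h2]; module
  have h4 : ‖ε - inner ℝ e ε • e‖ ≤ 4 * δ := by
    refine (norm_sub_le _ _).trans ?_
    rw [norm_smul, he, mul_one, Real.norm_eq_abs]
    linarith
  have h5 := hg.dist_le_mul ((y + s • (h • e + ε)) - inner ℝ e (y + s • (h • e + ε)) • e)
    (y - inner ℝ e y • e)
  rw [dist_eq_norm, dist_eq_norm, h3, norm_smul, Real.norm_of_nonneg hs, Real.norm_eq_abs] at h5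
  have h6 := (abs_le.1 h5).2
  have h7 : (K : ℝ) * (s * ‖ε - inner ℝ e ε • e‖) ≤ s * (K * (4 * δ)) := by
    rw [mul_left_comm]
    have := K.2
    gcongr
  -- The height gained, at least `s (h - 2δ)`, dominates the rise `4Kδ s` allowed by the Lipschitz
  -- constant; this is the hypothesis `hK`.
  have h8 : s * (K * (4 * δ)) ≤ s * (h + inner ℝ e ε) := by
    refine mul_le_mul_of_nonneg_left ?_ hs
    linarith [(abs_le.1 h1).1]
  rw [h2] at h6 ⊢
  linarith

/-- The target is a small bump at height `r / 2` above the boundary point. Directions from points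
near `x` to the bump are almost vertical, so these segments climb faster than the graph can. -/
lemma exists_isTarget_of_mem_frontier {x : Vec d} (hx : x ∈ frontier Ω.carrier) :
    ∃ r > 0, ∃ η, IsTarget Ω (Ω.carrier ∩ Metric.ball x r) η := by
  obtain ⟨e, K, g, he, hg, hev⟩ := Ω.hasLipschitzBoundary x hx
  obtain ⟨r, hr, hrΩ⟩ := Metric.eventually_nhds_iff_ball.1 hev
  -- This size keeps both endpoints in the ball of radius `r` and satisfies the slope condition with
  -- `h = r / 2`.
  obtain ⟨δ, hδ⟩ : ∃ δ, δ = r / (8 * (K + 1)) := ⟨_, rfl⟩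
  have hK0 : (0 : ℝ) ≤ K := K.2
  have hδ0 : 0 < δ := by rw [hδ]; positivity
  have hδ8 : 8 * (K + 1) * δ = r := by rw [hδ]; field_simp
  have hδr : 8 * δ ≤ r := by nlinarith
  have hKδ : (4 * K + 2) * δ ≤ r / 2 := by nlinarith
  obtain ⟨η, h1, h2, h3, h4⟩ := exists_smooth_density (x + (r / 2) • e) hδ0
  have key : ∀ a ∈ tsupport η, ∀ y ∈ Ω.carrier ∩ Metric.ball x δ, ∀ s ∈ Set.Icc (0 : ℝ) 1,
      s • a + (1 - s) • y ∈ Ω.carrier := by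
    intro a ha y hy s hs
    have ha' : ‖a - (x + (r / 2) • e)‖ ≤ δ := by
      rw [← dist_eq_norm]; exact h4 ha
    have hy' : ‖y - x‖ < δ := by rw [← dist_eq_norm]; exact hy.2
    have hab : a ∈ Metric.ball x r := by
      rw [Metric.mem_ball, dist_eq_norm]
      have : a - x = (a - (x + (r / 2) • e)) + (r / 2) • e := by abel
      rw [this]
      refine (norm_add_le _ _).trans_lt ?_
      rw [norm_smul, he, Real.norm_of_nonneg (by positivity)]
      linarith
    have hyb : y ∈ Metric.ball x r := by
      rw [Metric.mem_ball, dist_eq_norm]; linarith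
    have hp := convex_ball x r hab hyb hs.1 (by linarith [hs.2]) (by ring : s + (1 - s) = 1)
    rw [hrΩ _ hp]
    have hw : ‖(a - y) - (r / 2) • e‖ ≤ 2 * δ := by
      have : (a - y) - (r / 2) • e = (a - (x + (r / 2) • e)) - (y - x) := by abel
      rw [this]
      exact (norm_sub_le _ _).trans (by linarith)
    have := segment_above_graph he hg hKδ ((hrΩ y hyb).1 hy.1) hw hs.1
    have hps : s • a + (1 - s) • y = y + s • (a - y) := by module
    rw [hps]
    exact this
  refine ⟨δ, hδ0, η, h1, h2, h3, fun a ha => ?_, fun a ha y hy s hs =>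
    key a ha y hy s ⟨hs.1.le, hs.2.le⟩, Ω.isOpen.inter Metric.isOpen_ball, Set.inter_subset_left⟩
  -- The support of `η` lies in `Ω` by the endpoint `s = 1` of a segment from any nearby `y ∈ Ω`;
  -- hence `key` includes the endpoints.
  obtain ⟨y, hy, hyx⟩ := Metric.mem_closure_iff.1 (frontier_subset_closure hx) δ hδ0
  have := key a ha y ⟨hy, by rwa [Metric.mem_ball, dist_comm]⟩ 1 ⟨zero_le_one, le_rfl⟩
  simpa using this

lemma exists_isTarget {x : Vec d} (hx : x ∈ closure Ω.carrier) :
    ∃ r > 0, ∃ η, IsTarget Ω (Ω.carrier ∩ Metric.ball x r) η := by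
  by_cases h : x ∈ Ω.carrier
  · exact exists_isTarget_of_mem h
  · exact exists_isTarget_of_mem_frontier ⟨hx, by rwa [Ω.isOpen.interior_eq]⟩

/-- The range of the divergence on `𝐇¹₀(Ω)`. -/
def divRange (Ω : LipschitzDomain d) : Submodule ℝ (L2 Ω) := LinearMap.range (divL Ω).toLinearMap

/-- Locally, the class of a function modulo divergences is determined by its integral. -/
lemma exists_local_class (hd : d = 2 ∨ d = 3) {x : Vec d} (hx : x ∈ closure Ω.carrier) :
    ∃ r > 0, ∃ c : L2 Ω ⧸ divRange Ω, ∀ q : L2 Ω,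
      (∀ᵐ y ∂Ω.vol, y ∉ Metric.ball x r → q y = 0) → (divRange Ω).mkQ q = meanL Ω q • c := by
  obtain ⟨r, hr, η, hη⟩ := exists_isTarget hx
  refine ⟨r, hr, (divRange Ω).mkQ (classL2 Ω hη.smooth hη.compact), fun q hq => ?_⟩
  have hq' : ∀ᵐ y ∂Ω.vol, y ∉ Ω.carrier ∩ Metric.ball x r → q y = 0 := by
    filter_upwards [hq, ae_restrict_mem Ω.isOpen.measurableSet] with y h1 h2 h3
    exact h1 fun h4 => h3 ⟨h2, h4⟩
  obtain ⟨v, hv⟩ := hη.exists_divL_eq_sub hd hq'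
  rw [← map_smul, ← sub_eq_zero, ← map_sub, ← hv, Submodule.mkQ_apply,
    Submodule.Quotient.mk_eq_zero]
  exact ⟨v, rfl⟩

/-- Every function in `L²(Ω)` with mean value zero is the divergence of a field in `𝐇¹₀(Ω)`. -/
theorem exists_divL_eq_of_meanL_eq_zero (hd : d = 2 ∨ d = 3) {q : L2 Ω} (hq : meanL Ω q = 0) :
    ∃ v : H10 Ω, divL Ω v = q := by
  choose! r hr c hc using fun x (hx : x ∈ closure Ω.carrier) => exists_local_class hd hx
  have hsub : Ω.carrier ⊆ closure Ω.carrier := subset_closure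
  -- The indicator of the overlap of the two balls in `Ω` is admissible for both local classes and
  -- has nonzero mean, which forces the classes to agree.
  have hloc : ∀ x ∈ closure Ω.carrier, ∀ y ∈ Ω.carrier ∩ Metric.ball x (r x), c x = c y := by
    intro x hx y hy
    obtain ⟨V, hV⟩ : ∃ V, V = Ω.carrier ∩ (Metric.ball x (r x) ∩ Metric.ball y (r y)) := ⟨_, rfl⟩
    have hVo : IsOpen V := hV ▸ Ω.isOpen.inter (Metric.isOpen_ball.inter Metric.isOpen_ball)
    have hyV : y ∈ V := hV ▸ ⟨hy.1, hy.2, Metric.mem_ball_self (hr y (hsub hy.1))⟩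
    obtain ⟨p, hp⟩ : ∃ p : L2 Ω, p =ᵐ[Ω.vol] V.indicator fun _ => (1 : ℝ) :=
      ⟨indicatorConstLp 2 hVo.measurableSet (measure_ne_top _ _) 1, indicatorConstLp_coeFn⟩
    have hzero : ∀ B : Set (Vec d), V ⊆ B → ∀ᵐ z ∂Ω.vol, z ∉ B → p z = 0 := fun B hB => by
      filter_upwards [hp] with z hz hzB
      rw [hz, Set.indicator_of_notMem fun h => hzB (hB h)]
    have h1 := hc x hx p (hzero _ (hV ▸ fun z hz => hz.2.1))
    have h2 := hc y (hsub hy.1) p (hzero _ (hV ▸ fun z hz => hz.2.2))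
    have hm : meanL Ω p ≠ 0 := by
      rw [meanL_apply, integral_congr_ae hp, integral_indicator_const _ hVo.measurableSet,
        smul_eq_mul, mul_one, Measure.real, LipschitzDomain.vol,
        Measure.restrict_apply hVo.measurableSet,
        Set.inter_eq_left.2 (hV ▸ Set.inter_subset_left)]
      refine (ENNReal.toReal_pos (hVo.measure_pos _ ⟨y, hyV⟩).ne' ?_).ne'
      exact ((measure_mono (hV ▸ Set.inter_subset_left)).trans_lt
        Ω.isBounded.measure_lt_top).ne
    exact smul_right_injective _ hm (h1.symm.trans h2)
  obtain ⟨x₀, hx₀⟩ := Ω.isConnected.nonempty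
  have hconst : ∀ y ∈ Ω.carrier, c x₀ = c y := fun y hy =>
    Ω.isConnected.isPreconnected.induction₂ (fun x y => c x = c y)
      (fun x hx => by
        filter_upwards [self_mem_nhdsWithin,
          mem_nhdsWithin_of_mem_nhds (Metric.ball_mem_nhds x (hr x (hsub hx)))] with z h1 h2
        exact hloc x (hsub hx) z ⟨h1, h2⟩)
      (fun _ _ _ _ _ _ => Eq.trans) (fun _ _ _ _ => Eq.symm) hx₀ hy
  have hconst' : ∀ x ∈ closure Ω.carrier, c x = c x₀ := fun x hx => by
    obtain ⟨y, hy, hyx⟩ := Metric.mem_closure_iff.1 hx (r x) (hr x hx)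
    rw [hconst y hy]
    exact hloc x hx y ⟨hy, by rwa [Metric.mem_ball, dist_comm]⟩
  have hcomp : IsCompact (closure Ω.carrier) := Ω.isBounded.isCompact_closure
  obtain ⟨t, ht, htm, hP⟩ : ∃ t, closure Ω.carrier ⊆ t ∧ MeasurableSet t ∧ ∀ q : L2 Ω,
      (∀ᵐ y ∂Ω.vol, y ∉ t → q y = 0) → (divRange Ω).mkQ q = meanL Ω q • c x₀ := by
    -- With a common class, the property passes to unions: cut `q` into its restriction to `t` and
    -- the rest. No smooth partition of unity is needed, only measurability of `t`.
    refine hcomp.induction_on (p := fun s => ∃ t, s ⊆ t ∧ MeasurableSet t ∧ ∀ q : L2 Ω,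
      (∀ᵐ y ∂Ω.vol, y ∉ t → q y = 0) → (divRange Ω).mkQ q = meanL Ω q • c x₀) ?_ ?_ ?_ ?_
    · refine ⟨∅, subset_rfl, MeasurableSet.empty, fun q hq => ?_⟩
      have : q = 0 := Lp.ext (by
        filter_upwards [hq, Lp.coeFn_zero ℝ 2 Ω.vol] with y h1 h2
        rw [h1 (Set.notMem_empty y), h2]; rfl)
      rw [this]; simp
    · rintro s s' hs ⟨t, h1, h2, h3⟩
      exact ⟨t, hs.trans h1, h2, h3⟩
    · rintro s s' ⟨t, h1, h2, h3⟩ ⟨t', h1', h2', h3'⟩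
      refine ⟨t ∪ t', Set.union_subset_union h1 h1', h2.union h2', fun q hq => ?_⟩
      obtain ⟨p, hp⟩ : ∃ p : L2 Ω, p =ᵐ[Ω.vol] t.indicator q :=
        ⟨((Lp.memLp q).indicator h2).toLp _, MemLp.coeFn_toLp _⟩
      have e1 := h3 p (by
        filter_upwards [hp] with y hy hyt
        rw [hy, Set.indicator_of_notMem hyt])
      have e2 := h3' (q - p) (by
        filter_upwards [hp, hq, Lp.coeFn_sub q p] with y hy hqy hs hyt
        rw [hs, Pi.sub_apply, hy]
        by_cases hyt' : y ∈ t
        · rw [Set.indicator_of_mem hyt', sub_self]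
        · rw [Set.indicator_of_notMem hyt', hqy (by simp [hyt, hyt']), sub_zero])
      have : q = p + (q - p) := by abel
      rw [this, map_add, map_add, e1, e2, add_smul]
    · intro x hx
      refine ⟨Metric.ball x (r x), mem_nhdsWithin_of_mem_nhds (Metric.ball_mem_nhds x (hr x hx)),
        Metric.ball x (r x), subset_rfl, measurableSet_ball, fun q hq => ?_⟩
      rw [hc x hx q hq, hconst' x hx]
  have hfin := hP q (by
    filter_upwards [ae_restrict_mem Ω.isOpen.measurableSet] with y hy hyt
    exact absurd (ht (hsub hy)) hyt)
  rw [hq, zero_smul, Submodule.mkQ_apply, Submodule.Quotient.mk_eq_zero] at hfin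
  exact hfin

end

/-! ### Saddle point problems -/

section Saddle

variable {X M : Type*} [NormedAddCommGroup X] [InnerProductSpace ℝ X]
  [NormedAddCommGroup M] [InnerProductSpace ℝ M]

/-- The functional `v ↦ (p, D v)`. -/
def multiplier (D : X →L[ℝ] M) : M →L[ℝ] (X →L[ℝ] ℝ) :=
  (innerSL ℝ).bilinearComp (ContinuousLinearMap.id ℝ M) D

/-- The saddle point operator `(y, p) ↦ (A y - (p, D ·), (D y, ·))`. -/
def saddle (A : X →L[ℝ] X →L[ℝ] ℝ) (D : X →L[ℝ] M) :
    X × M →L[ℝ] (X →L[ℝ] ℝ) × (M →L[ℝ] ℝ) :=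
  (A.comp (ContinuousLinearMap.fst ℝ X M) -
    (multiplier D).comp (ContinuousLinearMap.snd ℝ X M)).prod
      ((innerSL ℝ).comp (D.comp (ContinuousLinearMap.fst ℝ X M)))

lemma saddle_apply_fst (A : X →L[ℝ] X →L[ℝ] ℝ) (D : X →L[ℝ] M) (x : X × M) (v : X) :
    (saddle A D x).1 v = A x.1 v - inner ℝ x.2 (D v) := rfl

lemma saddle_apply_snd (A : X →L[ℝ] X →L[ℝ] ℝ) (D : X →L[ℝ] M) (x : X × M) (q : M) :
    (saddle A D x).2 q = inner ℝ (D x.1) q := rfl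

variable [CompleteSpace X] [CompleteSpace M]

/-- A functional that vanishes on the kernel of a surjective operator is given by a multiplier. -/
lemma exists_multiplier (D : X →L[ℝ] M) (hD : Function.Surjective D) (ℓ : X →L[ℝ] ℝ)
    (hℓ : ∀ v, D v = 0 → ℓ v = 0) : ∃ p : M, ∀ v, inner ℝ p (D v) = ℓ v := by
  let L : M →ₗ[ℝ] ℝ := ((LinearMap.ker D.toLinearMap).liftQ ℓ.toLinearMap fun v hv => hℓ v hv).comp
    (D.toLinearMap.quotKerEquivOfSurjective hD).symm.toLinearMap
  have hL : ∀ v, L (D v) = ℓ v := fun v => by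
    have : (D.toLinearMap.quotKerEquivOfSurjective hD).symm (D v) =
        (LinearMap.ker D.toLinearMap).mkQ v := by
      rw [LinearEquiv.symm_apply_eq]; rfl
    change (LinearMap.ker D.toLinearMap).liftQ ℓ.toLinearMap (fun v hv => hℓ v hv)
      ((D.toLinearMap.quotKerEquivOfSurjective hD).symm (D v)) = ℓ v
    rw [this]; rfl
  have hc : Continuous L := by
    -- By the open mapping theorem `D` is a quotient map, so continuity of `L` follows from
    -- continuity of `ℓ = L ∘ D`.
    have hq := (D.isOpenMap hD).isQuotientMap D.continuous hD
    rw [hq.continuous_iff]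
    exact ℓ.continuous.congr fun v => (hL v).symm
  obtain ⟨p, hp⟩ := (InnerProductSpace.toDual ℝ M).surjective ⟨L, hc⟩
  refine ⟨p, fun v => ?_⟩
  rw [← InnerProductSpace.toDual_apply_apply (𝕜 := ℝ), hp]
  exact hL v

/-- Brezzi's theorem for a coercive form and a surjective constraint operator. -/
theorem saddle_bijective (A : X →L[ℝ] X →L[ℝ] ℝ) (D : X →L[ℝ] M) (hD : Function.Surjective D)
    {c : ℝ} (hc : 0 < c) (hA : ∀ y, c * ‖y‖ * ‖y‖ ≤ A y y) : Function.Bijective (saddle A D) := by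
  constructor
  · rw [injective_iff_map_eq_zero]
    rintro ⟨y, p⟩ h
    have h1 : ∀ v, A y v = inner ℝ p (D v) := fun v => by
      have := congrArg (fun z => z.1 v) h
      simpa [saddle_apply_fst, sub_eq_zero] using this
    have h2 : ∀ q, inner ℝ (D y) q = 0 := fun q => congrArg (fun z => z.2 q) h
    have hy : y = 0 := by
      have h3 := hA y
      rw [h1, real_inner_comm, h2] at h3
      by_contra hne
      have : 0 < ‖y‖ := norm_pos_iff.2 hne
      have : 0 < c * ‖y‖ * ‖y‖ := by positivity
      linarith
    obtain ⟨v, hv⟩ := hD p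
    have hp : p = 0 := by
      have := h1 v
      rw [hv, hy] at this
      simpa using this.symm
    rw [hy, hp]; rfl
  · rintro ⟨g₁, g₂⟩
    -- `y₀` lifts the constraint, Lax–Milgram on the kernel of `D` corrects it to `y₀ + y₁`, and the
    -- residual, which vanishes on the kernel, is absorbed by a multiplier.
    obtain ⟨y₀, hy₀⟩ := hD ((InnerProductSpace.toDual ℝ M).symm g₂)
    let V := LinearMap.ker D.toLinearMap
    have hVc : IsClosed (V : Set X) := D.isClosed_ker
    have : CompleteSpace V := hVc.completeSpace_coe
    let B : V →L[ℝ] V →L[ℝ] ℝ := A.bilinearComp V.subtypeL V.subtypeL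
    have hB : IsCoercive B := ⟨c, hc, fun v => hA v⟩
    let r : V →L[ℝ] ℝ := (g₁ - A y₀).comp V.subtypeL
    obtain ⟨y₁, hy₁⟩ : ∃ y₁ : V, ∀ v : V, A y₁ v = g₁ v - A y₀ v := by
      refine ⟨hB.continuousLinearEquivOfBilin.symm ((InnerProductSpace.toDual ℝ V).symm r),
        fun v => ?_⟩
      have := hB.continuousLinearEquivOfBilin_apply
        (hB.continuousLinearEquivOfBilin.symm ((InnerProductSpace.toDual ℝ V).symm r)) v
      rw [ContinuousLinearEquiv.apply_symm_apply, InnerProductSpace.toDual_symm_apply] at this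
      exact this.symm
    obtain ⟨p, hp⟩ := exists_multiplier D hD (A (y₀ + y₁) - g₁) fun v hv => by
      have := hy₁ ⟨v, hv⟩
      simp only [map_add, sub_apply, add_apply]
      linarith
    refine ⟨(y₀ + y₁, p), Prod.ext (ContinuousLinearMap.ext fun v => ?_)
      (ContinuousLinearMap.ext fun q => ?_)⟩
    · rw [saddle_apply_fst]
      dsimp only
      rw [hp]; simp
    · have h1 : D y₁ = 0 := y₁.2
      rw [saddle_apply_snd]
      dsimp only
      rw [map_add, h1, add_zero, hy₀, InnerProductSpace.toDual_symm_apply]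

end Saddle

/-! ### Smooth dependence on a parameter and second derivatives -/

section Smooth

variable {U Z Y H : Type*} [NormedAddCommGroup U] [NormedSpace ℝ U] [NormedAddCommGroup Z]
  [NormedSpace ℝ Z] [NormedAddCommGroup Y] [NormedSpace ℝ Y]
  [NormedAddCommGroup H] [InnerProductSpace ℝ H]

lemma contDiffAt_inverse_apply [CompleteSpace Z] (K₀ : Z →L[ℝ] Y) (K₁ : U →L[ℝ] Z →L[ℝ] Y) (F : Y)
    {u : U} (hu : (K₀ + K₁ u).IsInvertible) {n : WithTop ℕ∞} :
    ContDiffAt ℝ n (fun u => (K₀ + K₁ u).inverse F) u := by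
  have h1 : ContDiffAt ℝ n (fun u => K₀ + K₁ u) u := contDiffAt_const.add K₁.contDiff.contDiffAt
  exact (hu.contDiffAt_map_inverse.comp u h1).clm_apply contDiffAt_const

lemma eventually_isInvertible [CompleteSpace Z] (K₀ : Z →L[ℝ] Y) (K₁ : U →L[ℝ] Z →L[ℝ] Y) {u : U}
    (hu : (K₀ + K₁ u).IsInvertible) : ∀ᶠ u' in 𝓝 u, (K₀ + K₁ u').IsInvertible := by
  have hcont : Continuous fun u' => K₀ + K₁ u' := continuous_const.add K₁.continuous
  obtain ⟨e, he⟩ := hu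
  have := e.nhds
  rw [he] at this
  exact hcont.continuousAt this

/-- The first and second derivatives of an implicitly defined solution map. -/
lemma fderiv_of_forall_eq (K₀ : Z →L[ℝ] Y) (K₁ : U →L[ℝ] Z →L[ℝ] Y) (F : Y) {S : U → Z} {u : U}
    (hS : ContDiffAt ℝ 2 S u) (heq : ∀ᶠ u' in 𝓝 u, (K₀ + K₁ u') (S u') = F) (v : U) :
    (K₀ + K₁ u) (fderiv ℝ S u v) = - K₁ v (S u) ∧
    (K₀ + K₁ u) (fderiv ℝ (fderiv ℝ S) u v v) = - (2 : ℝ) • K₁ v (fderiv ℝ S u v) := by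
  have hd : ∀ᶠ u' in 𝓝 u, DifferentiableAt ℝ S u' :=
    (hS.eventually (by simp)).mono fun u' h => h.differentiableAt (by simp)
  have hK : ∀ u', HasFDerivAt (fun u => K₀ + K₁ u) K₁ u' := fun u' =>
    K₁.hasFDerivAt.const_add K₀
  -- The linearized equation is needed on a neighbourhood, not only at `u`, so that it can be
  -- differentiated again in the direction `v`.
  have h1 : ∀ᶠ u' in 𝓝 u, ∀ v, K₁ v (S u') + (K₀ + K₁ u') (fderiv ℝ S u' v) = 0 := by
    filter_upwards [hd, heq.eventually_nhds] with u' hdu' hequ' v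
    have e1 := (hK u').clm_apply hdu'.hasFDerivAt
    have e2 : HasFDerivAt (fun u => (K₀ + K₁ u) (S u)) (0 : U →L[ℝ] Y) u' :=
      (hasFDerivAt_const F u').congr_of_eventuallyEq hequ'
    have := congrArg (fun L => L v) (e1.unique e2)
    simpa [add_comm] using this
  have hd2 : HasFDerivAt (fderiv ℝ S) (fderiv ℝ (fderiv ℝ S) u) u :=
    ((hS.fderiv_right (m := 1) (by norm_num)).differentiableAt (by simp)).hasFDerivAt
  have e3 := ((K₁ v).hasFDerivAt.comp u hd.self_of_nhds.hasFDerivAt).add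
    ((hK u).clm_apply (hd2.clm_apply (hasFDerivAt_const v u)))
  have e4 : HasFDerivAt (fun u' => K₁ v (S u') + (K₀ + K₁ u') (fderiv ℝ S u' v)) (0 : U →L[ℝ] Y) u :=
    (hasFDerivAt_const (0 : Y) u).congr_of_eventuallyEq (h1.mono fun u' h => h v)
  refine ⟨eq_neg_of_add_eq_zero_right (h1.self_of_nhds v), ?_⟩
  have h5 := congrArg (fun L => L v) (e3.unique e4)
  simp only [add_apply, ContinuousLinearMap.comp_apply, ContinuousLinearMap.flip_apply,
    zero_apply, map_zero, zero_add] at h5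
  rw [neg_smul, two_smul, eq_neg_iff_add_eq_zero, ← h5]
  simp only [add_apply]
  abel

lemma contDiffAt_half_norm_sq (P : Z →L[ℝ] H) (b : H) {S : U → Z} {u : U}
    (hS : ContDiffAt ℝ 2 S u) : ContDiffAt ℝ 2 (fun u => 1 / 2 * ‖P (S u) - b‖ ^ 2) u :=
  contDiffAt_const.mul (((P.contDiff.contDiffAt.comp u hS).sub contDiffAt_const).norm_sq ℝ)

lemma second_fderiv_half_norm_sq (P : Z →L[ℝ] H) (b : H) {S : U → Z} {u : U}
    (hS : ContDiffAt ℝ 2 S u) (v : U) :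
    fderiv ℝ (fderiv ℝ fun u => 1 / 2 * ‖P (S u) - b‖ ^ 2) u v v
      = ‖P (fderiv ℝ S u v)‖ ^ 2 + inner ℝ (P (S u) - b) (P (fderiv ℝ (fderiv ℝ S) u v v)) := by
  have hd : ∀ᶠ u' in 𝓝 u, DifferentiableAt ℝ S u' :=
    (hS.eventually (by simp)).mono fun u' h => h.differentiableAt (by simp)
  have hT : ∀ u', DifferentiableAt ℝ S u' →
      HasFDerivAt (fun u => P (S u) - b) (P.comp (fderiv ℝ S u')) u' := fun u' h =>
    (P.hasFDerivAt.comp u' h.hasFDerivAt).sub_const b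
  have h1 : ∀ᶠ u' in 𝓝 u, fderiv ℝ (fun u => 1 / 2 * ‖P (S u) - b‖ ^ 2) u' v
      = inner ℝ (P (S u') - b) (P (fderiv ℝ S u' v)) := by
    filter_upwards [hd] with u' h
    rw [((hT u' h).norm_sq.const_mul (1 / 2)).fderiv]
    simp [inner_sub_left]
  have hd2 : HasFDerivAt (fderiv ℝ S) (fderiv ℝ (fderiv ℝ S) u) u :=
    ((hS.fderiv_right (m := 1) (by norm_num)).differentiableAt (by simp)).hasFDerivAt
  have hJ2 : HasFDerivAt (fderiv ℝ fun u => 1 / 2 * ‖P (S u) - b‖ ^ 2)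
      (fderiv ℝ (fderiv ℝ fun u => 1 / 2 * ‖P (S u) - b‖ ^ 2) u) u :=
    (((contDiffAt_half_norm_sq P b hS).fderiv_right (m := 1) (by norm_num)).differentiableAt
      (by simp)).hasFDerivAt
  have e1 := hJ2.clm_apply (hasFDerivAt_const v u)
  have e2 := ((hT u hd.self_of_nhds).inner ℝ
    (P.hasFDerivAt.comp u (hd2.clm_apply (hasFDerivAt_const v u)))).congr_of_eventuallyEq h1
  have := congrArg (fun L => L v) (e1.unique e2)
  simp only [add_apply, ContinuousLinearMap.comp_apply, ContinuousLinearMap.flip_apply,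
    zero_apply, map_zero, zero_add, ContinuousLinearMap.prod_apply,
    fderivInnerCLM_apply] at this
  rw [this, add_comm, ← real_inner_self_eq_norm_sq]
  rfl

end Smooth

/-! ### Reduced functionals constrained by a saddle point problem -/

section Control

variable {U X M H N : Type*} [NormedAddCommGroup U] [NormedSpace ℝ U]
  [NormedAddCommGroup X] [InnerProductSpace ℝ X] [NormedAddCommGroup M] [InnerProductSpace ℝ M]
  [NormedAddCommGroup H] [InnerProductSpace ℝ H] [NormedAddCommGroup N] [InnerProductSpace ℝ N]

/-- The dependence of the saddle point operator on a parameter in the bilinear form. -/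
def saddleParam (W : U →L[ℝ] X →L[ℝ] X →L[ℝ] ℝ) (M : Type*) [NormedAddCommGroup M]
    [InnerProductSpace ℝ M] : U →L[ℝ] X × M →L[ℝ] (X →L[ℝ] ℝ) × (M →L[ℝ] ℝ) :=
  (ContinuousLinearMap.compL ℝ (X × M) (X →L[ℝ] ℝ) ((X →L[ℝ] ℝ) × (M →L[ℝ] ℝ))
      (ContinuousLinearMap.inl ℝ (X →L[ℝ] ℝ) (M →L[ℝ] ℝ))).comp
    (((ContinuousLinearMap.compL ℝ (X × M) X (X →L[ℝ] ℝ)).flip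
      (ContinuousLinearMap.fst ℝ X M)).comp W)

lemma saddleParam_apply (W : U →L[ℝ] X →L[ℝ] X →L[ℝ] ℝ) (u : U) (x : X × M) :
    saddleParam W M u x = (W u x.1, 0) := rfl

set_option synthInstance.maxHeartbeats 100000 in
lemma saddle_add_saddleParam (A : X →L[ℝ] X →L[ℝ] ℝ) (W : U →L[ℝ] X →L[ℝ] X →L[ℝ] ℝ)
    (D : X →L[ℝ] M) (u : U) : saddle A D + saddleParam W M u = saddle (A + W u) D := by
  refine ContinuousLinearMap.ext fun x => Prod.ext (ContinuousLinearMap.ext fun v => ?_) (ContinuousLinearMap.ext fun q => ?_)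
  · simp only [add_apply, Prod.fst_add, saddle_apply_fst, saddleParam_apply]
    ring
  · simp only [add_apply, Prod.snd_add, saddle_apply_snd, saddleParam_apply]
    simp

lemma saddle_isInvertible [CompleteSpace X] [CompleteSpace M] {A : X →L[ℝ] X →L[ℝ] ℝ}
    {D : X →L[ℝ] M} (h : Function.Bijective (saddle A D)) : (saddle A D).IsInvertible :=
  ⟨ContinuousLinearEquiv.ofBijective (saddle A D) (LinearMap.ker_eq_bot.2 h.1)
    (LinearMap.range_eq_top.2 h.2), ContinuousLinearEquiv.coe_ofBijective ..⟩

set_option synthInstance.maxHeartbeats 100000 in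
/-- Near a parameter for which the saddle point operator is invertible, the equation has exactly one
solution, and the solution map is smooth. -/
lemma contDiffAt_of_forall_saddle_eq [CompleteSpace X] [CompleteSpace M]
    {A : X →L[ℝ] X →L[ℝ] ℝ} {W : U →L[ℝ] X →L[ℝ] X →L[ℝ] ℝ} {D : X →L[ℝ] M}
    {F : (X →L[ℝ] ℝ) × (M →L[ℝ] ℝ)} {S : U → X × M} {u : U}
    (hu : Function.Bijective (saddle (A + W u) D))
    (hS : ∀ u', (∃ x, saddle (A + W u') D x = F) → saddle (A + W u') D (S u') = F) :
    (∀ᶠ u' in 𝓝 u, saddle (A + W u') D (S u') = F) ∧ ContDiffAt ℝ 2 S u := by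
  have hinv : (saddle A D + saddleParam W M u).IsInvertible := by
    rw [saddle_add_saddleParam]; exact saddle_isInvertible hu
  have hev := eventually_isInvertible _ _ hinv
  -- `S` is only assumed to solve the equation when a solution exists. Where the operator is
  -- invertible this forces `S u'` to be the inverse applied to `F`, a smooth function of `u'`.
  have hev2 : ∀ᶠ u' in 𝓝 u, saddle (A + W u') D (S u') = F ∧
      (saddle A D + saddleParam W M u').inverse F = S u' := by
    filter_upwards [hev] with u' h
    obtain ⟨e, he⟩ := h
    have h1 : saddle (A + W u') D (S u') = F := by
      refine hS u' ⟨e.symm F, ?_⟩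
      rw [← saddle_add_saddleParam, ← he]
      exact e.apply_symm_apply F
    refine ⟨h1, ?_⟩
    rw [← saddle_add_saddleParam, ← he] at h1
    rw [← he, ContinuousLinearMap.inverse_equiv, ← h1]
    exact e.symm_apply_apply _
  refine ⟨hev2.mono fun _ h => h.1, ?_⟩
  exact (contDiffAt_inverse_apply _ _ F hinv).congr_of_eventuallyEq
    (hev2.mono fun _ h => h.2.symm)

variable {A : X →L[ℝ] X →L[ℝ] ℝ} {W : U →L[ℝ] X →L[ℝ] X →L[ℝ] ℝ} {D : X →L[ℝ] M}

/-- The linearized equation. -/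
lemma saddle_fderiv {F : (X →L[ℝ] ℝ) × (M →L[ℝ] ℝ)} {S : U → X × M} {u : U}
    (hS : ContDiffAt ℝ 2 S u) (heq : ∀ᶠ u' in 𝓝 u, saddle (A + W u') D (S u') = F) (v : U) :
    saddle (A + W u) D (fderiv ℝ S u v) = (- W v (S u).1, 0) ∧
    saddle (A + W u) D (fderiv ℝ (fderiv ℝ S) u v v) = ((- 2 : ℝ) • W v (fderiv ℝ S u v).1, 0) := by
  have h := fderiv_of_forall_eq (saddle A D) (saddleParam W M) F hS
    (heq.mono fun u' h => by rw [saddle_add_saddleParam]; exact h) v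
  rw [saddle_add_saddleParam, saddleParam_apply, saddleParam_apply] at h
  refine ⟨h.1.trans (Prod.ext rfl neg_zero), h.2.trans (Prod.ext rfl (smul_zero _))⟩

/-- A reduced tracking functional has a second derivative that is represented by an adjoint state. -/
lemma second_fderiv_reduced (hA : ∀ y v, A y v = A v y) (hW : ∀ w y v, W w y v = W w v y)
    {F : (X →L[ℝ] ℝ) × (M →L[ℝ] ℝ)} {S : U → X × M} {u : U} (hS : ContDiffAt ℝ 2 S u)
    (heq : ∀ᶠ u' in 𝓝 u, saddle (A + W u') D (S u') = F) (E : X →L[ℝ] H) (b : H)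
    (ι : U →L[ℝ] N) (α : ℝ) {z : X} {r : M}
    (hz : ∀ v, (A + W u) z v + inner ℝ r (D v) = inner ℝ (E (S u).1 - b) (E v)) (hz0 : D z = 0)
    (v : U) :
    fderiv ℝ (fderiv ℝ fun u => 1 / 2 * ‖E (S u).1 - b‖ ^ 2 + α / 2 * ‖ι u‖ ^ 2) u v v
      = α * ‖ι v‖ ^ 2 - 2 * W v (fderiv ℝ S u v).1 z + ‖E (fderiv ℝ S u v).1‖ ^ 2 := by
  let P : X × M →L[ℝ] H := E.comp (ContinuousLinearMap.fst ℝ X M)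
  have h1 := second_fderiv_half_norm_sq P b hS v
  have c1 := contDiffAt_half_norm_sq P b hS
  -- The control cost is a tracking term with the identity as solution map and target `0`; its
  -- second order contribution vanishes by `hid`.
  have h2 := second_fderiv_half_norm_sq ι 0 (S := fun u => u) (contDiff_id.contDiffAt (x := u)) v
  have c2 := contDiffAt_half_norm_sq ι 0 (S := fun u => u) (contDiff_id.contDiffAt (x := u))
  have hfun : (fun u => 1 / 2 * ‖E (S u).1 - b‖ ^ 2 + α / 2 * ‖ι u‖ ^ 2) =
      (fun u => 1 / 2 * ‖P (S u) - b‖ ^ 2) + α • fun u => 1 / 2 * ‖ι u - 0‖ ^ 2 := by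
    funext u'
    simp only [Pi.add_apply, Pi.smul_apply, sub_zero, smul_eq_mul]
    change _ = 1 / 2 * ‖E (S u').1 - b‖ ^ 2 + _
    ring
  have hd : fderiv ℝ (fun u => 1 / 2 * ‖E (S u).1 - b‖ ^ 2 + α / 2 * ‖ι u‖ ^ 2) =ᶠ[𝓝 u]
      fderiv ℝ (fun u => 1 / 2 * ‖P (S u) - b‖ ^ 2) +
        α • fderiv ℝ (fun u => 1 / 2 * ‖ι u - 0‖ ^ 2) := by
    filter_upwards [c1.eventually (by simp), c2.eventually (by simp)] with u' k1 k2
    rw [hfun, fderiv_add (k1.differentiableAt (by simp))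
      ((k2.differentiableAt (by simp)).const_smul α),
      fderiv_const_smul (k2.differentiableAt (by simp))]
    rfl
  have d1 := (c1.fderiv_right (m := 1) (by norm_num)).differentiableAt (by simp)
  have d2 := (c2.fderiv_right (m := 1) (by norm_num)).differentiableAt (by simp)
  have hid : fderiv ℝ (fderiv ℝ fun u : U => u) u = 0 := by
    have : fderiv ℝ (fun u : U => u) = fun _ => ContinuousLinearMap.id ℝ U :=
      funext fun x => fderiv_fun_id
    rw [this]; simp
  rw [hid, fderiv_fun_id] at h2
  rw [hd.fderiv_eq, fderiv_add d1 (d2.const_smul α), fderiv_const_smul d2]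
  simp only [add_apply, smul_apply]
  rw [h1, h2]
  obtain ⟨-, h3⟩ := saddle_fderiv hS heq v
  obtain ⟨η, hη⟩ : ∃ η, η = fderiv ℝ (fderiv ℝ S) u v v := ⟨_, rfl⟩
  rw [← hη] at h3
  -- Test the equation of `η` with `z`, where `D z = 0` removes the pressure, and the adjoint
  -- equation with `η`, where `D η.1 = 0` removes `r`. Symmetry of the forms identifies the two
  -- results.
  have h4 : (A + W u) η.1 z = - 2 * W v (fderiv ℝ S u v).1 z := by
    have := congrArg (fun y => y.1 z) h3
    simpa [saddle_apply_fst, hz0] using this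
  have h5 : inner ℝ r (D η.1) = 0 := by
    rw [real_inner_comm]
    exact congrArg (fun y => y.2 r) h3
  have h6 : inner ℝ (P (S u) - b) (P η) = - 2 * W v (fderiv ℝ S u v).1 z := by
    have := hz η.1
    rw [h5, add_zero] at this
    change inner ℝ (E (S u).1 - b) (E η.1) = _
    rw [← this, ← h4]
    simp only [add_apply, hA z, hW u z]
  rw [← hη, h6]
  simp only [ContinuousLinearMap.id_apply, zero_apply, map_zero, inner_zero_right, add_zero,
    smul_eq_mul]
  change ‖E (fderiv ℝ S u v).1‖ ^ 2 + _ + _ = _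
  ring

end Control

/-! ### The Lipschitz estimate -/

section Estimate

variable {U X M H N : Type*} [NormedAddCommGroup U] [NormedSpace ℝ U]
  [NormedAddCommGroup X] [InnerProductSpace ℝ X] [NormedAddCommGroup M] [InnerProductSpace ℝ M]
  [NormedAddCommGroup H] [InnerProductSpace ℝ H] [NormedAddCommGroup N] [InnerProductSpace ℝ N]

/-- The form `(m(w) E y, E v)`, linear in the parameter `w`. -/
def pullbackForm (m : U →L[ℝ] H →L[ℝ] H) (E : X →L[ℝ] H) : U →L[ℝ] X →L[ℝ] X →L[ℝ] ℝ :=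
  (ContinuousLinearMap.compL ℝ X H (X →L[ℝ] ℝ)
    ((innerSL ℝ).bilinearComp (ContinuousLinearMap.id ℝ H) E)).comp
      (((ContinuousLinearMap.compL ℝ X H H).flip E).comp m)

lemma pullbackForm_apply (m : U →L[ℝ] H →L[ℝ] H) (E : X →L[ℝ] H) (w : U) (y v : X) :
    pullbackForm m E w y v = inner ℝ (m w (E y)) (E v) := rfl

/-- The energy estimate. -/
lemma norm_le_of_energy {W : X →L[ℝ] X →L[ℝ] ℝ} {G : X →L[ℝ] N} {y : X} {k : ℝ} (hk : 0 ≤ k)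
    (hW : 0 ≤ W y y) (h : inner ℝ (G y) (G y) + W y y ≤ k * ‖G y‖) : ‖G y‖ ≤ k := by
  rw [real_inner_self_eq_norm_sq] at h
  by_contra! hlt
  nlinarith [norm_nonneg (G y)]

/-- The Lipschitz estimate for the second derivative of the reduced functional, in terms of the
states `y`, the linearized states `φ` and the adjoint states `z` of two parameters. -/
lemma abs_second_sub_le {W : U →L[ℝ] X →L[ℝ] X →L[ℝ] ℝ} {G : X →L[ℝ] N} {D : X →L[ℝ] M}
    {E : X →L[ℝ] H} {b : H} {f : X →L[ℝ] ℝ} {u₁ u₂ v : U} {y₁ y₂ φ₁ φ₂ z₁ z₂ : X}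
    {P C δ ν : ℝ} (hP : 0 ≤ P) (hC : 0 ≤ C) (hδ : 0 ≤ δ) (hν : 0 ≤ ν)
    (hE : ∀ w, ‖E w‖ ≤ P * ‖G w‖) (hf : ∀ w, ‖w‖ ≤ P * ‖G w‖)
    (hWδ : ∀ y w, |W (u₁ - u₂) y w| ≤ C * δ * ‖G y‖ * ‖G w‖)
    (hWν : ∀ y w, |W v y w| ≤ C * ν * ‖G y‖ * ‖G w‖)
    (hW₁ : ∀ y, 0 ≤ W u₁ y y) (hW₂ : ∀ y, 0 ≤ W u₂ y y)
    (hy₁ : ∀ w, D w = 0 → inner ℝ (G y₁) (G w) + W u₁ y₁ w = f w)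
    (hy₂ : ∀ w, D w = 0 → inner ℝ (G y₂) (G w) + W u₂ y₂ w = f w)
    (hφ₁ : ∀ w, D w = 0 → inner ℝ (G φ₁) (G w) + W u₁ φ₁ w = - W v y₁ w)
    (hφ₂ : ∀ w, D w = 0 → inner ℝ (G φ₂) (G w) + W u₂ φ₂ w = - W v y₂ w)
    (hz₁ : ∀ w, D w = 0 → inner ℝ (G z₁) (G w) + W u₁ z₁ w = inner ℝ (E y₁ - b) (E w))
    (hz₂ : ∀ w, D w = 0 → inner ℝ (G z₂) (G w) + W u₂ z₂ w = inner ℝ (E y₂ - b) (E w))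
    (dy₁ : D y₁ = 0) (dy₂ : D y₂ = 0) (dφ₁ : D φ₁ = 0) (dφ₂ : D φ₂ = 0) (dz₁ : D z₁ = 0)
    (dz₂ : D z₂ = 0) (α : ℝ) :
    |(α - 2 * W v φ₁ z₁ + ‖E φ₁‖ ^ 2) - (α - 2 * W v φ₂ z₂ + ‖E φ₂‖ ^ 2)| ≤
      C ^ 3 * (P * ‖f‖) * (6 * P ^ 2 * (P * ‖f‖) + 6 * (P * (P * (P * ‖f‖) + ‖b‖))) * δ * ν ^ 2 := by
  -- `Y` and `Z` are the energy bounds for the gradients of the states and of the adjoint states.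
  obtain ⟨Y, hY⟩ : ∃ Y, Y = P * ‖f‖ := ⟨_, rfl⟩
  obtain ⟨Z, hZ⟩ : ∃ Z, Z = P * (P * Y + ‖b‖) := ⟨_, rfl⟩
  have hY0 : 0 ≤ Y := by rw [hY]; positivity
  have hZ0 : 0 ≤ Z := by rw [hZ]; positivity
  have bf : ∀ w, f w ≤ Y * ‖G w‖ := fun w => by
    have h1 := (le_abs_self _).trans (f.le_opNorm w)
    have h2 := mul_le_mul_of_nonneg_left (hf w) (norm_nonneg f)
    rw [hY]; linarith
  have bE : ∀ {a : H} {k : ℝ}, ‖a‖ ≤ k → ∀ w, |inner ℝ a (E w)| ≤ k * P * ‖G w‖ := by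
    intro a k ha w
    have h1 := abs_real_inner_le_norm a (E w)
    have h2 := mul_le_mul ha (hE w) (norm_nonneg _) ((norm_nonneg a).trans ha)
    linarith
  have bW : ∀ {w : U} {k l : ℝ}, 0 ≤ k → (∀ x x', |W w x x'| ≤ C * k * ‖G x‖ * ‖G x'‖) →
      ∀ {x : X}, ‖G x‖ ≤ l → ∀ x', |W w x x'| ≤ C * k * l * ‖G x'‖ := by
    intro w k l hk h x hx x'
    refine (h x x').trans (mul_le_mul_of_nonneg_right ?_ (norm_nonneg _))
    exact mul_le_mul_of_nonneg_left hx (mul_nonneg hC hk)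
  have by₁ : ‖G y₁‖ ≤ Y := norm_le_of_energy hY0 (hW₁ _) ((hy₁ _ dy₁).le.trans (bf _))
  have by₂ : ‖G y₂‖ ≤ Y := norm_le_of_energy hY0 (hW₂ _) ((hy₂ _ dy₂).le.trans (bf _))
  have bφ₁ : ‖G φ₁‖ ≤ C * ν * Y := norm_le_of_energy (by positivity) (hW₁ _)
    ((hφ₁ _ dφ₁).le.trans ((neg_le_abs _).trans (bW hν hWν by₁ _)))
  have bφ₂ : ‖G φ₂‖ ≤ C * ν * Y := norm_le_of_energy (by positivity) (hW₂ _)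
    ((hφ₂ _ dφ₂).le.trans ((neg_le_abs _).trans (bW hν hWν by₂ _)))
  have bEy : ∀ {y : X}, ‖G y‖ ≤ Y → ‖E y - b‖ ≤ P * Y + ‖b‖ := fun {y} h =>
    (norm_sub_le _ _).trans (add_le_add_left ((hE y).trans (mul_le_mul_of_nonneg_left h hP)) _)
  have hZ' : (P * Y + ‖b‖) * P = Z := by rw [hZ, mul_comm]
  have bz₁ : ‖G z₁‖ ≤ Z := norm_le_of_energy hZ0 (hW₁ _)
    ((hz₁ _ dz₁).le.trans ((le_abs_self _).trans ((bE (bEy by₁) _).trans (by rw [hZ']))))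
  have bz₂ : ‖G z₂‖ ≤ Z := norm_le_of_energy hZ0 (hW₂ _)
    ((hz₂ _ dz₂).le.trans ((le_abs_self _).trans ((bE (bEy by₂) _).trans (by rw [hZ']))))
  -- A difference of solutions solves the equation for `u₁` with the extra source `-W (u₁ - u₂) x'`,
  -- so the energy estimate gains a factor `δ`.
  have split : ∀ x x' : X, ∀ w, inner ℝ (G (x - x')) (G w) + W u₁ (x - x') w =
      (inner ℝ (G x) (G w) + W u₁ x w) - (inner ℝ (G x') (G w) + W u₂ x' w)
        - W (u₁ - u₂) x' w := fun x x' w => by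
    simp only [map_sub, sub_apply, inner_sub_left]; ring
  have cy : ‖G (y₁ - y₂)‖ ≤ C * δ * Y := by
    have d0 : D (y₁ - y₂) = 0 := by rw [map_sub, dy₁, dy₂, sub_zero]
    refine norm_le_of_energy (by positivity) (hW₁ _) ?_
    rw [split, hy₁ _ d0, hy₂ _ d0]
    have := neg_le_abs (W (u₁ - u₂) y₂ (y₁ - y₂))
    linarith [bW hδ hWδ by₂ (y₁ - y₂)]
  have cφ : ‖G (φ₁ - φ₂)‖ ≤ 2 * (C ^ 2 * ν * δ * Y) := by
    have d0 : D (φ₁ - φ₂) = 0 := by rw [map_sub, dφ₁, dφ₂, sub_zero]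
    refine norm_le_of_energy (by positivity) (hW₁ _) ?_
    rw [split, hφ₁ _ d0, hφ₂ _ d0]
    have e1 := neg_le_abs (W (u₁ - u₂) φ₂ (φ₁ - φ₂))
    have e2 := neg_le_abs (W v (y₁ - y₂) (φ₁ - φ₂))
    have e3 : W v (y₁ - y₂) (φ₁ - φ₂) = W v y₁ (φ₁ - φ₂) - W v y₂ (φ₁ - φ₂) := by
      simp only [map_sub, sub_apply]; ring
    have e4 := bW hδ hWδ bφ₂ (φ₁ - φ₂)
    have e5 := bW hν hWν cy (φ₁ - φ₂)
    calc _ ≤ C * δ * (C * ν * Y) * ‖G (φ₁ - φ₂)‖ + C * ν * (C * δ * Y) * ‖G (φ₁ - φ₂)‖ := by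
          linarith
      _ = _ := by ring
  have cz : ‖G (z₁ - z₂)‖ ≤ P * (C * δ * Y) * P + C * δ * Z := by
    have d0 : D (z₁ - z₂) = 0 := by rw [map_sub, dz₁, dz₂, sub_zero]
    refine norm_le_of_energy (by positivity) (hW₁ _) ?_
    rw [split, hz₁ _ d0, hz₂ _ d0, ← inner_sub_left, sub_sub_sub_cancel_right, ← map_sub]
    have e1 := neg_le_abs (W (u₁ - u₂) z₂ (z₁ - z₂))
    have e4 := bW hδ hWδ bz₂ (z₁ - z₂)
    have e5 := (le_abs_self _).trans
      (bE ((hE (y₁ - y₂)).trans (mul_le_mul_of_nonneg_left cy hP)) (z₁ - z₂))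
    linarith
  have q1 : |‖E φ₁‖ ^ 2 - ‖E φ₂‖ ^ 2| ≤
      P * (2 * (C ^ 2 * ν * δ * Y)) * (P * (C * ν * Y) + P * (C * ν * Y)) := by
    have e1 : |‖E φ₁‖ - ‖E φ₂‖| ≤ P * (2 * (C ^ 2 * ν * δ * Y)) := by
      refine (abs_norm_sub_norm_le _ _).trans ?_
      rw [← map_sub]
      exact (hE _).trans (mul_le_mul_of_nonneg_left cφ hP)
    have e2 : ‖E φ₁‖ + ‖E φ₂‖ ≤ P * (C * ν * Y) + P * (C * ν * Y) :=
      add_le_add ((hE _).trans (mul_le_mul_of_nonneg_left bφ₁ hP))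
        ((hE _).trans (mul_le_mul_of_nonneg_left bφ₂ hP))
    rw [sq_sub_sq, abs_mul, abs_of_nonneg (add_nonneg (norm_nonneg (E φ₁)) (norm_nonneg (E φ₂))),
      mul_comm]
    exact mul_le_mul e1 e2 (by positivity) (by positivity)
  have q2 : |W v φ₁ z₁ - W v φ₂ z₂| ≤ C * ν * (2 * (C ^ 2 * ν * δ * Y)) * Z +
      C * ν * (C * ν * Y) * (P * (C * δ * Y) * P + C * δ * Z) := by
    have e : W v φ₁ z₁ - W v φ₂ z₂ = W v (φ₁ - φ₂) z₁ + W v φ₂ (z₁ - z₂) := by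
      simp only [map_sub, sub_apply]; ring
    rw [e]
    refine (abs_add_le _ _).trans (add_le_add ?_ ?_)
    · exact (bW hν hWν cφ z₁).trans (mul_le_mul_of_nonneg_left bz₁ (by positivity))
    · exact (bW hν hWν bφ₂ _).trans (mul_le_mul_of_nonneg_left cz (by positivity))
  rw [← hY, ← hZ]
  calc _ = |(‖E φ₁‖ ^ 2 - ‖E φ₂‖ ^ 2) - 2 * (W v φ₁ z₁ - W v φ₂ z₂)| := by congr 1; ring
    _ ≤ |‖E φ₁‖ ^ 2 - ‖E φ₂‖ ^ 2| + 2 * |W v φ₁ z₁ - W v φ₂ z₂| := by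
      refine (abs_sub _ _).trans (le_of_eq ?_)
      rw [abs_mul, abs_two]
    _ ≤ _ := add_le_add q1 (mul_le_mul_of_nonneg_left q2 zero_le_two)
    _ = _ := by ring

end Estimate

/-! ### The Stokes--Brinkman operator -/

section

variable {d : ℕ} {Ω : LipschitzDomain d}

instance : CompleteSpace (L20 Ω) := by
  have h : IsClosed (L20 Ω : Set (L2 Ω)) := by
    have : (L20 Ω : Set (L2 Ω)) = meanL Ω ⁻¹' {0} := Set.ext fun q => mem_L20
    rw [this]
    exact isClosed_singleton.preimage (meanL Ω).continuous
  exact h.completeSpace_coe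

/-- The divergence as a continuous linear map into `L²₀(Ω)`. -/
def divL0 (Ω : LipschitzDomain d) : H10 Ω →L[ℝ] L20 Ω :=
  (divL Ω).codRestrict (L20 Ω) fun v => mem_L20.2 (meanL_divL v)

lemma divL0_surjective (hd : d = 2 ∨ d = 3) (Ω : LipschitzDomain d) :
    Function.Surjective (divL0 Ω) := fun q => by
  obtain ⟨v, hv⟩ := exists_divL_eq_of_meanL_eq_zero hd (mem_L20.1 q.2)
  exact ⟨v, Subtype.ext hv⟩

lemma pairDiv_eq_inner (q : L20 Ω) (v : H10 Ω) : pairDiv q v = inner ℝ q (divL0 Ω v) := by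
  rw [pairDiv_eq, real_inner_comm]; rfl

/-- The form `(∇𝐲, ∇𝐯)`. -/
def gradForm (Ω : LipschitzDomain d) : H10 Ω →L[ℝ] H10 Ω →L[ℝ] ℝ :=
  (innerSL ℝ).bilinearComp (gradL Ω) (gradL Ω)

lemma gradForm_apply (y v : H10 Ω) : gradForm Ω y v = inner ℝ (gradL Ω y) (gradL Ω v) := rfl

/-- The functional `v ↦ (a, 𝐯)`. -/
def pairVel (Ω : LipschitzDomain d) : L2Vec Ω →L[ℝ] H10 Ω →L[ℝ] ℝ :=
  (innerSL ℝ).bilinearComp (ContinuousLinearMap.id ℝ (L2Vec Ω)) (velL Ω)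

lemma pairVel_apply (a : L2Vec Ω) (v : H10 Ω) : pairVel Ω a v = inner ℝ a (velL Ω v) := rfl

/-- The form `(w 𝐲, 𝐯)`, linear in the coefficient `w`. -/
def weightForm (Ω : LipschitzDomain d) : LInf Ω →L[ℝ] H10 Ω →L[ℝ] H10 Ω →L[ℝ] ℝ :=
  pullbackForm (mulInf Ω) (velL Ω)

lemma weightForm_apply (w : LInf Ω) (y v : H10 Ω) : weightForm Ω w y v = weighted w y v :=
  (pullbackForm_apply _ _ w y v).trans (weighted_eq w y v).symm

lemma weightForm_comm (w : LInf Ω) (y v : H10 Ω) : weightForm Ω w y v = weightForm Ω w v y := by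
  rw [weightForm_apply, weightForm_apply, weighted_comm]

lemma weighted_self_nonneg {u : LInf Ω} (hu : ∀ᵐ x ∂Ω.vol, 0 ≤ u x) (y : H10 Ω) :
    0 ≤ weighted u y y :=
  integral_nonneg_of_ae (hu.mono fun _ hx => mul_nonneg hx real_inner_self_nonneg)

/-- The inclusion of `L^∞(Ω)` in `L²(Ω)`. -/
def inclL2 (Ω : LipschitzDomain d) : LInf Ω →L[ℝ] L2 Ω :=
  ((ContinuousLinearMap.lsmul ℝ ℝ).holderL Ω.vol ∞ 2 2).flip ((memLp_const (1 : ℝ)).toLp _)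

lemma norm_inclL2 (w : LInf Ω) : ‖inclL2 Ω w‖ = normL2 w := by
  rw [Lp.norm_def, normL2]
  congr 1
  refine eLpNorm_congr_ae ?_
  filter_upwards [(ContinuousLinearMap.lsmul ℝ ℝ).coeFn_holder (r := 2) w
    ((memLp_const (1 : ℝ)).toLp (μ := Ω.vol) (p := 2) fun _ => (1 : ℝ)),
    (memLp_const (1 : ℝ)).coeFn_toLp (μ := Ω.vol) (p := 2)] with x hx h1
  refine hx.trans ?_
  rw [h1]; simp

/-- The operator of the state equations. -/
def stateOp (u : LInf Ω) : H10 Ω × L20 Ω →L[ℝ] (H10 Ω →L[ℝ] ℝ) × (L20 Ω →L[ℝ] ℝ) :=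
  saddle (gradForm Ω + weightForm Ω u) (divL0 Ω)

lemma stateOp_fst (u : LInf Ω) (x : H10 Ω × L20 Ω) (v : H10 Ω) :
    (stateOp u x).1 v =
      inner ℝ (gradL Ω x.1) (gradL Ω v) + weighted u x.1 v - inner ℝ x.2 (divL0 Ω v) := by
  rw [stateOp, saddle_apply_fst, add_apply, add_apply, gradForm_apply, weightForm_apply]

lemma stateOp_snd (u : LInf Ω) (x : H10 Ω × L20 Ω) (q : L20 Ω) :
    (stateOp u x).2 q = pairDiv q x.1 := by
  rw [stateOp, saddle_apply_snd, pairDiv_eq_inner, real_inner_comm]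

lemma stateOp_eq_iff {u : LInf Ω} {x : H10 Ω × L20 Ω} {F : H10 Ω →L[ℝ] ℝ} :
    stateOp u x = (F, 0) ↔ (∀ v, inner ℝ (gradL Ω x.1) (gradL Ω v) + weighted u x.1 v
      - inner ℝ x.2 (divL0 Ω v) = F v) ∧ ∀ q : L20 Ω, pairDiv q x.1 = 0 := by
  rw [Prod.ext_iff, ContinuousLinearMap.ext_iff, ContinuousLinearMap.ext_iff]
  exact and_congr (forall_congr' fun v => by rw [stateOp_fst])
    (forall_congr' fun q => by rw [stateOp_snd]; rfl)

lemma isState_iff {f : HNeg Ω} {u : LInf Ω} {x : H10 Ω × L20 Ω} :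
    IsState f u x ↔ stateOp u x = (f, 0) := by
  rw [stateOp_eq_iff]
  exact and_congr (forall_congr' fun v => by rw [pairDiv_eq_inner]; rfl) Iff.rfl

/-- The forms are symmetric, so the adjoint equations differ from the state equations only in the
sign of the pressure. One bijectivity result serves both. -/
lemma isAdjoint_iff {f : HNeg Ω} {yΩ : L2Vec Ω} {u : LInf Ω} {z : H10 Ω} {r : L20 Ω} :
    IsAdjoint f yΩ u (z, r) ↔
      stateOp u (z, -r) = (pairVel Ω (velL Ω (controlToState f u).1 - yΩ), 0) := by
  rw [stateOp_eq_iff]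
  refine and_congr (forall_congr' fun v => ?_) Iff.rfl
  rw [pairDiv_eq_inner, pairVel_apply, inner_neg_left, sub_neg_eq_add,
    real_inner_comm (gradL Ω v)]
  rfl

lemma stateOp_bijective (hd : d = 2 ∨ d = 3) {u : LInf Ω} (hu : ∀ᵐ x ∂Ω.vol, 0 ≤ u x) :
    Function.Bijective (stateOp u) := by
  obtain ⟨C, hC, h⟩ := exists_norm_le_grad hd Ω
  refine saddle_bijective _ _ (divL0_surjective hd Ω) (c := (C ^ 2)⁻¹) (by positivity) fun y => ?_
  rw [add_apply, add_apply, gradForm_apply, weightForm_apply, real_inner_self_eq_norm_sq]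
  have h1 := weighted_self_nonneg hu y
  have h2 : ‖y‖ * ‖y‖ ≤ C ^ 2 * ‖gradL Ω y‖ ^ 2 := by
    have := mul_self_le_mul_self (norm_nonneg y) (h y)
    rw [grad_eq_gradL] at this
    linarith
  rw [mul_assoc, inv_mul_le_iff₀ (by positivity)]
  nlinarith [sq_nonneg C]

lemma existsUnique_isState (hd : d = 2 ∨ d = 3) {u : LInf Ω} (hu : ∀ᵐ x ∂Ω.vol, 0 ≤ u x)
    (f : HNeg Ω) : ∃! yp, IsState f u yp := by
  simpa only [isState_iff] using (stateOp_bijective hd hu).existsUnique (f, 0)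

lemma existsUnique_isAdjoint (hd : d = 2 ∨ d = 3) {u : LInf Ω} (hu : ∀ᵐ x ∂Ω.vol, 0 ≤ u x)
    (f : HNeg Ω) (yΩ : L2Vec Ω) : ∃! zr, IsAdjoint f yΩ u zr := by
  obtain ⟨⟨z, r⟩, h1, h2⟩ := (stateOp_bijective hd hu).existsUnique
    (pairVel Ω (velL Ω (controlToState f u).1 - yΩ), 0)
  refine ⟨(z, -r), isAdjoint_iff.2 (by rw [neg_neg]; exact h1), ?_⟩
  rintro ⟨z', r'⟩ h
  obtain ⟨rfl, h3⟩ := Prod.ext_iff.1 (h2 _ (isAdjoint_iff.1 h))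
  exact Prod.ext rfl (neg_eq_iff_eq_neg.1 h3)

lemma isState_controlToState {f : HNeg Ω} {u : LInf Ω} (h : ∃ yp, IsState f u yp) :
    IsState f u (controlToState f u) := by
  rw [controlToState, dif_pos h]
  exact h.choose_spec

end

/-! ### The reduced cost -/

section

variable {d : ℕ} {Ω : LipschitzDomain d}

/-- Nearby coefficients may be negative somewhere, yet the equations remain solvable because
invertibility is an open condition. Thus `u ≥ 0` at the base point suffices. -/
lemma controlToState_smooth (hd : d = 2 ∨ d = 3) {u : LInf Ω} (hu : ∀ᵐ x ∂Ω.vol, 0 ≤ u x)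
    (f : HNeg Ω) : (∀ᶠ u' in 𝓝 u, stateOp u' (controlToState f u') = (f, 0)) ∧
      ContDiffAt ℝ 2 (controlToState f) u := by
  have hS : ∀ u', (∃ x, stateOp u' x = (f, 0)) → stateOp u' (controlToState f u') = (f, 0) :=
    fun u' ⟨x, hx⟩ => isState_iff.1 (isState_controlToState ⟨x, isState_iff.2 hx⟩)
  exact contDiffAt_of_forall_saddle_eq (A := gradForm Ω) (W := weightForm Ω) (D := divL0 Ω)
    (F := (f, 0)) (stateOp_bijective hd hu) hS

lemma reducedCost_eq (α : ℝ) (f : HNeg Ω) (yΩ : L2Vec Ω) : reducedCost α f yΩ = fun u =>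
    1 / 2 * ‖velL Ω (controlToState f u).1 - yΩ‖ ^ 2 + α / 2 * ‖inclL2 Ω u‖ ^ 2 := by
  funext u
  rw [norm_inclL2]; rfl

lemma contDiffAt_reducedCost (hd : d = 2 ∨ d = 3) {u : LInf Ω} (hu : ∀ᵐ x ∂Ω.vol, 0 ≤ u x)
    (α : ℝ) (f : HNeg Ω) (yΩ : L2Vec Ω) : ContDiffAt ℝ 2 (reducedCost α f yΩ) u := by
  have h1 := contDiffAt_half_norm_sq
    ((velL Ω).comp (ContinuousLinearMap.fst ℝ (H10 Ω) (L20 Ω))) yΩ (controlToState_smooth hd hu f).2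
  have h2 : ContDiffAt ℝ 2 (fun u => α / 2 * ‖inclL2 Ω u‖ ^ 2) u :=
    contDiffAt_const.mul ((inclL2 Ω).contDiff.contDiffAt.norm_sq ℝ)
  rw [reducedCost_eq]
  exact h1.add h2

lemma gradForm_comm (y v : H10 Ω) : gradForm Ω y v = gradForm Ω v y := by
  rw [gradForm_apply, gradForm_apply, real_inner_comm]

lemma divL0_eq_zero {v : H10 Ω} (h : ∀ q : L20 Ω, pairDiv q v = 0) : divL0 Ω v = 0 := by
  have := h (divL0 Ω v)
  rw [pairDiv_eq_inner] at this
  exact inner_self_eq_zero.1 this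

/-- The second derivative of the reduced cost. -/
lemma secondDeriv_reducedCost (hd : d = 2 ∨ d = 3) {u : LInf Ω} (hu : ∀ᵐ x ∂Ω.vol, 0 ≤ u x)
    (α : ℝ) (f : HNeg Ω) (yΩ : L2Vec Ω) {zr : H10 Ω × L20 Ω} (hz : IsAdjoint f yΩ u zr)
    (v : LInf Ω) : secondDeriv (reducedCost α f yΩ) u v =
      α * normL2 v ^ 2 - 2 * weighted v (fderiv ℝ (controlToState f) u v).1 zr.1
        + ‖vel (fderiv ℝ (controlToState f) u v).1‖ ^ 2 := by
  obtain ⟨heq, hS⟩ := controlToState_smooth hd hu f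
  have hadj : ∀ w, (gradForm Ω + weightForm Ω u) zr.1 w + inner ℝ zr.2 (divL0 Ω w) =
      inner ℝ (velL Ω (controlToState f u).1 - yΩ) (velL Ω w) := fun w => by
    rw [add_apply, add_apply, gradForm_apply, weightForm_apply, ← pairDiv_eq_inner,
      real_inner_comm]
    exact hz.1 w
  rw [reducedCost_eq, secondDeriv, ← norm_inclL2, ← weightForm_apply]
  exact second_fderiv_reduced (A := gradForm Ω) (W := weightForm Ω) (D := divL0 Ω) (F := (f, 0))
    (S := controlToState f) gradForm_comm weightForm_comm hS heq (velL Ω) yΩ (inclL2 Ω) α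
    (z := zr.1) (r := zr.2) hadj (divL0_eq_zero hz.2) v

/-- The linearized state equations. -/
lemma stateOp_fderiv (hd : d = 2 ∨ d = 3) {u : LInf Ω} (hu : ∀ᵐ x ∂Ω.vol, 0 ≤ u x) (f : HNeg Ω)
    (v : LInf Ω) : stateOp u (fderiv ℝ (controlToState f) u v) =
      (- weightForm Ω v (controlToState f u).1, 0) := by
  obtain ⟨heq, hS⟩ := controlToState_smooth hd hu f
  exact (saddle_fderiv (A := gradForm Ω) (W := weightForm Ω) (D := divL0 Ω) (F := (f, 0)) hS heq v).1

/-- Solutions of the momentum equation, tested with solenoidal fields. -/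
lemma stateOp_solenoidal {u : LInf Ω} {x : H10 Ω × L20 Ω} {F : H10 Ω →L[ℝ] ℝ}
    (h : stateOp u x = (F, 0)) : divL0 Ω x.1 = 0 ∧ ∀ w, divL0 Ω w = 0 →
      inner ℝ (gradL Ω x.1) (gradL Ω w) + weightForm Ω u x.1 w = F w := by
  obtain ⟨h1, h2⟩ := stateOp_eq_iff.1 h
  refine ⟨divL0_eq_zero h2, fun w hw => ?_⟩
  have := h1 w
  rw [hw, inner_zero_right, sub_zero] at this
  rw [weightForm_apply, this]

/-- The Lipschitz property of the second derivative of the reduced cost, with an explicit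
constant. -/
lemma abs_secondDeriv_sub_le (hd : d = 2 ∨ d = 3) {P C : ℝ} (hP : 0 ≤ P) (hC : 0 ≤ C)
    (hPv : ∀ v : H10 Ω, ‖v‖ ≤ P * ‖grad v‖)
    (hCw : ∀ (w : LInf Ω) (y v : H10 Ω), |weighted w y v| ≤ C * normL2 w * ‖grad y‖ * ‖grad v‖)
    (f : HNeg Ω) (yΩ : L2Vec Ω) (α : ℝ) {u₁ u₂ : LInf Ω} (hu₁ : ∀ᵐ x ∂Ω.vol, 0 ≤ u₁ x)
    (hu₂ : ∀ᵐ x ∂Ω.vol, 0 ≤ u₂ x) (v : LInf Ω) :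
    |secondDeriv (reducedCost α f yΩ) u₁ v - secondDeriv (reducedCost α f yΩ) u₂ v| ≤
      C ^ 3 * (P * ‖f‖) * (6 * P ^ 2 * (P * ‖f‖) + 6 * (P * (P * (P * ‖f‖) + ‖yΩ‖)))
        * normL2 (u₁ - u₂) * normL2 v ^ 2 := by
  obtain ⟨⟨z₁, r₁⟩, hz₁⟩ := (existsUnique_isAdjoint hd hu₁ f yΩ).exists
  obtain ⟨⟨z₂, r₂⟩, hz₂⟩ := (existsUnique_isAdjoint hd hu₂ f yΩ).exists
  have b : ∀ (w : LInf Ω) (y y' : H10 Ω),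
      |weightForm Ω w y y'| ≤ C * normL2 w * ‖gradL Ω y‖ * ‖gradL Ω y'‖ := fun w y y' => by
    rw [weightForm_apply]; exact hCw w y y'
  have pos : ∀ u : LInf Ω, (∀ᵐ x ∂Ω.vol, 0 ≤ u x) → ∀ y, 0 ≤ weightForm Ω u y y := fun u hu y => by
    rw [weightForm_apply]; exact weighted_self_nonneg hu y
  obtain ⟨dy₁, ey₁⟩ := stateOp_solenoidal (controlToState_smooth hd hu₁ f).1.self_of_nhds
  obtain ⟨dy₂, ey₂⟩ := stateOp_solenoidal (controlToState_smooth hd hu₂ f).1.self_of_nhds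
  obtain ⟨dφ₁, eφ₁⟩ := stateOp_solenoidal (stateOp_fderiv hd hu₁ f v)
  obtain ⟨dφ₂, eφ₂⟩ := stateOp_solenoidal (stateOp_fderiv hd hu₂ f v)
  obtain ⟨dz₁, ez₁⟩ := stateOp_solenoidal (isAdjoint_iff.1 hz₁)
  obtain ⟨dz₂, ez₂⟩ := stateOp_solenoidal (isAdjoint_iff.1 hz₂)
  rw [secondDeriv_reducedCost hd hu₁ α f yΩ hz₁, secondDeriv_reducedCost hd hu₂ α f yΩ hz₂,
    ← weightForm_apply, ← weightForm_apply]
  -- The last argument is the common term `α ‖v‖²`, which cancels in the difference.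
  exact abs_second_sub_le (W := weightForm Ω) (G := gradL Ω) (D := divL0 Ω) (E := velL Ω) (b := yΩ)
    (f := f) (u₁ := u₁) (u₂ := u₂) (v := v) hP hC (normL2_nonneg (u₁ - u₂))
    (normL2_nonneg v) (fun w => (norm_vel_le w).trans (hPv w)) hPv (b _) (b v) (pos _ hu₁)
    (pos _ hu₂) ey₁ ey₂ eφ₁ eφ₂ ez₁ ez₂ dy₁ dy₂ dφ₁ dφ₂ dz₁ dz₂ (α * normL2 v ^ 2)

end

end StokesBrinkman

end

theorem mainTheorem4 (d : ℕ) (hd : d = 2 ∨ d = 3) (Ω : LipschitzDomain d) :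
    ∃ D : ℝ → ℝ → ℝ, (∀ s t : ℝ, 0 < D s t) ∧
      ∀ (f : HNeg Ω) (yΩ : L2Vec Ω) (α a b : ℝ), 0 < α → 0 < a → a < b →
        -- the control-to-state map and the reduced cost are well defined on `𝒰`; `j` is `C²`
        (∀ u ∈ coefficients Ω, (∃! yp, IsState f u yp) ∧
          ContDiffAt ℝ 2 (reducedCost α f yΩ) u) ∧
        -- the formula for the second derivative
        (∀ u ∈ admissible Ω a b, DifferentiableAt ℝ (controlToState f) u ∧
          (∃! zr, IsAdjoint f yΩ u zr) ∧
            ∀ zr, IsAdjoint f yΩ u zr → ∀ v : LInf Ω,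
              secondDeriv (reducedCost α f yΩ) u v =
                α * normL2 v ^ 2
                  - 2 * weighted v (fderiv ℝ (controlToState f) u v).1 zr.1
                  + ‖vel (fderiv ℝ (controlToState f) u v).1‖ ^ 2) ∧
        -- the Lipschitz property of the second derivative
        (∀ u₁ ∈ admissible Ω a b, ∀ u₂ ∈ admissible Ω a b, ∀ v : LInf Ω,
          |secondDeriv (reducedCost α f yΩ) u₁ v - secondDeriv (reducedCost α f yΩ) u₂ v|
            ≤ D ‖f‖ ‖yΩ‖ * normL2 (u₁ - u₂) * normL2 v ^ 2) := by
  obtain ⟨P, hP, hPv⟩ := exists_norm_le_grad hd Ω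
  obtain ⟨C, hC, hCw⟩ := exists_weighted_le hd Ω
  -- The absolute values and the `+ 1` make the function positive on all of `ℝ²`; at the norms the
  -- absolute values disappear. `P` and `C` depend only on `Ω`.
  refine ⟨fun s t =>
    C ^ 3 * (P * |s|) * (6 * P ^ 2 * (P * |s|) + 6 * (P * (P * (P * |s|) + |t|))) + 1,
    fun s t => by positivity, fun f yΩ α a b _ ha _ => ?_⟩
  have hadm : ∀ u ∈ admissible Ω a b, ∀ᵐ x ∂Ω.vol, 0 ≤ u x := fun u hu =>
    Filter.Eventually.mono hu fun _ hx => ha.le.trans hx.1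
  refine ⟨fun u ⟨c, hc, hu⟩ => ?_, fun u hu => ?_, fun u₁ hu₁ u₂ hu₂ v => ?_⟩
  · have hu0 := hu.mono fun _ hx => (hc.trans hx).le
    exact ⟨existsUnique_isState hd hu0 f, contDiffAt_reducedCost hd hu0 α f yΩ⟩
  · have hu0 := hadm u hu
    exact ⟨(controlToState_smooth hd hu0 f).2.differentiableAt (by simp),
      existsUnique_isAdjoint hd hu0 f yΩ,
      fun zr hz v => secondDeriv_reducedCost hd hu0 α f yΩ hz v⟩
  · refine (abs_secondDeriv_sub_le hd hP.le hC.le hPv hCw f yΩ α (hadm u₁ hu₁) (hadm u₂ hu₂)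
      v).trans ?_
    beta_reduce
    rw [abs_of_nonneg (norm_nonneg f), abs_of_nonneg (norm_nonneg yΩ)]
    have := mul_nonneg (normL2_nonneg (u₁ - u₂)) (sq_nonneg (normL2 v))
    linarith
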